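/- Let $\mathfrak n\ge 2$, $\hbar\in\mathbb C$, let $P=\sum_{i,j}E_{ij}\otimes E_{ji}$ and $R(u)=u\,\mathbb I\otimes\mathbb I-\hbar P$ on $\mathbb C^{\mathfrak n}\otimes\mathbb C^{\mathfrak n}$, let $\mathbb I^{(k)}=\sum_{i\ge k}E_{ii}$, and put $$\mathbb R^{(k,p)}(u)=\frac{1}{u-\hbar}\,(\mathbb I^{(k)}\otimes\mathbb I^{(p)})\,R(u)\,(\mathbb I^{(k)}\otimes\mathbb I^{(p)}).$$ Let $\mathcal Y_{\mathfrak n}$ be the Yangian, generated by $t_{ij}^{(p)}$ ($1\le i,j\le\mathfrak n$, $p\ge1$) with the relations $R_{12}(u-v)T_1(u)T_2(v)=T_2(v)T_1(u)R_{12}(u-v)$, where $T(u)=\sum_{i,j} E_{ij}\otimes t_{ij}(u)$ and $t_{ij}(u)=\delta_{ij}+\sum_{p\ge1}t_{ij}^{(p)}u^{-p}$. Let $V$ be a finite-dimensional representation of $\mathcal Y_{\mathfrak n}$ with a highest weight vector $\Omega\ne0$, that is, $t_{ij}(u)\Omega=0$ for $i>j$ and $t_{ii}(u)\Omega=\lambda_i(u)\Omega$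 with scalar series $\lambda_i(u)$, and suppose that $T(u)$, multiplied by some nonzero scalar Laurent series in $u^{-1}$, is polynomial in $u$ on $V$, as it is for tensor products of evaluation representations; from now on $T(u)$ denotes this polynomial. Let $c\in\mathbb C$, let $a\ge 0$ be an integer, let $K^-(u)$ be the diagonal matrix whose $i$-th entry is $u-c$ for $i\le a$ and $-u-c$ for $i>a$, and let $D(u)=T(u)K^-(u)T^{-1}(-u)$ with entries $d_{ij}(u)$. For $1\le k\le\mathfrak n$ let $$\widehat D^{(k)}(u)=\sum_{i,j\ge k}E_{ij}\otimes d^{(k)}_{ij}(u),\qquad d^{(k)}_{ij}(u)=d_{ij}\big(u+\tfrac{(k-1)\hbar}2\big)+\delta_{ij}\sum_{q=1}^{k-1}\tfrac{\hbar}{2u}\,d_{qq}\big(u+\tfrac{(k-1)\hbar}2\big).$$ Let $M_1,\dots,M_{\mathfrak n-1}\ge0$ be integers and $u_{ij}$ ($1\le i\le\mathfrak n-1$, $1\le j\le M_i$) complex numbers, and let $A_i$ be the ordered sequence $a^i_1,\dots,a^i_{M_i}$ of copies of $\mathbb C^{\mathfrak n}$. Define $$\Phi^{\mathfrak n}(\{u\})=tr_{A_1\cdots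 A_{\mathfrak n-1}}\Big(\prod_{i=1}^{\mathfrak n-1}\widehat{\mathbb D}^{(i)}_{A_i}\;E_{\mathfrak n,\mathfrak n-1}^{\otimes M_{\mathfrak n-1}}\otimes\cdots\otimes E_{21}^{\otimes M_1}\Big),\qquad \widehat{\mathbb D}^{(i)}_{A_i}=\prod_{j=1}^{M_i}\overline{\mathcal R}^{(i)}_j\,\widehat D^{(i)}_{a^i_j}\big(u_{ij}+\tfrac\hbar2\big)\,\mathcal R^{(i)}_j,$$ $$\overline{\mathcal R}^{(i)}_j=\prod_{b<i}^{\longleftarrow}\ \prod_{c=1,\dots,M_b}^{\longrightarrow}\mathbb R^{(i,b+1)}_{a^i_ja^b_c}\big(u_{ij}+u_{bc}+\tfrac{(i-b)\hbar}2\big),\qquad \mathcal R^{(i)}_j=\prod_{b<i}^{\longrightarrow}\ \prod_{c=1,\dots,M_b}^{\longleftarrow}\mathbb R^{(i,b+1)}_{a^i_ja^b_c}\big(u_{ij}-u_{bc}+\tfrac{(i-b)\hbar}2\big),$$ where products without an arrow, and those with an arrow to the right, are ordered with increasing index from left to right, and those with an arrow to the left with decreasing index. Suppose that all factors are defined: $T(-u_{ij}-\tfrac{i\hbar}2)$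 is invertible for all $i,j$; $2u_{ij}+\hbar\ne0$ for $i\ge2$; and $u_{ij}\pm u_{bc}+\tfrac{(i-b)\hbar}2\ne\hbar$ for $b<i$. Then: 1. (Invariance.) $\Phi^{\mathfrak n}(\{u\})\Omega$ does not change when, for every $i$, the same permutation is applied to the places of $a^i_1,\dots,a^i_{M_i}$ and of $u_{i1},\dots,u_{iM_i}$ in the formula. Equivalently, it is symmetric in $u_{i1},\dots,u_{iM_i}$ for every $i$. 2. (Recursion.) Suppose in addition that $2u_{ij}+l\hbar\ne0$ for $1\le l\le i-1$. For a family $X(u)$ of $\mathfrak n\times\mathfrak n$ matrices over an algebra, let $\Phi^{\mathfrak n}[X]$ be the trace formula with $X$ in the place of $D$. Let $\widehat B^{(1)}(u)=\sum_{j=2}^{\mathfrak n}e_j^t\otimes d_{1j}(u+\tfrac\hbar2)$ be a row with operator entries, and let $D'(u)$ be the $(\mathfrak n-1)\times(\mathfrak n-1)$ matrix, with entries in $End((\mathbb C^{\mathfrak n-1})^{\otimes M_1}\otimes V)$, $$D'(u)=\mathbb R_{1}(u+u_{11})\cdots\mathbb R_{M_1}(u+u_{1M_1})\,\widehat D^{(2)}(u)\,\mathbb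 R_{M_1}(u-u_{1M_1})\cdots\mathbb R_{1}(u-u_{11}),$$ where $\mathbb C^{\mathfrak n-1}$ has the basis $e_2,\dots,e_{\mathfrak n}$ and $\mathbb R_c$ is the normalized $R$-matrix $R/(u-\hbar)$ of rank $\mathfrak n-1$ between the matrix space and the $c$-th of the $M_1$ spaces. This $D'$ is the image of the generating matrix $D$ of rank $\mathfrak n-1$ under $(\bar\pi^{(2)}_{u_{11}}\otimes\cdots\otimes\bar\pi^{(2)}_{u_{1M_1}}\otimes\mathbb I)\circ\Delta^{(M_1)}\circ\tau$, with $\tau(D)=\widehat D^{(2)}$, $\Delta(D)=TDT^{-1}(-u)$, $\bar\pi^{(2)}_{a}(T(u))=\mathbb R(u+a)$ and $\bar\pi^{(2)}_{a}(T^{-1}(-u))=\mathbb R(u-a)$. Then $$\Phi^{\mathfrak n}[D](\{u\})\,\Omega=\widehat B^{(1)}_{a^1_1}(u_{11})\cdots\widehat B^{(1)}_{a^1_{M_1}}(u_{1M_1})\;\Phi^{\mathfrak n-1}[D'](\{u\}\setminus\{u_1\})\;e_2^{\otimes M_1}\otimes\Omega .$$ Moreover $\Phi^{\mathfrak n}[D](\{u\})\Omega$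 is equal to the vector that is built from $\Phi^1=1$ by using this recursion at every rank. -/

import Mathlib

open scoped Kronecker

namespace OpenChain

noncomputable section

/-! ### Rational R-matrices -/

/-- The permutation `P = ∑ E_{ij} ⊗ E_{ji}` of two copies of the `n`-dimensional auxiliary space. -/
def permP (A : Type*) [Ring A] (n : ℕ) : Matrix (Fin n × Fin n) (Fin n × Fin n) A :=
  ∑ i : Fin n, ∑ j : Fin n, Matrix.single i j (1 : A) ⊗ₖ Matrix.single j i (1 : A)

/-- `R(u) = u 𝕀 ⊗ 𝕀 - ħ P`. -/
def rMatrix (ħ : ℂ) (n : ℕ) (u : ℂ) : Matrix (Fin n × Fin n) (Fin n × Fin n) ℂ :=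
  u • (1 : Matrix (Fin n × Fin n) (Fin n × Fin n) ℂ) - ħ • permP ℂ n

/-- The projector `𝕀^{(m+1)} = ∑_{i ≥ m} E_{ii}`; the indices `i` are counted from `0`. -/
def proj (n m : ℕ) : Matrix (Fin n) (Fin n) ℂ :=
  Matrix.diagonal fun i => if m ≤ (i : ℕ) then 1 else 0

/-- The normalized reduced matrix
`ℝ^{(k+1,p+1)}(u) = (u - ħ)⁻¹ (𝕀^{(k+1)} ⊗ 𝕀^{(p+1)}) R(u) (𝕀^{(k+1)} ⊗ 𝕀^{(p+1)})`. -/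
def normR (ħ : ℂ) (n k p : ℕ) (u : ℂ) : Matrix (Fin n × Fin n) (Fin n × Fin n) ℂ :=
  (u - ħ)⁻¹ • ((proj n k ⊗ₖ proj n p) * rMatrix ħ n u * (proj n k ⊗ₖ proj n p))

/-! ### The Yangian of `gl_n` in the RTT presentation -/

/-- The coefficients `T^{(p)}` of `T(u) = 1 + ∑_{p ≥ 1} T^{(p)} u^{-p}`, with free entries;
the generator with label `(p, i, j)` is `t_{ij}^{(p+1)}`. -/
def tFree (n : ℕ) : ℕ → Matrix (Fin n) (Fin n) (FreeAlgebra ℂ (ℕ × Fin n × Fin n))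
  | 0 => 1
  | p + 1 => Matrix.of fun i j => FreeAlgebra.ι ℂ (p, i, j)

/-- `T_1^{(p)} = T^{(p)} ⊗ 1`. -/
def tFree₁ (n p : ℕ) :
    Matrix (Fin n × Fin n) (Fin n × Fin n) (FreeAlgebra ℂ (ℕ × Fin n × Fin n)) :=
  tFree n p ⊗ₖ (1 : Matrix (Fin n) (Fin n) (FreeAlgebra ℂ (ℕ × Fin n × Fin n)))

/-- `T_2^{(p)} = 1 ⊗ T^{(p)}`. -/
def tFree₂ (n p : ℕ) :
    Matrix (Fin n × Fin n) (Fin n × Fin n) (FreeAlgebra ℂ (ℕ × Fin n × Fin n)) :=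
  (1 : Matrix (Fin n) (Fin n) (FreeAlgebra ℂ (ℕ × Fin n × Fin n))) ⊗ₖ tFree n p

/-- The coefficient of `u^{-r} v^{-s}` in `R₁₂(u-v) T₁(u) T₂(v)`. -/
def rttLeft (ħ : ℂ) (n r s : ℕ) :
    Matrix (Fin n × Fin n) (Fin n × Fin n) (FreeAlgebra ℂ (ℕ × Fin n × Fin n)) :=
  tFree₁ n (r + 1) * tFree₂ n s - tFree₁ n r * tFree₂ n (s + 1)
    - ħ • (permP _ n * tFree₁ n r * tFree₂ n s)

/-- The coefficient of `u^{-r} v^{-s}` in `T₂(v) T₁(u) R₁₂(u-v)`. -/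
def rttRight (ħ : ℂ) (n r s : ℕ) :
    Matrix (Fin n × Fin n) (Fin n × Fin n) (FreeAlgebra ℂ (ℕ × Fin n × Fin n)) :=
  tFree₂ n s * tFree₁ n (r + 1) - tFree₂ n (s + 1) * tFree₁ n r
    - ħ • (tFree₂ n s * tFree₁ n r * permP _ n)

/-- The RTT relations `R₁₂(u-v) T₁(u) T₂(v) = T₂(v) T₁(u) R₁₂(u-v)`, coefficient by coefficient.
The coefficients of `u v^{-s}` and `u^{-r} v` agree trivially, because `T^{(0)} = 1`. -/
inductive YangianRel (ħ : ℂ) (n : ℕ) :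
    FreeAlgebra ℂ (ℕ × Fin n × Fin n) → FreeAlgebra ℂ (ℕ × Fin n × Fin n) → Prop
  | rtt (r s : ℕ) (x y : Fin n × Fin n) :
      YangianRel ħ n (rttLeft ħ n r s x y) (rttRight ħ n r s x y)

/-- The Yangian `𝒴_n`. -/
abbrev Yangian (ħ : ℂ) (n : ℕ) : Type := RingQuot (YangianRel ħ n)

/-- `t_{ij}^{(p)}` in the Yangian, with `t_{ij}^{(0)} = δ_{ij}`. -/
def Yangian.t (ħ : ℂ) (n p : ℕ) (i j : Fin n) : Yangian ħ n :=
  RingQuot.mkAlgHom ℂ (YangianRel ħ n) (tFree n p i j)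

/-- `Ω` is a highest weight vector: `Ω ≠ 0`, `t_{ij}(u) Ω = 0` for `i > j` and
`t_{ii}(u) Ω = λ_i(u) Ω` for formal series `λ_i(u)` in `u⁻¹`. -/
structure IsHighestWeightVector {ħ : ℂ} {n : ℕ} {V : Type*} [AddCommGroup V] [Module ℂ V]
    (ρ : Yangian ħ n →ₐ[ℂ] Module.End ℂ V) (Ω : V) : Prop where
  ne_zero : Ω ≠ 0
  lower : ∀ (p : ℕ) (i j : Fin n), j < i → ρ (Yangian.t ħ n p i j) Ω = 0
  diag : ∀ i : Fin n, ∃ lam : ℕ → ℂ, ∀ p : ℕ, ρ (Yangian.t ħ n p i i) Ω = lam p • Ω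

/-- The polynomial matrix `T` is a normalization of the monodromy matrix of the representation `ρ`:
`T(u) = u^d f(u) (1 + ∑_{p ≥ 1} ρ(T^{(p)}) u^{-p})` for a natural number `d` and a scalar formal
series `f(u) = f₀ + f₁ u⁻¹ + ⋯` with `f₀ ≠ 0`. -/
def IsMonodromy {ħ : ℂ} {n : ℕ} {V : Type*} [AddCommGroup V] [Module ℂ V]
    (ρ : Yangian ħ n →ₐ[ℂ] Module.End ℂ V)
    (T : Matrix (Fin n) (Fin n) (Polynomial (Module.End ℂ V))) : Prop :=
  ∃ (d : ℕ) (f : ℕ → ℂ), f 0 ≠ 0 ∧ ∀ i j : Fin n, (T i j).natDegree ≤ d ∧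
    ∀ m : ℕ, ∑ x ∈ Finset.HasAntidiagonal.antidiagonal m, f x.1 • ρ (Yangian.t ħ n x.2 i j) =
      if m ≤ d then (T i j).coeff (d - m) else 0

/-- The value `T(u)` of a polynomial monodromy matrix at the complex number `u`. -/
def evalT {n : ℕ} {V : Type*} [AddCommGroup V] [Module ℂ V]
    (T : Matrix (Fin n) (Fin n) (Polynomial (Module.End ℂ V))) (u : ℂ) :
    Matrix (Fin n) (Fin n) (Module.End ℂ V) :=
  T.map fun q => q.eval (algebraMap ℂ (Module.End ℂ V) u)

/-- `K⁻(u) = diag(u - c, …, u - c, -u - c, …, -u - c)` with `a` entries of the first kind. -/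
def kMinus (n a : ℕ) (c u : ℂ) : Matrix (Fin n) (Fin n) ℂ :=
  Matrix.diagonal fun i => if (i : ℕ) < a then u - c else -u - c

/-- The monodromy matrix of the open chain, `D(u) = T(u) K⁻(u) T⁻¹(-u)`. -/
def openMonodromy {n : ℕ} {V : Type*} [AddCommGroup V] [Module ℂ V]
    (T : Matrix (Fin n) (Fin n) (Polynomial (Module.End ℂ V))) (a : ℕ) (c u : ℂ) :
    Matrix (Fin n) (Fin n) (Module.End ℂ V) :=
  evalT T u * (kMinus n a c u).map (algebraMap ℂ (Module.End ℂ V)) * Ring.inverse (evalT T (-u))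

/-! ### Operators on tensor products of auxiliary spaces

Operators on `⨂_{s ∈ S} ℂⁿ` with coefficients in an algebra `A` are matrices over `A` whose rows and
columns are labelled by the basis `S → Fin n`. -/

/-- The matrix `X` acting in the auxiliary space `s`. -/
def onSite {S : Type*} [DecidableEq S] [Fintype S] {n : ℕ} {A : Type*} [Ring A]
    (s : S) (X : Matrix (Fin n) (Fin n) A) : Matrix (S → Fin n) (S → Fin n) A :=
  fun p q => if ∀ x, x ≠ s → p x = q x then X (p s) (q s) else 0

/-- The scalar matrix `Y` acting in the pair `(s, t)` of auxiliary spaces (`s ≠ t`). -/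
def onSites {S : Type*} [DecidableEq S] [Fintype S] {n : ℕ} (A : Type*) [Ring A] [Algebra ℂ A]
    (s t : S) (Y : Matrix (Fin n × Fin n) (Fin n × Fin n) ℂ) :
    Matrix (S → Fin n) (S → Fin n) A :=
  fun p q => if ∀ x, x ≠ s → x ≠ t → p x = q x
    then algebraMap ℂ A (Y (p s, p t) (q s, q t)) else 0

/-- The generators `D̂^{(k+1)}(u) = ∑_{i,j ≥ k} E_{ij} ⊗ d^{(k+1)}_{ij}(u)`, where
`d^{(k+1)}_{ij}(u) = d_{ij}(u + kħ/2) + δ_{ij} ∑_{a < k} ħ/(2u) d_{aa}(u + kħ/2)`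
and the indices `i, j, a` are counted from `0`. -/
def hatD (ħ : ℂ) {n : ℕ} {A : Type*} [Ring A] [Algebra ℂ A] (D : ℂ → Matrix (Fin n) (Fin n) A)
    (k : ℕ) (u : ℂ) : Matrix (Fin n) (Fin n) A :=
  fun i j => if k ≤ (i : ℕ) ∧ k ≤ (j : ℕ) then
      D (u + k * ħ / 2) i j +
        (if i = j then
        ∑ a : Fin n, (if (a : ℕ) < k then (ħ / (2 * u)) • D (u + k * ħ / 2) a a else 0) else 0)
    else 0

/-! ### The trace formula

The rank is `𝔫 = r + 1`. The auxiliary space `a_j^i` and the parameter `u_{ij}` have the label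
`⟨k, j⟩` with `k = i - 1 : Fin r` and `j : Fin (M k)`. A family `π` of permutations says which
spaces take the places of the ordered sequences `A_1; …; A_{𝔫-1}`: the `j`-th place of `A_{k+1}` is
taken by the space `⟨k, π k j⟩`, and `u k j` is the parameter that stands in this place. -/

section TraceFormula

variable (ħ : ℂ) {r : ℕ} {A : Type*} [Ring A] [Algebra ℂ A]
  (D : ℂ → Matrix (Fin (r + 1)) (Fin (r + 1)) A)
  (M : Fin r → ℕ) (π : (k : Fin r) → Equiv.Perm (Fin (M k))) (u : (k : Fin r) → Fin (M k) → ℂ)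

/-- The operators with coefficients in `A` on all auxiliary spaces together. -/
abbrev AuxOp (A : Type*) {r : ℕ} (M : Fin r → ℕ) : Type _ :=
  Matrix (((k : Fin r) × Fin (M k)) → Fin (r + 1)) (((k : Fin r) × Fin (M k)) → Fin (r + 1)) A

/-- `R̄^{(i)}`: the product over decreasing `b < i`, and over increasing `c` for each `b`, of
`ℝ^{(i,b+1)}_{a_j^i a_c^b}(u_{ij} + u_{bc} + (i-b)ħ/2)`. -/
def rBar (k : Fin r) (j : Fin (M k)) : AuxOp A M :=
  ((((List.finRange r).filter (· < k)).reverse).map fun b =>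
    (List.ofFn fun c : Fin (M b) =>
      onSites A (⟨k, π k j⟩ : (k : Fin r) × Fin (M k)) ⟨b, π b c⟩
        (normR ħ (r + 1) k (b + 1)
          (u k j + u b c + (((k : ℕ) : ℂ) - ((b : ℕ) : ℂ)) * ħ / 2))).prod).prod

/-- `R^{(i)}`: the product over increasing `b < i`, and over decreasing `c` for each `b`, of
`ℝ^{(i,b+1)}_{a_j^i a_c^b}(u_{ij} - u_{bc} + (i-b)ħ/2)`. -/
def rProd (k : Fin r) (j : Fin (M k)) : AuxOp A M :=
  (((List.finRange r).filter (· < k)).map fun b =>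
    ((List.ofFn fun c : Fin (M b) =>
      onSites A (⟨k, π k j⟩ : (k : Fin r) × Fin (M k)) ⟨b, π b c⟩
        (normR ħ (r + 1) k (b + 1)
          (u k j - u b c + (((k : ℕ) : ℂ) - ((b : ℕ) : ℂ)) * ħ / 2))).reverse).prod).prod

/-- `𝔻̂^{(i)}_{A_i} = ∏_{j=1}^{M_i} R̄^{(i)} D̂^{(i)}_{a_j^i}(u_{ij} + ħ/2) R^{(i)}`. -/
def dressedD (k : Fin r) : AuxOp A M :=
  (List.ofFn fun j : Fin (M k) =>
    rBar ħ M π u k j *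
      onSite (⟨k, π k j⟩ : (k : Fin r) × Fin (M k)) (hatD ħ D k (u k j + ħ / 2)) *
      rProd ħ M π u k j).prod

/-- `E_{𝔫,𝔫-1}^{⊗ M_{𝔫-1}} ⊗ ⋯ ⊗ E_{21}^{⊗ M_1}`. -/
def lowering (A : Type*) [Ring A] [Algebra ℂ A] : AuxOp A M :=
  fun p q => algebraMap ℂ A
    (∏ s : (k : Fin r) × Fin (M k), Matrix.single s.1.succ s.1.castSucc (1 : ℂ) (p s) (q s))

/-- The trace formula
`tr_{A_1 … A_{𝔫-1}} (∏_{i=1}^{𝔫-1} 𝔻̂^{(i)}_{A_i} · E_{𝔫,𝔫-1}^{⊗ M_{𝔫-1}} ⊗ ⋯ ⊗ E_{21}^{⊗ M_1})`. -/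
def betheTrace : A :=
  Matrix.trace ((List.ofFn fun k : Fin r => dressedD ħ D M π u k).prod * lowering M A)

end TraceFormula

/-! ### The recursive form -/

/-- `τ(D(u)) = D̂^{(2)}(u)`, an `(𝔫-1) × (𝔫-1)` matrix. -/
def tau (ħ : ℂ) {n : ℕ} {A : Type*} [Ring A] [Algebra ℂ A]
    (D : ℂ → Matrix (Fin (n + 1)) (Fin (n + 1)) A) (u : ℂ) : Matrix (Fin n) (Fin n) A :=
  fun i j => hatD ħ D 1 u i.succ j.succ

/-- The normalized matrix `ℝ(x)` of rank `n` between an auxiliary space, whose indices label the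
entries, and the `c`-th of `m` further spaces. For `x = u + a` this is the image of `T(u)`, and for
`x = u - a` the image of `T⁻¹(-u)`, in the fundamental representation `π̄_a`. -/
def fundR (ħ : ℂ) {n m : ℕ} (A : Type*) [Ring A] [Algebra ℂ A] (c : Fin m) (x : ℂ) :
    Matrix (Fin n) (Fin n) (Matrix (Fin m → Fin n) (Fin m → Fin n) A) :=
  fun i j => onSite c fun k l => algebraMap ℂ A (normR ħ n 0 0 x (i, k) (j, l))

/-- `(π̄_{a_1} ⊗ ⋯ ⊗ π̄_{a_m} ⊗ 𝕀) ∘ Δ^{(m)}` on the generators: since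
`Δ(D(u)) = T_{[1]}(u) D_{[2]}(u) T_{[1]}⁻¹(-u)`, the image of `D(u)` is
`ℝ_1(u + a_1) ⋯ ℝ_m(u + a_m) D(u) ℝ_m(u - a_m) ⋯ ℝ_1(u - a_1)`. -/
def coprodFund (ħ : ℂ) {n m : ℕ} {A : Type*} [Ring A] [Algebra ℂ A] (a : Fin m → ℂ)
    (D : ℂ → Matrix (Fin n) (Fin n) A) (u : ℂ) :
    Matrix (Fin n) (Fin n) (Matrix (Fin m → Fin n) (Fin m → Fin n) A) :=
  (List.ofFn fun c : Fin m => fundR ħ A c (u + a c)).prod *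
    (D u).map (fun x => Matrix.diagonal fun _ => x) *
    ((List.ofFn fun c : Fin m => fundR ħ A c (u - a c)).reverse).prod

/-- The images of the generators under
`(π̄^{(2)}_{u_{11}} ⊗ ⋯ ⊗ π̄^{(2)}_{u_{1M_1}} ⊗ 𝕀) ∘ Δ^{(M_1)} ∘ τ`. -/
def psiGen (ħ : ℂ) {n m : ℕ} {A : Type*} [Ring A] [Algebra ℂ A] (a : Fin m → ℂ)
    (D : ℂ → Matrix (Fin (n + 1)) (Fin (n + 1)) A) :
    ℂ → Matrix (Fin n) (Fin n) (Matrix (Fin m → Fin n) (Fin m → Fin n) A) :=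
  coprodFund ħ a (tau ħ D)

/-- The components `j = 2, …, 𝔫` of the row `B̂^{(1)}(u) = ∑_j e_j^t ⊗ d_{1j}(u + ħ/2)`, which are
those that act on the space spanned by `e_2, …, e_𝔫`. -/
def hatB (ħ : ℂ) {n : ℕ} {A : Type*} (D : ℂ → Matrix (Fin (n + 1)) (Fin (n + 1)) A)
    (u : ℂ) (j : Fin n) : A :=
  D (u + ħ / 2) 0 j.succ

/-- `B̂^{(1)}_{a_1}(u_{11}) ⋯ B̂^{(1)}_{a_m}(u_{1m}) · X · e_2^{⊗ m}`, for an operator `X` with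
coefficients in `A` on `m` copies of the space with basis `e_2, …, e_𝔫` (indices `0, …, 𝔫 - 2`). -/
def contractB (ħ : ℂ) {n m : ℕ} {A : Type*} [Ring A]
    (D : ℂ → Matrix (Fin (n + 2)) (Fin (n + 2)) A) (a : Fin m → ℂ)
    (X : Matrix (Fin m → Fin (n + 1)) (Fin m → Fin (n + 1)) A) : A :=
  ∑ p : Fin m → Fin (n + 1),
    (List.ofFn fun c : Fin m => hatB ħ D (a c) (p c)).prod * X p (fun _ => 0)

/-- The Bethe vectors by recursion on the rank: `Φ^1 = 1` and
`Φ^𝔫(u) = B̂(u_{11}) ⋯ B̂(u_{1M_1}) Ψ̂_{u_1}(Φ^{𝔫-1}(u / u_1))`. -/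
def betheRec (ħ : ℂ) : (r : ℕ) → {A : Type*} → [Ring A] → [Algebra ℂ A] →
    (ℂ → Matrix (Fin (r + 1)) (Fin (r + 1)) A) → (M : Fin r → ℕ) →
    ((k : Fin r) → Fin (M k) → ℂ) → A
  | 0, _, _, _, _, _, _ => 1
  | r + 1, _, _, _, D, M, u =>
    contractB ħ D (u 0)
      (betheRec ħ r (psiGen ħ (u 0) D) (fun k => M k.succ) (fun k => u k.succ))

/-- All the factors of the trace formula are defined at `u`. -/
structure IsRegular (ħ : ℂ) {r : ℕ} {V : Type*} [AddCommGroup V] [Module ℂ V]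
    (T : Matrix (Fin (r + 1)) (Fin (r + 1)) (Polynomial (Module.End ℂ V)))
    (M : Fin r → ℕ) (u : (k : Fin r) → Fin (M k) → ℂ) : Prop where
  isUnit : ∀ (k : Fin r) (j : Fin (M k)),
    IsUnit (evalT T (-(u k j + (((k : ℕ) : ℂ) + 1) * ħ / 2)))
  hatD_ne : ∀ (k : Fin r) (j : Fin (M k)), 0 < (k : ℕ) → 2 * u k j + ħ ≠ 0
  add_ne : ∀ (k b : Fin r) (j : Fin (M k)) (c : Fin (M b)), b < k →
    u k j + u b c + (((k : ℕ) : ℂ) - ((b : ℕ) : ℂ)) * ħ / 2 ≠ ħ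
  sub_ne : ∀ (k b : Fin r) (j : Fin (M k)) (c : Fin (M b)), b < k →
    u k j - u b c + (((k : ℕ) : ℂ) - ((b : ℕ) : ℂ)) * ħ / 2 ≠ ħ

end

end OpenChain

/-! The engine is a nesting of reflection algebras. A family `D` counts as a solution on a subspace
`W` when R(x-y) D₁(x) R(x+y) D₂(y) = D₂(y) R(x+y) D₁(x) R(x-y) holds on the vectors of `W`, for x
and y outside a finite set (`ReflData`). Dressing D ↦ L D N by matrices with the exchange relations
of T(u) and T⁻¹(-u) keeps solutions (`agreeOn_refl_dress`). On the vectors annihilated by the first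
column of `D` below the diagonal (`hwSub`), the products d_{i1}(x) d_{1l}(y) can be eliminated from
the component equations. What remains says that the lower block, shifted by ħ/2 and corrected by
ħ/(2u) d_{11}, is a solution of rank one less (`ReflData.tau`). Hence D' (`psiGen`) is a solution
with highest weight vector e_2^{⊗M_1} ⊗ Ω, and induction on the rank is possible as long as the
algebra, the module and `W` are all allowed to change.

Recursion (`betheTrace_smul`). The trace against the matrices E_{i+1,i} is one matrix entry
(`betheTrace_eq`), so the formula is a product of operators applied to a basis vector with e_2 in
every first-level space. The levels act from the highest one down. Level 2 carries complete
R-matrices of rank 𝔫-1 to the first level, and these turn D̂^{(2)} into D'. For the levels i ≥ 3 the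
projectors kill the permutation part on e_2, so the R-matrices to the first level become scalars. In
the formula of rank 𝔫-1 the same dressing sits inside D̂^{(i-1)}[D']. The two agree because both
give one scalar, a product of factors `rho`, times D̂^{(i-1)}[τ(D)] (`psiGen_hatD_smul`,
`top_smul`). Level 1 then contributes the rows B̂.

Symmetry. Exchanging neighbouring rows B̂ costs a braid matrix P R (`rowB_exchange`). This matrix
intertwines D' with the D' of swapped parameters (`dressList_exchange`) and acts on e_2^{⊗M_1} by
the very scalar produced by the exchange, which cancels (`recVec_swap_of_ne`). The other levels
follow by induction. Relabelling the auxiliary spaces is conjugation by a permutation operator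
(`betheTrace_relabel`).

Special parameters. Component equations are divided by polynomials in x and y, which is legitimate
at generic points only; the rest follows because weakly continuous families that agree off a finite
set agree everywhere (`WeakContOn.eqOn_of_finite`). The same principle, applied to a common shift of
all parameters, frees the symmetry from the conditions 2u_{ij} + lħ ≠ 0 (`betheTrace_symm`).

Input from the Yangian. K⁻ solves the reflection equation (`kMinus_refl`), polynomial RTT relations
give the exchange relations (`RttCoeffs.exchangeRel`), and the triangular action of T and T⁻¹ on Ω
makes Ω a highest weight vector of `D` (`RttCoeffs.isHighest`). -/

namespace OpenChain
open scoped Matrix.Module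

/-! ### Operators on two auxiliary spaces -/

section TwoSpaces

variable {n : ℕ} {A : Type*} [Ring A]

/-- `X ⊗ 1`. -/
def leg₁ (X : Matrix (Fin n) (Fin n) A) : Matrix (Fin n × Fin n) (Fin n × Fin n) A := X ⊗ₖ 1

/-- `1 ⊗ X`. -/
def leg₂ (X : Matrix (Fin n) (Fin n) A) : Matrix (Fin n × Fin n) (Fin n × Fin n) A := 1 ⊗ₖ X

/-- `x - ħ P` with coefficients in `A`. -/
def rMat (ħ : ℂ) (n : ℕ) (A : Type*) [Ring A] [Algebra ℂ A] (x : ℂ) :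
    Matrix (Fin n × Fin n) (Fin n × Fin n) A :=
  x • 1 - ħ • permP A n

theorem leg₁_apply (X : Matrix (Fin n) (Fin n) A) (i k j l : Fin n) :
    leg₁ X (i, k) (j, l) = if k = l then X i j else 0 := by
  simp [leg₁, Matrix.one_apply]

theorem leg₂_apply (X : Matrix (Fin n) (Fin n) A) (i k j l : Fin n) :
    leg₂ X (i, k) (j, l) = if i = j then X k l else 0 := by
  simp [leg₂, Matrix.one_apply]

theorem leg₁_mul (X Y : Matrix (Fin n) (Fin n) A) : leg₁ (X * Y) = leg₁ X * leg₁ Y := by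
  ext ⟨i, k⟩ ⟨j, l⟩
  simp [leg₁_apply, Matrix.mul_apply, Fintype.sum_prod_type]

theorem leg₂_mul (X Y : Matrix (Fin n) (Fin n) A) : leg₂ (X * Y) = leg₂ X * leg₂ Y := by
  ext ⟨i, k⟩ ⟨j, l⟩
  simp only [leg₂_apply, Matrix.mul_apply, Fintype.sum_prod_type]
  rw [Finset.sum_comm]
  by_cases h : i = j <;> simp [h]

@[simp] theorem leg₁_one : leg₁ (1 : Matrix (Fin n) (Fin n) A) = 1 := by simp [leg₁]

@[simp] theorem leg₂_one : leg₂ (1 : Matrix (Fin n) (Fin n) A) = 1 := by simp [leg₂]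

theorem leg₁_mul_leg₂_apply (X Y : Matrix (Fin n) (Fin n) A) (i k j l : Fin n) :
    (leg₁ X * leg₂ Y) (i, k) (j, l) = X i j * Y k l := by
  simp [leg₁_apply, leg₂_apply, Matrix.mul_apply, Fintype.sum_prod_type]

theorem leg₂_mul_leg₁_apply (X Y : Matrix (Fin n) (Fin n) A) (i k j l : Fin n) :
    (leg₂ Y * leg₁ X) (i, k) (j, l) = Y k l * X i j := by
  simp [leg₁_apply, leg₂_apply, Matrix.mul_apply, Fintype.sum_prod_type]

theorem leg₁_mul_leg₂_comm {X Y : Matrix (Fin n) (Fin n) A}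
    (h : ∀ i j k l, Commute (X i j) (Y k l)) : leg₁ X * leg₂ Y = leg₂ Y * leg₁ X := by
  ext ⟨i, k⟩ ⟨j, l⟩
  rw [leg₁_mul_leg₂_apply, leg₂_mul_leg₁_apply, (h i j k l).eq]

theorem permP_apply (i k j l : Fin n) :
    permP A n (i, k) (j, l) = if i = l ∧ k = j then 1 else 0 := by
  simp only [permP, Matrix.sum_apply, Matrix.kroneckerMap_apply, Matrix.single_apply]
  rw [Finset.sum_eq_single i, Finset.sum_eq_single j]
  · by_cases h : i = l <;> by_cases h' : k = j <;> simp [h, h', eq_comm]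
  · intro b _ hb; simp [hb]
  · simp
  · intro b _ hb; simp [hb]
  · simp

theorem permP_mul_apply (X : Matrix (Fin n × Fin n) (Fin n × Fin n) A) (i k j l : Fin n) :
    (permP A n * X) (i, k) (j, l) = X (k, i) (j, l) := by
  rw [Matrix.mul_apply, Finset.sum_eq_single (k, i)]
  · simp [permP_apply]
  · rintro ⟨a, b⟩ _ h
    rw [permP_apply, if_neg, zero_mul]
    rintro ⟨rfl, rfl⟩; exact h rfl
  · simp

theorem mul_permP_apply (X : Matrix (Fin n × Fin n) (Fin n × Fin n) A) (i k j l : Fin n) :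
    (X * permP A n) (i, k) (j, l) = X (i, k) (l, j) := by
  rw [Matrix.mul_apply, Finset.sum_eq_single (l, j)]
  · simp [permP_apply]
  · rintro ⟨a, b⟩ _ h
    rw [permP_apply, if_neg, mul_zero]
    rintro ⟨rfl, rfl⟩; exact h rfl
  · simp

theorem permP_mul_permP : permP A n * permP A n = 1 := by
  ext ⟨i, k⟩ ⟨j, l⟩
  rw [permP_mul_apply, permP_apply, Matrix.one_apply]
  simp only [Prod.mk.injEq]
  congr 1
  exact propext ⟨fun h => ⟨h.2, h.1⟩, fun h => ⟨h.2, h.1⟩⟩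

theorem permP_mul_leg₁ (X : Matrix (Fin n) (Fin n) A) :
    permP A n * leg₁ X = leg₂ X * permP A n := by
  ext ⟨i, k⟩ ⟨j, l⟩
  rw [permP_mul_apply, mul_permP_apply, leg₁_apply, leg₂_apply]

theorem permP_mul_leg₂ (X : Matrix (Fin n) (Fin n) A) :
    permP A n * leg₂ X = leg₁ X * permP A n := by
  ext ⟨i, k⟩ ⟨j, l⟩
  rw [permP_mul_apply, mul_permP_apply, leg₁_apply, leg₂_apply]

variable [Algebra ℂ A]

theorem rMat_comm_permP (ħ x : ℂ) :
    permP A n * rMat ħ n A x = rMat ħ n A x * permP A n := by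
  simp [rMat, mul_sub, sub_mul]

/-- Moving the permutation to the right turns X₁ P Y₂ into (XY)₁ P, which is why a matrix product
appears in the second term. -/
theorem leg₁_rMat_leg₂_apply (ħ s : ℂ) (X Y : Matrix (Fin n) (Fin n) A) (i k j l : Fin n) :
    (leg₁ X * rMat ħ n A s * leg₂ Y) (i, k) (j, l) =
      s • (X i j * Y k l) - ħ • (if k = j then (X * Y) i l else 0) := by
  have : leg₁ X * rMat ħ n A s * leg₂ Y =
      s • (leg₁ X * leg₂ Y) - ħ • (leg₁ (X * Y) * permP A n) := by
    rw [leg₁_mul, mul_assoc _ _ (permP A n), ← permP_mul_leg₂]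
    simp only [rMat, mul_sub, sub_mul, mul_smul_comm, smul_mul_assoc, mul_one, mul_assoc]
  rw [this, Matrix.sub_apply, Matrix.smul_apply, Matrix.smul_apply, leg₁_mul_leg₂_apply,
    mul_permP_apply, leg₁_apply]

theorem leg₂_rMat_leg₁_apply (ħ s : ℂ) (X Y : Matrix (Fin n) (Fin n) A) (i k j l : Fin n) :
    (leg₂ Y * rMat ħ n A s * leg₁ X) (i, k) (j, l) =
      s • (Y k l * X i j) - ħ • (if i = l then (Y * X) k j else 0) := by
  have : leg₂ Y * rMat ħ n A s * leg₁ X =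
      s • (leg₂ Y * leg₁ X) - ħ • (leg₂ (Y * X) * permP A n) := by
    rw [leg₂_mul, mul_assoc _ _ (permP A n), ← permP_mul_leg₁]
    simp only [rMat, mul_sub, sub_mul, mul_smul_comm, smul_mul_assoc, mul_one, mul_assoc]
  rw [this, Matrix.sub_apply, Matrix.smul_apply, Matrix.smul_apply, leg₂_mul_leg₁_apply,
    mul_permP_apply, leg₂_apply]

theorem rMat_mul_apply (ħ m : ℂ) (X : Matrix (Fin n × Fin n) (Fin n × Fin n) A)
    (i k j l : Fin n) :
    (rMat ħ n A m * X) (i, k) (j, l) = m • X (i, k) (j, l) - ħ • X (k, i) (j, l) := by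
  rw [rMat, sub_mul, Matrix.sub_apply, smul_mul_assoc, smul_mul_assoc, one_mul, Matrix.smul_apply,
    Matrix.smul_apply, permP_mul_apply]

theorem mul_rMat_apply (ħ m : ℂ) (X : Matrix (Fin n × Fin n) (Fin n × Fin n) A)
    (i k j l : Fin n) :
    (X * rMat ħ n A m) (i, k) (j, l) = m • X (i, k) (j, l) - ħ • X (i, k) (l, j) := by
  rw [rMat, mul_sub, Matrix.sub_apply, mul_smul_comm, mul_smul_comm, mul_one, Matrix.smul_apply,
    Matrix.smul_apply, mul_permP_apply]

/-- `R₁₂(x-y) X₁ Y₂ = Y₂ X₁ R₁₂(x-y)` in components. -/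
theorem rtt_iff (ħ m : ℂ) (X Y : Matrix (Fin n) (Fin n) A) :
    rMat ħ n A m * leg₁ X * leg₂ Y = leg₂ Y * leg₁ X * rMat ħ n A m ↔
      ∀ i j k l, m • (X i j * Y k l - Y k l * X i j) = ħ • (X k j * Y i l - Y k j * X i l) := by
  constructor
  · intro h i j k l
    have := congrFun (congrFun h (i, k)) (j, l)
    rw [mul_assoc, rMat_mul_apply, mul_rMat_apply, leg₁_mul_leg₂_apply, leg₁_mul_leg₂_apply,
      leg₂_mul_leg₁_apply, leg₂_mul_leg₁_apply] at this
    linear_combination (norm := module) this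
  · intro h
    ext ⟨i, k⟩ ⟨j, l⟩
    rw [mul_assoc, rMat_mul_apply, mul_rMat_apply, leg₁_mul_leg₂_apply, leg₁_mul_leg₂_apply,
      leg₂_mul_leg₁_apply, leg₂_mul_leg₁_apply]
    linear_combination (norm := module) h i j k l

/-- `X₁ R₁₂(s) Y₂ = Y₂ R₁₂(s) X₁` in components. -/
theorem cross_iff (ħ s : ℂ) (X Y : Matrix (Fin n) (Fin n) A) :
    leg₁ X * rMat ħ n A s * leg₂ Y = leg₂ Y * rMat ħ n A s * leg₁ X ↔
      ∀ i j k l, s • (X i j * Y k l - Y k l * X i j) =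
        ħ • ((if k = j then (X * Y) i l else 0) - if i = l then (Y * X) k j else 0) := by
  constructor
  · intro h i j k l
    have := congrFun (congrFun h (i, k)) (j, l)
    rw [leg₁_rMat_leg₂_apply, leg₂_rMat_leg₁_apply] at this
    linear_combination (norm := module) this
  · intro h
    ext ⟨i, k⟩ ⟨j, l⟩
    rw [leg₁_rMat_leg₂_apply, leg₂_rMat_leg₁_apply]
    linear_combination (norm := module) h i j k l

/-- The left hand side of the reflection equation. -/
def reflL (ħ : ℂ) (D : ℂ → Matrix (Fin n) (Fin n) A) (x y : ℂ) :
    Matrix (Fin n × Fin n) (Fin n × Fin n) A :=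
  rMat ħ n A (x - y) * leg₁ (D x) * rMat ħ n A (x + y) * leg₂ (D y)

/-- The right hand side of the reflection equation. -/
def reflR (ħ : ℂ) (D : ℂ → Matrix (Fin n) (Fin n) A) (x y : ℂ) :
    Matrix (Fin n × Fin n) (Fin n × Fin n) A :=
  leg₂ (D y) * rMat ħ n A (x + y) * leg₁ (D x) * rMat ħ n A (x - y)

theorem reflL_apply (ħ : ℂ) (D : ℂ → Matrix (Fin n) (Fin n) A) (x y : ℂ) (i k j l : Fin n) :
    reflL ħ D x y (i, k) (j, l) =
      (x - y) • ((x + y) • (D x i j * D y k l) - ħ • (if k = j then (D x * D y) i l else 0)) -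
      ħ • ((x + y) • (D x k j * D y i l) - ħ • (if i = j then (D x * D y) k l else 0)) := by
  rw [reflL, mul_assoc, mul_assoc, rMat_mul_apply, ← mul_assoc, leg₁_rMat_leg₂_apply,
    leg₁_rMat_leg₂_apply]

theorem reflR_apply (ħ : ℂ) (D : ℂ → Matrix (Fin n) (Fin n) A) (x y : ℂ) (i k j l : Fin n) :
    reflR ħ D x y (i, k) (j, l) =
      (x - y) • ((x + y) • (D y k l * D x i j) - ħ • (if i = l then (D y * D x) k j else 0)) -
      ħ • ((x + y) • (D y k j * D x i l) - ħ • (if i = j then (D y * D x) k l else 0)) := by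
  rw [reflR, mul_rMat_apply, leg₂_rMat_leg₁_apply, leg₂_rMat_leg₁_apply]

end TwoSpaces

/-! ### Identities on a subspace -/

section AgreeOn

variable {A V : Type*} [Ring A] [AddCommGroup V] [Module ℂ V] [Module A V]

/-- The matrices `X` and `Y` of operators agree on the subspace `W`. -/
def AgreeOn {ι κ : Type*} (W : Submodule ℂ V) (X Y : Matrix ι κ A) : Prop :=
  ∀ p q, ∀ w ∈ W, X p q • w = Y p q • w

variable {ι : Type*} [Fintype ι] {W : Submodule ℂ V} {X Y : Matrix ι ι A}

theorem AgreeOn.mul_left (h : AgreeOn W X Y) (Z : Matrix ι ι A) : AgreeOn W (Z * X) (Z * Y) := by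
  intro p q w hw
  simp only [Matrix.mul_apply, Finset.sum_smul, mul_smul, h _ _ w hw]

/-- The factor `Z` acts on `W` first, so it has to preserve `W` before the hypothesis can be used.
-/
theorem AgreeOn.mul_right (h : AgreeOn W X Y) {Z : Matrix ι ι A}
    (hZ : ∀ p q, ∀ w ∈ W, Z p q • w ∈ W) : AgreeOn W (X * Z) (Y * Z) := by
  intro p q w hw
  simp only [Matrix.mul_apply, Finset.sum_smul, mul_smul, h _ _ _ (hZ _ _ w hw)]

theorem smul_mem_mul {Z Z' : Matrix ι ι A}
    (hZ : ∀ p q, ∀ w ∈ W, Z p q • w ∈ W) (hZ' : ∀ p q, ∀ w ∈ W, Z' p q • w ∈ W) :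
    ∀ p q, ∀ w ∈ W, (Z * Z') p q • w ∈ W := by
  intro p q w hw
  simp only [Matrix.mul_apply, Finset.sum_smul, mul_smul]
  exact W.sum_mem fun a _ => hZ _ _ _ (hZ' _ _ w hw)

end AgreeOn

/-! ### Dressing of solutions of the reflection equation -/

section Dress

variable {n : ℕ} {A V : Type*} [Ring A] [Algebra ℂ A] [AddCommGroup V] [Module ℂ V] [Module A V]

/-- The exchange relations of `L(x) = T(x)` and `N(x) = T⁻¹(-x)`. -/
structure ExchangeRel (ħ : ℂ) (L N : ℂ → Matrix (Fin n) (Fin n) A) (x y : ℂ) : Prop where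
  ll : rMat ħ n A (x - y) * leg₁ (L x) * leg₂ (L y) = leg₂ (L y) * leg₁ (L x) * rMat ħ n A (x - y)
  nl : leg₁ (N x) * rMat ħ n A (x + y) * leg₂ (L y) = leg₂ (L y) * rMat ħ n A (x + y) * leg₁ (N x)
  ln : leg₁ (L x) * rMat ħ n A (x + y) * leg₂ (N y) = leg₂ (N y) * rMat ħ n A (x + y) * leg₁ (L x)
  nn : rMat ħ n A (x - y) * leg₁ (N x) * leg₂ (N y) = leg₂ (N y) * leg₁ (N x) * rMat ħ n A (x - y)

/-- Both sides factor as L₂(y) L₁(x) · (the same side for `D`) · N₁(x) N₂(y): the exchange relations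
move all `L` to the left and all `N` to the right, past entries of `D` with which they commute. The
equation for `D` is then applied to vectors N₁N₂w, so `N` must preserve `W`. -/
theorem agreeOn_refl_dress {ħ : ℂ} {L N D : ℂ → Matrix (Fin n) (Fin n) A} {x y : ℂ}
    {W : Submodule ℂ V} (hLN : ExchangeRel ħ L N x y)
    (hL : ∀ i j k l, Commute (D x i j) (L y k l))
    (hL' : ∀ i j k l, Commute (L x i j) (D y k l))
    (hN : ∀ i j k l, Commute (N x i j) (D y k l))
    (hN' : ∀ i j k l, Commute (D x i j) (N y k l))
    (hNx : ∀ i j, ∀ w ∈ W, N x i j • w ∈ W) (hNy : ∀ i j, ∀ w ∈ W, N y i j • w ∈ W)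
    (h : AgreeOn W (reflL ħ D x y) (reflR ħ D x y)) :
    AgreeOn W (reflL ħ (fun z => L z * D z * N z) x y) (reflR ħ (fun z => L z * D z * N z) x y) := by
  have cL := leg₁_mul_leg₂_comm hL
  have cL' := leg₁_mul_leg₂_comm hL'
  have cN := leg₁_mul_leg₂_comm hN
  have cN' := leg₁_mul_leg₂_comm hN'
  have e₁ : reflL ħ (fun z => L z * D z * N z) x y =
      leg₂ (L y) * leg₁ (L x) * (reflL ħ D x y * (leg₁ (N x) * leg₂ (N y))) := by
    simp only [reflL, leg₁_mul, leg₂_mul]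
    obtain ⟨R, hR⟩ : ∃ R, R = rMat ħ n A (x - y) := ⟨_, rfl⟩
    have hll := hLN.ll
    have hnn := hLN.nn
    rw [← hR] at hll hnn ⊢
    calc R * (leg₁ (L x) * leg₁ (D x) * leg₁ (N x)) * rMat ħ n A (x + y) *
          (leg₂ (L y) * leg₂ (D y) * leg₂ (N y))
        = R * leg₁ (L x) * leg₁ (D x) * (leg₁ (N x) * rMat ħ n A (x + y) * leg₂ (L y)) *
          leg₂ (D y) * leg₂ (N y) := by simp only [mul_assoc]
      _ = R * leg₁ (L x) * (leg₁ (D x) * leg₂ (L y)) * rMat ħ n A (x + y) *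
          (leg₁ (N x) * leg₂ (D y)) * leg₂ (N y) := by rw [hLN.nl]; simp only [mul_assoc]
      _ = (R * leg₁ (L x) * leg₂ (L y)) * leg₁ (D x) * rMat ħ n A (x + y) *
          leg₂ (D y) * leg₁ (N x) * leg₂ (N y) := by rw [cL, cN]; simp only [mul_assoc]
      _ = _ := by rw [hll]; simp only [mul_assoc]
  have e₂ : reflR ħ (fun z => L z * D z * N z) x y =
      leg₂ (L y) * leg₁ (L x) * (reflR ħ D x y * (leg₁ (N x) * leg₂ (N y))) := by
    simp only [reflR, leg₁_mul, leg₂_mul]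
    obtain ⟨R, hR⟩ : ∃ R, R = rMat ħ n A (x - y) := ⟨_, rfl⟩
    have hll := hLN.ll
    have hnn := hLN.nn
    rw [← hR] at hll hnn ⊢
    symm
    calc leg₂ (L y) * leg₁ (L x) * (leg₂ (D y) * rMat ħ n A (x + y) * leg₁ (D x) * R *
          (leg₁ (N x) * leg₂ (N y)))
        = leg₂ (L y) * (leg₁ (L x) * leg₂ (D y)) * rMat ħ n A (x + y) * leg₁ (D x) *
          (R * leg₁ (N x) * leg₂ (N y)) := by simp only [mul_assoc]
      _ = leg₂ (L y) * leg₂ (D y) * leg₁ (L x) * rMat ħ n A (x + y) * (leg₁ (D x) *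
          leg₂ (N y)) * leg₁ (N x) * R := by rw [hnn, cL']; simp only [mul_assoc]
      _ = leg₂ (L y) * leg₂ (D y) * (leg₁ (L x) * rMat ħ n A (x + y) * leg₂ (N y)) * leg₁ (D x) *
          leg₁ (N x) * R := by rw [cN']; simp only [mul_assoc]
      _ = _ := by rw [hLN.ln]; simp only [mul_assoc]
  rw [e₁, e₂]
  refine (h.mul_right (smul_mem_mul ?_ ?_)).mul_left _
  · rintro ⟨i, k⟩ ⟨j, l⟩ w hw
    rw [leg₁_apply]
    split_ifs
    · exact hNx _ _ w hw
    · simp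
  · rintro ⟨i, k⟩ ⟨j, l⟩ w hw
    rw [leg₂_apply]
    split_ifs
    · exact hNy _ _ w hw
    · simp

end Dress

/-! ### Weakly continuous families of vectors -/

section WeakCont

variable {V V' : Type*} [AddCommGroup V] [Module ℂ V] [AddCommGroup V'] [Module ℂ V']

/-- All linear functionals of `f` are continuous on `S`. -/
def WeakContOn (f : ℂ → V) (S : Set ℂ) : Prop :=
  ∀ φ : V →ₗ[ℂ] ℂ, ContinuousOn (fun x => φ (f x)) S

variable {f g : ℂ → V} {S S' : Set ℂ}

theorem WeakContOn.mono (hf : WeakContOn f S) (h : S' ⊆ S) : WeakContOn f S' :=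
  fun φ => (hf φ).mono h

theorem weakContOn_const (v : V) : WeakContOn (fun _ => v) S := fun _ => continuousOn_const

theorem WeakContOn.add (hf : WeakContOn f S) (hg : WeakContOn g S) :
    WeakContOn (fun x => f x + g x) S := fun φ => by
  simp only [map_add]; exact (hf φ).add (hg φ)

theorem WeakContOn.sub (hf : WeakContOn f S) (hg : WeakContOn g S) :
    WeakContOn (fun x => f x - g x) S := fun φ => by
  simp only [map_sub]; exact (hf φ).sub (hg φ)

theorem WeakContOn.smul {c : ℂ → ℂ} (hc : ContinuousOn c S) (hf : WeakContOn f S) :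
    WeakContOn (fun x => c x • f x) S := fun φ => by
  simp only [map_smul, smul_eq_mul]; exact hc.mul (hf φ)

theorem WeakContOn.sum {κ : Type*} (s : Finset κ) {F : κ → ℂ → V}
    (h : ∀ a ∈ s, WeakContOn (F a) S) : WeakContOn (fun x => ∑ a ∈ s, F a x) S := fun φ => by
  simpa only [map_sum] using continuousOn_finsetSum s fun a ha => h a ha φ

theorem WeakContOn.ite {p : Prop} [Decidable p] (hf : WeakContOn f S) :
    WeakContOn (fun x => if p then f x else 0) S := by
  split_ifs
  · exact hf
  · exact weakContOn_const 0

theorem WeakContOn.map (hf : WeakContOn f S) (T : V →ₗ[ℂ] V') :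
    WeakContOn (fun x => T (f x)) S := fun φ => hf (φ.comp T)

theorem WeakContOn.comp (hf : WeakContOn f S) {c : ℂ → ℂ} (hc : ContinuousOn c S')
    (h : Set.MapsTo c S' S) : WeakContOn (fun x => f (c x)) S' := fun φ =>
  (hf φ).comp hc h

theorem WeakContOn.smul_left {A : Type*} [Ring A] [Algebra ℂ A] [Module A V] [IsScalarTower ℂ A V]
    (hf : WeakContOn f S) (a : A) : WeakContOn (fun x => a • f x) S :=
  hf.map (Algebra.lsmul ℂ ℂ V a)

theorem WeakContOn.congr (hf : WeakContOn f S) (h : ∀ x ∈ S, g x = f x) : WeakContOn g S :=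
  fun φ => (hf φ).congr fun x hx => by simp only [h x hx]

/-- Functionals separate vectors, which reduces the claim to scalar functions. The set `S` is open
because its complement is finite, and a finite set cannot contain a punctured neighbourhood in ℂ, so
continuity determines the value at every point of `S`. -/
theorem WeakContOn.eqOn_of_finite (hf : WeakContOn f S) (hg : WeakContOn g S) (hS : Sᶜ.Finite)
    {F : Set ℂ} (hF : F.Finite) (h : ∀ x ∈ S, x ∉ F → f x = g x) : ∀ x ∈ S, f x = g x := by
  intro y hy
  rw [← sub_eq_zero, ← Module.forall_dual_apply_eq_zero_iff ℂ]
  intro φ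
  have hopen : IsOpen S := by simpa using hS.isClosed.isOpen_compl
  have hc : ContinuousAt (fun x => φ (f x - g x)) y :=
    ((hf.sub hg) φ).continuousAt (hopen.mem_nhds hy)
  have hev : ∀ᶠ x in nhdsWithin y {y}ᶜ, φ (f x - g x) = 0 := by
    have h1 : ∀ᶠ x in nhdsWithin y {y}ᶜ, x ∈ S :=
      nhdsWithin_le_nhds (hopen.mem_nhds hy)
    have h2 : ∀ᶠ x in nhdsWithin y {y}ᶜ, x ∉ F := by
      have : (F \ {y})ᶜ ∈ nhds y := (hF.subset Set.sdiff_subset).isClosed.isOpen_compl.mem_nhds (by simp)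
      filter_upwards [nhdsWithin_le_nhds this, self_mem_nhdsWithin] with x hx hxy hxF
      exact hx ⟨hxF, hxy⟩
    filter_upwards [h1, h2] with x hx hx'
    rw [h x hx hx', sub_self, map_zero]
  have h3 := hc.tendsto.mono_left (nhdsWithin_le_nhds (s := {y}ᶜ))
  exact tendsto_nhds_unique h3 (tendsto_const_nhds.congr' (hev.mono fun x hx => hx.symm))

end WeakCont

/-! ### Reflection algebras acting on a subspace -/

section ReflData

variable {n : ℕ} {A V : Type*} [Ring A] [Algebra ℂ A] [AddCommGroup V] [Module ℂ V] [Module A V]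

/-- The matrices `D(x)`, `x ∈ S`, preserve the subspace `W`, depend continuously on `x` there and
satisfy the reflection equation on it. -/
structure ReflData (ħ : ℂ) (D : ℂ → Matrix (Fin n) (Fin n) A) (W : Submodule ℂ V) (S : Set ℂ) :
    Prop where
  finite_compl : Sᶜ.Finite
  smul_mem : ∀ x ∈ S, ∀ i j, ∀ w ∈ W, D x i j • w ∈ W
  cont : ∀ i j, ∀ w ∈ W, WeakContOn (fun x => D x i j • w) S
  refl : ∀ x ∈ S, ∀ y ∈ S, AgreeOn W (reflL ħ D x y) (reflR ħ D x y)

/-- `Ω` is annihilated by the entries of `D` below the diagonal. -/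
structure IsHighest (D : ℂ → Matrix (Fin n) (Fin n) A) (W : Submodule ℂ V) (S : Set ℂ) (Ω : V) :
    Prop where
  mem : Ω ∈ W
  lower : ∀ x ∈ S, ∀ i j, j < i → D x i j • Ω = 0

variable [IsScalarTower ℂ A V]

theorem ite_smul_zero' {R M : Type*} [Ring R] [AddCommGroup M] [Module R M] (p : Prop) [Decidable p]
    (a : R) (w : M) : (if p then a else 0) • w = if p then a • w else 0 := by
  split_ifs <;> simp

/-- Renames the action of the noncommutative ring as an opaque function. The tactic `module` then
sees complex scalars only and treats every operator word applied to a vector as an atom. -/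
theorem exists_action (R M : Type*) [Ring R] [AddCommGroup M] [Module R M] :
    ∃ f : R → M → M, ∀ (a : R) (v : M), a • v = f a v := ⟨_, fun _ _ => rfl⟩

/-- The reflection equation on `w` in components. -/
def ReflAt (ħ : ℂ) (D : ℂ → Matrix (Fin n) (Fin n) A) (x y : ℂ) (w : V) (i j k l : Fin n) : Prop :=
  ((x - y) * (x + y)) • (D x i j • D y k l • w - D y k l • D x i j • w) =
    (ħ * (x - y)) • ((if k = j then ∑ a, D x i a • D y a l • w else 0) -
      (if i = l then ∑ a, D y k a • D x a j • w else 0)) +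
    (ħ * (x + y)) • (D x k j • D y i l • w - D y k j • D x i l • w) -
    (ħ * ħ) • ((if i = j then ∑ a, D x k a • D y a l • w else 0) -
      (if i = j then ∑ a, D y k a • D x a l • w else 0))

theorem agreeOn_refl_iff {ħ : ℂ} {D : ℂ → Matrix (Fin n) (Fin n) A} {W : Submodule ℂ V} {x y : ℂ} :
    AgreeOn W (reflL ħ D x y) (reflR ħ D x y) ↔
      ∀ w ∈ W, ∀ i j k l, ReflAt ħ D x y w i j k l := by
  have key : ∀ (w : V) (i j k l : Fin n), ReflAt ħ D x y w i j k l ↔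
      reflL ħ D x y (i, k) (j, l) • w = reflR ħ D x y (i, k) (j, l) • w := by
    intro w i j k l
    simp only [ReflAt, reflL_apply, reflR_apply, sub_smul, smul_assoc, smul_sub, ite_smul_zero',
      Matrix.mul_apply, Finset.sum_smul, mul_smul]
    obtain ⟨f, hf⟩ := exists_action A V
    simp only [hf]
    constructor
    · intro h
      linear_combination (norm := module) h
    · intro h
      linear_combination (norm := module) h
  constructor
  · exact fun h w hw i j k l => (key w i j k l).2 (h _ _ w hw)
  · rintro h ⟨i, k⟩ ⟨j, l⟩ w hw
    exact (key w i j k l).1 (h w hw i j k l)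

end ReflData


/-! ### The subspace killed by the first column, and reduction of the rank -/

section HighestSubspace

variable {n : ℕ} {A V : Type*} [Ring A] [Algebra ℂ A] [AddCommGroup V] [Module ℂ V] [Module A V]
  [IsScalarTower ℂ A V]

omit [IsScalarTower ℂ A V] in
theorem smul_smul_comm_of_tower [IsScalarTower ℂ A V] (c : ℂ) (a : A) (v : V) :
    a • c • v = c • a • v := by
  rw [← algebraMap_smul A c v, ← algebraMap_smul A c (a • v), ← mul_smul, ← mul_smul,
    Algebra.commutes]

/-- The vectors of `W` that are annihilated by the first column of `D` below the diagonal. -/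
def hwSub (D : ℂ → Matrix (Fin (n + 1)) (Fin (n + 1)) A) (W : Submodule ℂ V) (S : Set ℂ) :
    Submodule ℂ V where
  carrier := {w | w ∈ W ∧ ∀ x ∈ S, ∀ p : Fin n, D x p.succ 0 • w = 0}
  add_mem' h h' := ⟨W.add_mem h.1 h'.1, fun x hx p => by
    rw [smul_add, h.2 x hx, h'.2 x hx, add_zero]⟩
  zero_mem' := ⟨W.zero_mem, fun _ _ _ => smul_zero _⟩
  smul_mem' c _ h := ⟨W.smul_mem c h.1, fun x hx p => by
    rw [smul_smul_comm_of_tower, h.2 x hx, smul_zero]⟩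

variable {ħ : ℂ} {W : Submodule ℂ V} {S : Set ℂ} {w : V} {x y : ℂ}

theorem ReflData.reflAt {D : ℂ → Matrix (Fin n) (Fin n) A} (hD : ReflData ħ D W S) (hx : x ∈ S)
    (hy : y ∈ S) (hw : w ∈ W) (i j k l : Fin n) : ReflAt ħ D x y w i j k l :=
  agreeOn_refl_iff.1 (hD.refl x hx y hy) w hw i j k l

theorem eq_zero_of_smul {c : ℂ} (hc : c ≠ 0) {v : V} (h : c • v = 0) : v = 0 :=
  (smul_eq_zero.1 h).resolve_left hc

section

variable {D : ℂ → Matrix (Fin (n + 1)) (Fin (n + 1)) A}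

/-- The (1,1;k,1) equation at (x,y) and at (y,x) gives two linear equations for the unknowns
d_{k1}(y) d_{11}(x) w and d_{k1}(x) d_{11}(y) w. After the common factor x+y-ħ is removed, their
determinant is -(x-y)², so both unknowns vanish generically. -/
theorem ReflData.lower_diag_smul (hD : ReflData ħ D W S) (hw : w ∈ hwSub D W S) (hx : x ∈ S)
    (hy : y ∈ S) (k : Fin n) : D y k.succ 0 • D x 0 0 • w = 0 := by
  have hW := hw.1
  refine (hD.cont k.succ 0 _ (hD.smul_mem x hx 0 0 w hW)).eqOn_of_finite (weakContOn_const 0)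
    hD.finite_compl (F := {x, ħ - x}) (by simp) ?_ y hy
  intro y hy hyF
  simp only [Set.mem_insert_iff, Set.mem_singleton_iff, not_or] at hyF
  have e₁ := hD.reflAt hx hy hW 0 0 k.succ 0
  have e₂ := hD.reflAt hy hx hW 0 0 k.succ 0
  simp only [ReflAt, Fin.sum_univ_succ, hw.2 x hx, hw.2 y hy, smul_zero, Finset.sum_const_zero,
    add_zero, Fin.succ_ne_zero, if_false, if_true] at e₁ e₂
  have : ((x - y) ^ 2 * (x + y - ħ)) ≠ 0 := by
    refine mul_ne_zero (pow_ne_zero 2 (sub_ne_zero.2 (Ne.symm hyF.1))) fun h => hyF.2 ?_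
    linear_combination h
  refine eq_zero_of_smul this ?_
  obtain ⟨f, hf⟩ := exists_action A V
  simp only [hf] at e₁ e₂ ⊢
  linear_combination (norm := module) (-(x - y + ħ)) • e₁ - ħ • e₂

/-- In the (i,j;k,1) equation every other term contains a first-column entry acting on w or on
d_{11} w, and these vanish already; the term (x²-y²) d_{k1}(y) d_{ij}(x) w remains alone. -/
theorem ReflData.lower_block_smul (hD : ReflData ħ D W S) (hw : w ∈ hwSub D W S) (hx : x ∈ S)
    (hy : y ∈ S) (i j k : Fin n) : D y k.succ 0 • D x i.succ j.succ • w = 0 := by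
  have hW := hw.1
  refine (hD.cont k.succ 0 _ (hD.smul_mem x hx _ _ w hW)).eqOn_of_finite (weakContOn_const 0)
    hD.finite_compl (F := {x, -x}) (by simp) ?_ y hy
  intro y hy hyF
  simp only [Set.mem_insert_iff, Set.mem_singleton_iff, not_or] at hyF
  have e₁ := hD.reflAt hx hy hW i.succ j.succ k.succ 0
  simp only [ReflAt, Fin.sum_univ_succ, hw.2 x hx, hw.2 y hy, smul_zero, Finset.sum_const_zero,
    add_zero, Fin.succ_ne_zero, if_false, hD.lower_diag_smul hw hx hy, hD.lower_diag_smul hw hy hx,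
    ite_self, sub_zero, zero_sub, smul_neg, neg_eq_zero] at e₁
  refine eq_zero_of_smul (mul_ne_zero (sub_ne_zero.2 (Ne.symm hyF.1)) fun h => hyF.2 ?_) e₁
  linear_combination h

theorem ReflData.diag_smul_mem_hwSub (hD : ReflData ħ D W S) (hw : w ∈ hwSub D W S) (hx : x ∈ S) :
    D x 0 0 • w ∈ hwSub D W S :=
  ⟨hD.smul_mem x hx _ _ w hw.1, fun _ hy k => hD.lower_diag_smul hw hx hy k⟩

theorem ReflData.block_smul_mem_hwSub (hD : ReflData ħ D W S) (hw : w ∈ hwSub D W S) (hx : x ∈ S)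
    (i j : Fin n) : D x i.succ j.succ • w ∈ hwSub D W S :=
  ⟨hD.smul_mem x hx _ _ w hw.1, fun _ hy k => hD.lower_block_smul hw hx hy i j k⟩

/-- On such vectors the sums in the (1,1;1,1) equation collapse to their first summand, and the
equation becomes (x-y-ħ)(x+y-ħ) times the commutator. -/
theorem ReflData.diag_comm (hD : ReflData ħ D W S) (hw : w ∈ hwSub D W S) (hx : x ∈ S)
    (hy : y ∈ S) : D y 0 0 • D x 0 0 • w = D x 0 0 • D y 0 0 • w := by
  have hW := hw.1
  refine (hD.cont 0 0 _ (hD.smul_mem x hx 0 0 w hW)).eqOn_of_finite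
    ((hD.cont 0 0 w hW).smul_left (D x 0 0)) hD.finite_compl (F := {x - ħ, ħ - x}) (by simp) ?_ y hy
  intro y hy hyF
  simp only [Set.mem_insert_iff, Set.mem_singleton_iff, not_or] at hyF
  have e₁ := hD.reflAt hx hy hW 0 0 0 0
  simp only [ReflAt, Fin.sum_univ_succ, hw.2 x hx, hw.2 y hy, smul_zero, Finset.sum_const_zero,
    add_zero, if_true] at e₁
  have : ((x - y - ħ) * (x + y - ħ)) ≠ 0 := by
    refine mul_ne_zero (fun h => hyF.1 ?_) fun h => hyF.2 ?_
    · linear_combination -h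
    · linear_combination h
  rw [← sub_eq_zero]
  refine eq_zero_of_smul this ?_
  obtain ⟨f, hf⟩ := exists_action A V
  simp only [hf] at e₁ ⊢
  linear_combination (norm := module) -e₁

/-- `∑_{a ≥ 1} d_{ia}(x) d_{al}(y) w`. -/
def blockProd (D : ℂ → Matrix (Fin (n + 1)) (Fin (n + 1)) A) (x y : ℂ) (w : V) (i l : Fin n) : V :=
  ∑ a : Fin n, D x i.succ a.succ • D y a.succ l.succ • w

/-- The (i,1;1,l) equation solved for d_{i1} d_{1l}. This is the substitution that removes the first
row and column from the equations of the lower block. -/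
theorem ReflData.creation_annihilation (hD : ReflData ħ D W S) (hw : w ∈ hwSub D W S) (hx : x ∈ S)
    (hy : y ∈ S) (i l : Fin n) :
    ((x - y) * (x + y - ħ)) • D x i.succ 0 • D y 0 l.succ • w =
      (ħ * (x - y)) • (blockProd D x y w i l - if i = l then D x 0 0 • D y 0 0 • w else 0) +
      (ħ * (x + y)) • (D x 0 0 • D y i.succ l.succ • w - D y 0 0 • D x i.succ l.succ • w) := by
  have e₁ := hD.reflAt hx hy hw.1 i.succ 0 0 l.succ
  simp only [ReflAt, Fin.sum_univ_succ, hw.2 x hx, smul_zero, Finset.sum_const_zero,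
    add_zero, if_true, Fin.succ_ne_zero, if_false, Fin.succ_inj, hD.diag_comm hw hx hy] at e₁
  rw [blockProd]
  obtain ⟨f, hf⟩ := exists_action A V
  simp only [hf] at e₁ ⊢
  linear_combination (norm := module) e₁

/-- Adding the previous relation at (x,y) and at (y,x) cancels the diagonal terms, since the d_{11}
commute, and leaves a common factor x-y. -/
theorem ReflData.creation_annihilation_sub (hD : ReflData ħ D W S) (hw : w ∈ hwSub D W S)
    (hx : x ∈ S) (hy : y ∈ S) (hxy : x ≠ y) (i l : Fin n) :
    (x + y - ħ) • (D x i.succ 0 • D y 0 l.succ • w - D y i.succ 0 • D x 0 l.succ • w) =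
      ħ • (blockProd D x y w i l - blockProd D y x w i l) := by
  have e₁ := hD.creation_annihilation hw hx hy i l
  have e₂ := hD.creation_annihilation hw hy hx i l
  rw [hD.diag_comm hw hx hy] at e₂
  rw [← sub_eq_zero]
  refine eq_zero_of_smul (sub_ne_zero.2 hxy) ?_
  obtain ⟨f, hf⟩ := exists_action A V
  simp only [hf] at e₁ e₂ ⊢
  linear_combination (norm := module) e₁ + e₂

/-- In the (1,1;k,l) equation the right hand side is ħ times the relation of
`creation_annihilation_sub`, the summand a = 1 of the contraction changing its factor x+y into
x+y-ħ. Only (x²-y²) times the commutator is left. -/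
theorem ReflData.diag_block_comm (hD : ReflData ħ D W S) (hw : w ∈ hwSub D W S) (hx : x ∈ S)
    (hy : y ∈ S) (k l : Fin n) :
    D y k.succ l.succ • D x 0 0 • w = D x 0 0 • D y k.succ l.succ • w := by
  have hW := hw.1
  refine (hD.cont _ _ _ (hD.smul_mem x hx 0 0 w hW)).eqOn_of_finite
    ((hD.cont _ _ w hW).smul_left (D x 0 0)) hD.finite_compl (F := {x, -x}) (by simp) ?_ y hy
  intro y hy hyF
  simp only [Set.mem_insert_iff, Set.mem_singleton_iff, not_or] at hyF
  have e₁ := hD.reflAt hx hy hW 0 0 k.succ l.succ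
  have e₂ := hD.creation_annihilation_sub hw hx hy (Ne.symm hyF.1) k l
  simp only [ReflAt, Fin.sum_univ_succ, if_true, Fin.succ_ne_zero, if_false,
    (Fin.succ_ne_zero _).symm] at e₁
  rw [← sub_eq_zero]
  refine eq_zero_of_smul (mul_ne_zero (sub_ne_zero.2 (Ne.symm hyF.1)) fun h => hyF.2 ?_)
    (c := (x - y) * (x + y)) ?_
  · linear_combination h
  rw [blockProd, blockProd] at e₂
  obtain ⟨f, hf⟩ := exists_action A V
  simp only [hf] at e₁ e₂ ⊢
  linear_combination (norm := module) -e₁ - ħ • e₂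

/-- Exchange of creation operators. -/
theorem ReflData.creation_comm (hD : ReflData ħ D W S) (hw : w ∈ W) (hx : x ∈ S)
    (hy : y ∈ S) (a b : Fin n) :
    (x - y - ħ) • D x 0 a.succ • D y 0 b.succ • w =
      (x - y) • D y 0 b.succ • D x 0 a.succ • w - ħ • D y 0 a.succ • D x 0 b.succ • w := by
  have c₁ : ContinuousOn (fun x : ℂ => x - y - ħ) S := by fun_prop
  have c₂ : ContinuousOn (fun x : ℂ => x - y) S := by fun_prop
  refine (WeakContOn.smul c₁ (hD.cont 0 a.succ _ (hD.smul_mem y hy 0 b.succ w hw))).eqOn_of_finite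
    ((WeakContOn.smul c₂ ((hD.cont 0 a.succ w hw).smul_left (D y 0 b.succ))).sub
      (WeakContOn.smul continuousOn_const ((hD.cont 0 b.succ w hw).smul_left (D y 0 a.succ))))
    hD.finite_compl (F := {-y}) (by simp) ?_ x hx
  intro x hx hxF
  -- No contraction occurs in this component, and the whole equation carries the factor x + y; the
  -- point x = -y is covered by continuity.
  have e₁ := hD.reflAt hx hy hw 0 a.succ 0 b.succ
  simp only [ReflAt, (Fin.succ_ne_zero _).symm, if_false] at e₁
  rw [← sub_eq_zero]
  refine eq_zero_of_smul (c := x + y) (fun h => hxF ?_) ?_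
  · rw [Set.mem_singleton_iff]; linear_combination h
  obtain ⟨f, hf⟩ := exists_action A V
  simp only [hf] at e₁ ⊢
  linear_combination (norm := module) e₁

omit [AddCommGroup V] [Module ℂ V] [Module A V] [IsScalarTower ℂ A V] in
theorem tau_apply (u : ℂ) (i j : Fin n) :
    tau ħ D u i j = D (u + ħ / 2) i.succ j.succ +
      if i = j then (ħ / (2 * u)) • D (u + ħ / 2) 0 0 else 0 := by
  simp only [tau, hatD, Fin.val_succ, Nat.le_add_left, and_self, if_true, Fin.succ_inj,
    Nat.cast_one, one_mul, Nat.lt_one_iff, Fin.val_eq_zero_iff, Finset.sum_ite_eq',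
    Finset.mem_univ]

/-- The regular points of `τ(D)`. -/
def tauSet (ħ : ℂ) (S : Set ℂ) : Set ℂ := {x | x + ħ / 2 ∈ S ∧ x ≠ 0}

theorem ReflData.tau_smul_mem (hD : ReflData ħ D W S) (hx : x ∈ tauSet ħ S) (i j : Fin n)
    (hw : w ∈ hwSub D W S) : tau ħ D x i j • w ∈ hwSub D W S := by
  rw [tau_apply, add_smul, ite_smul_zero', smul_assoc]
  refine add_mem (hD.block_smul_mem_hwSub hw hx.1 i j) ?_
  split_ifs
  · exact Submodule.smul_mem _ _ (hD.diag_smul_mem_hwSub hw hx.1)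
  · exact zero_mem _

end

/-- The reflection equation extends from generic points by continuity. -/
theorem reflAt_of_generic {D : ℂ → Matrix (Fin n) (Fin n) A} (hS : Sᶜ.Finite)
    (hmem : ∀ x ∈ S, ∀ i j, ∀ w ∈ W, D x i j • w ∈ W)
    (hcont : ∀ i j, ∀ w ∈ W, WeakContOn (fun x => D x i j • w) S) (hy : y ∈ S) {F : Set ℂ}
    (hF : F.Finite) (hw : w ∈ W) (i j k l : Fin n)
    (h : ∀ x ∈ S, x ∉ F → ReflAt ħ D x y w i j k l) :
    ∀ x ∈ S, ReflAt ħ D x y w i j k l := by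
  have h₁ : ∀ i j k l, WeakContOn (fun x => D x i j • D y k l • w) S := fun i j k l =>
    hcont i j _ (hmem y hy k l w hw)
  have h₂ : ∀ i j k l, WeakContOn (fun x => D y k l • D x i j • w) S := fun i j k l =>
    (hcont i j w hw).smul_left _
  refine WeakContOn.eqOn_of_finite ?_ ?_ hS hF h
  · exact WeakContOn.smul (by fun_prop) ((h₁ _ _ _ _).sub (h₂ _ _ _ _))
  · refine WeakContOn.sub (WeakContOn.add ?_ ?_) ?_
    · exact WeakContOn.smul (by fun_prop) (WeakContOn.sub
        (WeakContOn.ite (WeakContOn.sum _ fun a _ => h₁ _ _ _ _))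
        (WeakContOn.ite (WeakContOn.sum _ fun a _ => h₂ _ _ _ _)))
    · exact WeakContOn.smul (by fun_prop) ((h₁ _ _ _ _).sub (h₂ _ _ _ _))
    · exact WeakContOn.smul (by fun_prop) (WeakContOn.sub
        (WeakContOn.ite (WeakContOn.sum _ fun a _ => h₁ _ _ _ _))
        (WeakContOn.ite (WeakContOn.sum _ fun a _ => h₂ _ _ _ _)))

theorem tauSet_finite_compl (ħ : ℂ) (hS : Sᶜ.Finite) : (tauSet ħ S)ᶜ.Finite := by
  have : (tauSet ħ S)ᶜ ⊆ (fun x => x - ħ / 2) '' Sᶜ ∪ {0} := by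
    intro x hx
    by_cases h0 : x = 0
    · exact Or.inr h0
    · exact Or.inl ⟨x + ħ / 2, fun h => hx ⟨h, h0⟩, by simp⟩
  exact ((hS.image _).union (Set.finite_singleton 0)).subset this

/-- The shift by ħ/2 explains itself here. It leaves x-y unchanged, while the denominator x+y-ħ from
the elimination of d_{i1} d_{1l} becomes x+y at the shifted points, the argument required in rank
𝔫-1. The d_{11} terms produced by the elimination are those that the correction ħ/(2u) d_{11}
supplies. -/
theorem ReflData.tau_reflAt {D : ℂ → Matrix (Fin (n + 1)) (Fin (n + 1)) A}
    (hD : ReflData ħ D W S) (hw : w ∈ hwSub D W S) (hx : x ∈ tauSet ħ S) (hy : y ∈ tauSet ħ S)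
    (hxy : x ≠ y) (hxy' : x + y + ħ ≠ 0) (i j k l : Fin n) :
    ReflAt ħ (tau ħ D) x y w i j k l := by
  obtain ⟨hx, hx0⟩ := hx
  obtain ⟨hy, hy0⟩ := hy
  have hne : x + ħ / 2 ≠ y + ħ / 2 := fun h => hxy (add_right_cancel h)
  have cXY := hD.diag_comm hw hx hy
  have cX := fun p q => hD.diag_block_comm hw hx hy p q
  have cY := fun p q => hD.diag_block_comm hw hy hx p q
  have e₀ := hD.reflAt hx hy hw.1 i.succ j.succ k.succ l.succ
  have e₁ := hD.creation_annihilation hw hx hy i l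
  have e₂ := hD.creation_annihilation hw hy hx k j
  have e₃ := hD.creation_annihilation_sub hw hx hy hne k l
  rw [cXY] at e₂
  have eX : 2 * x * (ħ / (2 * x)) = ħ := by field_simp
  have eY : 2 * y * (ħ / (2 * y)) = ħ := by field_simp
  simp only [ReflAt, Fin.sum_univ_succ, Fin.succ_inj] at e₀
  have hite : ∀ (p : Prop) [Decidable p] (v : V),
      (if p then v else 0) = (if p then (1 : ℂ) else 0) • v := by
    intro p _ v; split_ifs <;> simp
  have hsum : ∀ (x y : ℂ) (i l : Fin n),
      blockProd D (x + ħ / 2) (y + ħ / 2) w i l =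
      ∑ a : Fin n, D (x + ħ / 2) i.succ a.succ • D (y + ħ / 2) a.succ l.succ • w := fun _ _ _ _ => rfl
  rw [ReflAt, ← sub_eq_zero]
  refine eq_zero_of_smul (c := x + y + ħ) hxy' ?_
  have hsc : ∀ (c : ℂ) (a : A) (v : V), a • c • v = c • a • v := smul_smul_comm_of_tower
  -- A contraction of two corrected blocks is the contraction of the blocks plus terms linear and
  -- quadratic in the coefficients κ, κ' of d_{11}.
  have hs : ∀ (x y : ℂ) (κ κ' : ℂ) (i l : Fin n),
      (∑ a : Fin n, (D (x + ħ / 2) i.succ a.succ +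
          if i = a then κ • D (x + ħ / 2) 0 0 else 0) •
        (D (y + ħ / 2) a.succ l.succ + if a = l then κ' • D (y + ħ / 2) 0 0 else 0) • w) =
      blockProd D (x + ħ / 2) (y + ħ / 2) w i l +
        κ • D (x + ħ / 2) 0 0 • D (y + ħ / 2) i.succ l.succ • w +
        κ' • D (x + ħ / 2) i.succ l.succ • D (y + ħ / 2) 0 0 • w +
        (if i = l then (κ' * κ) • D (x + ħ / 2) 0 0 • D (y + ħ / 2) 0 0 • w else 0) := by
    intro x y κ κ' i l
    simp only [add_smul, smul_add, ite_smul_zero', smul_assoc, Finset.sum_add_distrib,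
      Finset.sum_ite_eq, Finset.mem_univ, if_true, hsc, smul_ite, smul_zero,
      Finset.sum_ite_eq', blockProd, mul_smul]
    by_cases h : i = l <;> simp [h] <;> abel
  simp only [tau_apply]
  rw [hs, hs, hs, hs]
  simp only [add_smul, smul_add, ite_smul_zero', smul_assoc, hsc, smul_ite,
    smul_zero, cX, cY, cXY]
  rw [← hsum, ← hsum, ← hsum, ← hsum] at e₀
  simp only [hite (i = l), hite (k = j), hite (i = j), hite (k = l)] at *
  generalize ħ / (2 * x) = κ at *
  generalize ħ / (2 * y) = κ' at *
  generalize (if i = l then (1 : ℂ) else 0) = a₁ at *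
  generalize (if k = j then (1 : ℂ) else 0) = a₂ at *
  generalize (if i = j then (1 : ℂ) else 0) = a₃ at *
  generalize (if k = l then (1 : ℂ) else 0) = a₄ at *
  clear hs hsc hsum cX cY cXY
  obtain ⟨f, hf⟩ := exists_action A V
  simp only [hf] at e₀ e₁ e₂ e₃ ⊢
  -- `e₁`, `e₂` and `e₃` remove the summand of index 0 from the three kinds of contraction in `e₀`;
  -- the remaining d_{11} terms match by 2xκ = ħ and 2yκ' = ħ.
  linear_combination (norm := module) (x + y) • e₀ + (ħ * a₂) • e₁ + (ħ * a₁) • e₂ -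
    (ħ * ħ * a₃) • e₃ -
    eX • (((x + y + ħ) * ħ * a₂) • f (D (x + ħ / 2) 0 0) (f (D (y + ħ / 2) i.succ l.succ) w) -
      ((x + y + ħ) * ħ * a₁) • f (D (x + ħ / 2) 0 0) (f (D (y + ħ / 2) k.succ j.succ) w)) +
    eY • (((x + y + ħ) * ħ * a₂) • f (D (y + ħ / 2) 0 0) (f (D (x + ħ / 2) i.succ l.succ) w) -
      ((x + y + ħ) * ħ * a₁) • f (D (y + ħ / 2) 0 0) (f (D (x + ħ / 2) k.succ j.succ) w))

/-- The componentwise result misses x = y and x + y = -ħ, where an overall factor was divided out;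
continuity in x supplies these points. -/
theorem ReflData.tau {D : ℂ → Matrix (Fin (n + 1)) (Fin (n + 1)) A} (hD : ReflData ħ D W S) :
    ReflData ħ (tau ħ D) (hwSub D W S) (tauSet ħ S) := by
  have hcont : ∀ i j, ∀ w ∈ hwSub D W S,
      WeakContOn (fun x => OpenChain.tau ħ D x i j • w) (tauSet ħ S) := by
    intro i j w hw
    simp only [tau_apply, add_smul, ite_smul_zero', smul_assoc]
    have hm : Set.MapsTo (fun x => x + ħ / 2) (tauSet ħ S) S := fun x hx => hx.1
    refine WeakContOn.add ((hD.cont _ _ w hw.1).comp (by fun_prop) hm)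
      (WeakContOn.ite (WeakContOn.smul ?_ ((hD.cont _ _ w hw.1).comp (by fun_prop) hm)))
    exact continuousOn_const.div (by fun_prop) fun x hx => mul_ne_zero two_ne_zero hx.2
  refine ⟨tauSet_finite_compl ħ hD.finite_compl, fun x hx i j w hw => hD.tau_smul_mem hx i j hw,
    hcont, fun x hx y hy => agreeOn_refl_iff.2 fun w hw i j k l => ?_⟩
  refine reflAt_of_generic (F := {y, -(y + ħ)}) (tauSet_finite_compl ħ hD.finite_compl)
    (fun x hx i j w hw => hD.tau_smul_mem hx i j hw) hcont hy (by simp) hw i j k l ?_ x hx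
  intro x hx hxF
  simp only [Set.mem_insert_iff, Set.mem_singleton_iff, not_or] at hxF
  exact hD.tau_reflAt hw hx hy hxF.1 (fun h => hxF.2 (by linear_combination h)) i j k l

end HighestSubspace


/-! ### Operators on one site -/

section OnSite

variable {S : Type*} [DecidableEq S] [Fintype S] {n : ℕ} {A : Type*} [Ring A]

theorem sum_agree_off {M : Type*} [AddCommMonoid M] (s : S) (p : S → Fin n) (f : (S → Fin n) → M) :
    (∑ q : S → Fin n, if ∀ x, x ≠ s → p x = q x then f q else 0) =
      ∑ a : Fin n, f (Function.update p s a) := by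
  rw [← Finset.sum_filter]
  refine Finset.sum_nbij' (fun q => q s) (fun a => Function.update p s a) ?_ ?_ ?_ ?_ ?_
  · simp
  · intro a _
    simp only [Finset.mem_filter, Finset.mem_univ, true_and]
    intro x hx; simp [hx]
  · intro q hq
    simp only [Finset.mem_filter, Finset.mem_univ, true_and] at hq
    funext x
    by_cases hx : x = s
    · subst hx; simp
    · simp [hx, hq x hx]
  · intro a _; simp
  · intro q hq
    simp only [Finset.mem_filter, Finset.mem_univ, true_and] at hq
    congr 1
    funext x
    by_cases hx : x = s
    · subst hx; simp
    · simp [hx, hq x hx]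

theorem onSite_mul (s : S) (X Y : Matrix (Fin n) (Fin n) A) :
    onSite s (X * Y) = onSite s X * onSite s Y := by
  ext p q
  rw [Matrix.mul_apply]
  have : ∀ r, onSite s X p r * onSite s Y r q =
      if ∀ x, x ≠ s → p x = r x then X (p s) (r s) * onSite s Y r q else 0 := by
    intro r
    simp only [onSite]
    split_ifs <;> simp
  simp only [this]
  rw [sum_agree_off]
  simp only [onSite, Function.update_self, Matrix.mul_apply]
  by_cases h : ∀ x, x ≠ s → p x = q x
  · rw [if_pos h]
    refine Finset.sum_congr rfl fun a _ => ?_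
    rw [if_pos fun x hx => by simp [hx, h x hx]]
  · rw [if_neg h]
    refine (Finset.sum_eq_zero fun a _ => ?_).symm
    rw [if_neg fun h' => h fun x hx => by simpa [hx] using h' x hx, mul_zero]

theorem onSite_one (s : S) : onSite s (1 : Matrix (Fin n) (Fin n) A) = 1 := by
  ext p q
  simp only [onSite, Matrix.one_apply]
  by_cases h : p = q
  · simp [h]
  · rw [if_neg h]
    split_ifs with h1 h2
    · exact absurd (funext fun x => if hx : x = s then hx ▸ h2 else h1 x hx) h
    · rfl
    · rfl

theorem onSite_add (s : S) (X Y : Matrix (Fin n) (Fin n) A) :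
    onSite s (X + Y) = onSite s X + onSite s Y := by
  ext p q
  simp only [onSite, Matrix.add_apply]
  split_ifs <;> simp

theorem onSite_zero (s : S) : onSite s (0 : Matrix (Fin n) (Fin n) A) = 0 := by
  ext p q
  simp [onSite]

theorem onSite_sum {κ : Type*} (s : S) (t : Finset κ) (X : κ → Matrix (Fin n) (Fin n) A) :
    onSite s (∑ a ∈ t, X a) = ∑ a ∈ t, onSite s (X a) := by
  classical
  induction t using Finset.induction_on with
  | empty => simp [onSite_zero]
  | insert a t ha ih => rw [Finset.sum_insert ha, Finset.sum_insert ha, onSite_add, ih]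

theorem onSite_smul_apply {V : Type*} [AddCommGroup V] [Module A V] (s : S)
    (X : Matrix (Fin n) (Fin n) A) (v : (S → Fin n) → V) (p : S → Fin n) :
    (onSite s X • v) p = ∑ a, X (p s) a • v (Function.update p s a) := by
  rw [Matrix.Module.smul_apply]
  simp only [onSite, ite_smul, zero_smul]
  rw [sum_agree_off]
  simp

theorem onSite_mul_onSite_apply {s t : S} (hst : s ≠ t) (X Y : Matrix (Fin n) (Fin n) A)
    (p q : S → Fin n) :
    (onSite s X * onSite t Y) p q =
      if ∀ x, x ≠ s → x ≠ t → p x = q x then X (p s) (q s) * Y (p t) (q t) else 0 := by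
  rw [Matrix.mul_apply]
  have : ∀ r, onSite s X p r * onSite t Y r q =
      if ∀ x, x ≠ s → p x = r x then X (p s) (r s) * onSite t Y r q else 0 := by
    intro r
    simp only [onSite]
    split_ifs <;> simp
  simp only [this]
  rw [sum_agree_off]
  simp only [onSite, Function.update_self]
  rw [Finset.sum_eq_single (q s)]
  · by_cases h : ∀ x, x ≠ s → x ≠ t → p x = q x
    · rw [if_pos h, if_pos]
      · simp [hst.symm]
      · intro x hx
        by_cases hxs : x = s
        · subst hxs; simp
        · simpa [hxs] using h x hxs hx
    · rw [if_neg h, if_neg, mul_zero]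
      exact fun h' => h fun x hx hx' => by simpa [hx] using h' x hx'
  · intro a _ ha
    rw [if_neg, mul_zero]
    exact fun h => ha (by simpa using h s hst)
  · simp

theorem onSite_commute {s t : S} (hst : s ≠ t) {X Y : Matrix (Fin n) (Fin n) A}
    (h : ∀ i j k l, Commute (X i j) (Y k l)) : Commute (onSite s X) (onSite t Y) := by
  ext p q
  rw [onSite_mul_onSite_apply hst, onSite_mul_onSite_apply hst.symm, (h _ _ _ _).eq]
  congr 1
  exact propext ⟨fun h x h1 h2 => h x h2 h1, fun h x h1 h2 => h x h2 h1⟩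

end OnSite

/-! ### Dressing by matrix units -/

section MatrixUnits

variable {n : ℕ} {A V : Type*} [Ring A] [Algebra ℂ A] [AddCommGroup V] [Module ℂ V] [Module A V]

/-- A system of matrix units in an algebra. -/
structure IsMatrixUnits (e : Fin n → Fin n → A) : Prop where
  mul : ∀ i j k l, e i j * e k l = if j = k then e i l else 0
  sum : ∑ i, e i i = 1

noncomputable section

/-- The matrix `(x - ħ ∑ E_{ij} ⊗ e_{ji}) / (x - ħ)`. -/
def unitR (ħ : ℂ) (e : Fin n → Fin n → A) (x : ℂ) : Matrix (Fin n) (Fin n) A := fun i j =>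
  (x - ħ)⁻¹ • ((x * if i = j then (1 : ℂ) else 0) • 1 - ħ • e j i)

theorem unitR_mul_unitR {e : Fin n → Fin n → A} (he : IsMatrixUnits e) (ħ x y : ℂ)
    (i j k l : Fin n) :
    unitR ħ e x i j * unitR ħ e y k l = ((x - ħ)⁻¹ * (y - ħ)⁻¹) •
      ((x * y * (if i = j then 1 else 0) * if k = l then 1 else 0) • 1 -
        (x * ħ * if i = j then 1 else 0) • e l k - (y * ħ * if k = l then 1 else 0) • e j i +
        (ħ * ħ * if i = l then 1 else 0) • e j k) := by
  have h : e j i * e l k = (if i = l then (1 : ℂ) else 0) • e j k := by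
    rw [he.mul]; split_ifs <;> simp
  simp only [unitR]
  rw [smul_mul_smul_comm]
  congr 1
  simp only [sub_mul, mul_sub, smul_mul_assoc, mul_smul_comm, one_mul, mul_one, h, smul_smul]
  module

theorem unitR_mul_apply {e : Fin n → Fin n → A} (he : IsMatrixUnits e) (ħ x y : ℂ) (i l : Fin n) :
    (unitR ħ e x * unitR ħ e y) i l = ((x - ħ)⁻¹ * (y - ħ)⁻¹) •
      (((x * y + ħ * ħ) * if i = l then 1 else 0) • 1 - ((x + y) * ħ) • e l i) := by
  rw [Matrix.mul_apply]
  simp only [unitR_mul_unitR he, ← Finset.smul_sum]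
  congr 1
  simp only [Finset.sum_add_distrib, Finset.sum_sub_distrib, ← Finset.smul_sum, he.sum]
  simp only [mul_ite, mul_one, mul_zero, ite_smul, zero_smul,
    Finset.sum_ite_eq, Finset.sum_ite_eq', Finset.mem_univ, if_true]
  split_ifs <;> module

/-- This is the Yang–Baxter equation with the third space represented by the matrix units `e`. -/
theorem unitR_rtt {e : Fin n → Fin n → A} (he : IsMatrixUnits e) (ħ x y : ℂ) :
    rMat ħ n A (x - y) * leg₁ (unitR ħ e x) * leg₂ (unitR ħ e y) =
      leg₂ (unitR ħ e y) * leg₁ (unitR ħ e x) * rMat ħ n A (x - y) := by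
  rw [rtt_iff]
  intro i j k l
  simp only [unitR_mul_unitR he]
  module

/-- The background is unitarity: (x - ħP)(-x - ħP) is scalar, so R(x) is proportional to the inverse
of R(-x). The same matrix therefore serves in the role of T(x) and in that of T⁻¹(-x). -/
theorem unitR_cross {e : Fin n → Fin n → A} (he : IsMatrixUnits e) (ħ x y : ℂ) :
    leg₁ (unitR ħ e x) * rMat ħ n A (x + y) * leg₂ (unitR ħ e y) =
      leg₂ (unitR ħ e y) * rMat ħ n A (x + y) * leg₁ (unitR ħ e x) := by
  have hite : ∀ (p : Prop) [Decidable p] (v : A),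
      (if p then v else 0) = (if p then (1 : ℂ) else 0) • v := by
    intro p _ v; split_ifs <;> simp
  rw [cross_iff]
  intro i j k l
  rw [unitR_mul_apply he, unitR_mul_apply he, hite (k = j), hite (i = l)]
  simp only [unitR_mul_unitR he]
  module

theorem unitR_exchangeRel {e : Fin n → Fin n → A} (he : IsMatrixUnits e) (ħ a x y : ℂ) :
    ExchangeRel ħ (fun x => unitR ħ e (x + a)) (fun x => unitR ħ e (x - a)) x y where
  ll := by simpa using unitR_rtt he ħ (x + a) (y + a)
  nn := by simpa using unitR_rtt he ħ (x - a) (y - a)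
  nl := by simpa using unitR_cross he ħ (x - a) (y + a)
  ln := by simpa using unitR_cross he ħ (x + a) (y - a)

theorem unitR_commute {e : Fin n → Fin n → A} {b : A} (h : ∀ i j, Commute b (e i j)) (ħ x : ℂ)
    (i j : Fin n) : Commute b (unitR ħ e x i j) :=
  (((Commute.one_right b).smul_right _).sub_right ((h j i).smul_right _)).smul_right _

variable {W : Submodule ℂ V} {S : Set ℂ} [IsScalarTower ℂ A V]

theorem unitR_smul (ħ : ℂ) (e : Fin n → Fin n → A) (x : ℂ) (i j : Fin n) (v : V) :
    unitR ħ e x i j • v =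
      (x - ħ)⁻¹ • ((x * if i = j then (1 : ℂ) else 0) • v - ħ • e j i • v) := by
  simp only [unitR, smul_assoc, sub_smul, one_smul]

theorem unitR_smul_mem {e : Fin n → Fin n → A} (h : ∀ i j, ∀ w ∈ W, e i j • w ∈ W) (ħ x : ℂ)
    (i j : Fin n) {w : V} (hw : w ∈ W) : unitR ħ e x i j • w ∈ W := by
  rw [unitR_smul]
  exact W.smul_mem _ (W.sub_mem (W.smul_mem _ hw) (W.smul_mem _ (h _ _ w hw)))

/-- `R(x + a) D(x) R(x - a)`. -/
def dress (ħ : ℂ) (e : Fin n → Fin n → A) (a : ℂ) (D : ℂ → Matrix (Fin n) (Fin n) A) (x : ℂ) :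
    Matrix (Fin n) (Fin n) A :=
  unitR ħ e (x + a) * D x * unitR ħ e (x - a)

/-- The points of `S` at which `R(x ± a)` is defined. -/
def dressSet (ħ a : ℂ) (S : Set ℂ) : Set ℂ := {x | x ∈ S ∧ x + a ≠ ħ ∧ x - a ≠ ħ}

omit [Module ℂ V] [IsScalarTower ℂ A V] in
theorem dress_smul (ħ : ℂ) (e : Fin n → Fin n → A) (a : ℂ) (D : ℂ → Matrix (Fin n) (Fin n) A)
    (x : ℂ) (i j : Fin n) (v : V) :
    dress ħ e a D x i j • v =
      ∑ q, ∑ p, unitR ħ e (x + a) i p • D x p q • unitR ħ e (x - a) q j • v := by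
  simp only [dress, Matrix.mul_apply, Finset.sum_smul, mul_smul]

theorem ReflData.dress {D : ℂ → Matrix (Fin n) (Fin n) A} {ħ : ℂ} (hD : ReflData ħ D W S)
    {e : Fin n → Fin n → A} (he : IsMatrixUnits e) (heW : ∀ i j, ∀ w ∈ W, e i j • w ∈ W)
    (hcomm : ∀ x i j k l, Commute (D x i j) (e k l)) (a : ℂ) :
    ReflData ħ (dress ħ e a D) W (dressSet ħ a S) where
  finite_compl := by
    have : (dressSet ħ a S)ᶜ ⊆ Sᶜ ∪ {ħ - a, ħ + a} := by
      intro x hx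
      by_contra h
      simp only [Set.mem_union, Set.mem_compl_iff, Set.mem_insert_iff, Set.mem_singleton_iff,
        not_or, not_not] at h
      exact hx ⟨h.1, fun h' => h.2.1 (by linear_combination h'),
        fun h' => h.2.2 (by linear_combination h')⟩
    exact (hD.finite_compl.union (by simp)).subset this
  smul_mem x hx i j w hw := by
    rw [dress_smul]
    exact W.sum_mem fun q _ => W.sum_mem fun p _ => unitR_smul_mem (V := V) (W := W) heW _ _ _ _
      (hD.smul_mem x hx.1 _ _ _ (unitR_smul_mem (V := V) (W := W) heW _ _ _ _ hw))
  cont i j w hw := by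
    simp only [dress_smul]
    refine WeakContOn.sum _ fun q _ => WeakContOn.sum _ fun p _ => ?_
    have hsc : ∀ (c : ℂ) (a : A) (v : V), a • c • v = c • a • v := smul_smul_comm_of_tower
    simp only [unitR_smul, smul_sub, hsc]
    have hm : dressSet ħ a S ⊆ S := fun x hx => hx.1
    have c₁ : ContinuousOn (fun x => (x + a - ħ)⁻¹) (dressSet ħ a S) :=
      ContinuousOn.inv₀ (by fun_prop) fun x hx => sub_ne_zero.2 hx.2.1
    have c₂ : ContinuousOn (fun x => (x - a - ħ)⁻¹) (dressSet ħ a S) :=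
      ContinuousOn.inv₀ (by fun_prop) fun x hx => sub_ne_zero.2 hx.2.2
    have c₃ : ∀ c b : ℂ, ContinuousOn (fun x => (x + b) * c) (dressSet ħ a S) := by
      intros; fun_prop
    have c₄ : ∀ c b : ℂ, ContinuousOn (fun x => (x - b) * c) (dressSet ħ a S) := by
      intros; fun_prop
    have h₁ := (hD.cont p q w hw).mono hm
    have h₂ := (hD.cont p q _ (heW j q w hw)).mono hm
    have h₁' := h₁.smul_left (e p i)
    have h₂' := h₂.smul_left (e p i)
    exact ((WeakContOn.smul c₂ (WeakContOn.smul (c₄ _ _) (WeakContOn.smul c₁ (WeakContOn.smul (c₃ _ _) h₁)))).sub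
        (WeakContOn.smul c₂ (WeakContOn.smul (c₄ _ _) (WeakContOn.smul c₁ (WeakContOn.smul continuousOn_const h₁'))))).sub
      ((WeakContOn.smul c₂ (WeakContOn.smul continuousOn_const (WeakContOn.smul c₁ (WeakContOn.smul (c₃ _ _) h₂)))).sub
        (WeakContOn.smul c₂ (WeakContOn.smul continuousOn_const (WeakContOn.smul c₁ (WeakContOn.smul continuousOn_const h₂')))))
  refl x hx y hy := by
    refine agreeOn_refl_dress (unitR_exchangeRel he ħ a x y) ?_ ?_ ?_ ?_ ?_ ?_
      (hD.refl x hx.1 y hy.1)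
    · exact fun i j k l => unitR_commute (hcomm x i j) ħ _ k l
    · exact fun i j k l => (unitR_commute (hcomm y k l) ħ _ i j).symm
    · exact fun i j k l => (unitR_commute (hcomm y k l) ħ _ i j).symm
    · exact fun i j k l => unitR_commute (hcomm x i j) ħ _ k l
    · exact fun i j w hw => unitR_smul_mem (V := V) (W := W) heW _ _ _ _ hw
    · exact fun i j w hw => unitR_smul_mem (V := V) (W := W) heW _ _ _ _ hw

/-! ### Dressed generators on a highest weight vector -/

section HighestVector

variable {D : ℂ → Matrix (Fin (n + 1)) (Fin (n + 1)) A} {ħ : ℂ}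
  {e : Fin (n + 1) → Fin (n + 1) → A} (he : IsMatrixUnits e) {x a : ℂ}
  (hcomm : ∀ i j k l, Commute (D x i j) (e k l)) {v : V}
  (hv : ∀ i j, j ≠ 0 → e i j • v = 0) (hD : ∀ p, p ≠ 0 → D x p 0 • v = 0)

include hcomm hv hD in
-- The permutation term of the (q,l) entry involves e_{lq}, which kills v unless q = 0; then d_{p0}
-- v vanishes unless p = 0. A single term survives.
theorem dress_smul_highest_aux (l p : Fin (n + 1)) :
    ∑ q, D x p q • unitR ħ e (x - a) q l • v = (x - a - ħ)⁻¹ •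
      ((x - a) • D x p l • v - ħ • if p = 0 then e l 0 • D x 0 0 • v else 0) := by
  have hsc : ∀ (c : ℂ) (a : A) (v : V), a • c • v = c • a • v := smul_smul_comm_of_tower
  have h₁ : ∀ q, D x p q • e l q • v =
      if q = 0 then (if p = 0 then e l 0 • D x 0 0 • v else 0) else 0 := by
    intro q
    split_ifs with h h'
    · rw [h, h', ← mul_smul, (hcomm _ _ _ _).eq, mul_smul]
    · rw [h, ← mul_smul, (hcomm _ _ _ _).eq, mul_smul, hD p h', smul_zero]
    · rw [hv l q h, smul_zero]
  simp only [unitR_smul, smul_sub, hsc, h₁, Finset.sum_sub_distrib, ← Finset.smul_sum,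
    Finset.sum_ite_eq', Finset.mem_univ, if_true]
  congr 2
  rw [Finset.sum_eq_single l] <;> simp +contextual

include hcomm hv hD in
theorem dress_smul_highest_sum (j l : Fin (n + 1)) :
    dress ħ e a D x j l • v = (x - a - ħ)⁻¹ • ∑ p, unitR ħ e (x + a) j p •
      ((x - a) • D x p l • v - ħ • if p = 0 then e l 0 • D x 0 0 • v else 0) := by
  have hsc : ∀ (c : ℂ) (a : A) (v : V), a • c • v = c • a • v := smul_smul_comm_of_tower
  rw [dress_smul, Finset.sum_comm]
  simp only [← Finset.smul_sum, dress_smul_highest_aux hcomm hv hD, hsc]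

include he hcomm hv hD in
-- The permutation term of the left factor sees e_{pj} with j ≠ 0, which kills v after commuting
-- through `D`. Only the product of both permutation terms escapes, through e_{0j} e_{l0} = δ_{jl}
-- e_{00}; it is the source of the inhomogeneous ħ² term.
theorem dress_smul_highest {j : Fin (n + 1)} (hj : j ≠ 0) (l : Fin (n + 1)) :
    dress ħ e a D x j l • v = ((x - a - ħ)⁻¹ * (x + a - ħ)⁻¹) •
      ((x ^ 2 - a ^ 2) • D x j l • v +
        (ħ ^ 2) • if j = l then e 0 0 • D x 0 0 • v else 0) := by
  have hsc : ∀ (c : ℂ) (a : A) (v : V), a • c • v = c • a • v := smul_smul_comm_of_tower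
  rw [dress_smul_highest_sum hcomm hv hD]
  have h₁ : ∀ p, e p j • D x p l • v = 0 := fun p => by
    rw [← mul_smul, ← (hcomm _ _ _ _).eq, mul_smul, hv _ _ hj, smul_zero]
  have h₂ : e 0 j • e l 0 • D x 0 0 • v = if j = l then e 0 0 • D x 0 0 • v else 0 := by
    rw [← mul_smul, he.mul]; split_ifs <;> simp
  simp only [unitR_smul, smul_sub, hsc, h₁, smul_zero, smul_ite, h₂, ← Finset.smul_sum,
    Finset.sum_sub_distrib, Finset.sum_ite_eq', Finset.mem_univ, if_true, hj, if_false, mul_zero,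
    zero_smul, Finset.sum_const_zero]
  rw [Finset.sum_eq_single j (by simp +contextual [eq_comm]) (by simp)]
  obtain ⟨f, hf⟩ := exists_action A V
  simp only [hf]
  split_ifs <;> module

include hcomm hv hD in
-- The normalization by x - ħ is chosen so that R acts as 1 on e_2 ⊗ e_2; hence the corner entry is
-- not changed by dressing.
theorem dress_smul_highest_zero (hv0 : e 0 0 • v = v) (h₁ : x + a ≠ ħ) (h₂ : x - a ≠ ħ) :
    dress ħ e a D x 0 0 • v = D x 0 0 • v := by
  have hsc : ∀ (c : ℂ) (a : A) (v : V), a • c • v = c • a • v := smul_smul_comm_of_tower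
  have hDv : e 0 0 • D x 0 0 • v = D x 0 0 • v := by
    rw [← mul_smul, ← (hcomm _ _ _ _).eq, mul_smul, hv0]
  rw [dress_smul_highest_sum hcomm hv hD, Finset.sum_eq_single 0]
  · rw [if_pos rfl, hDv, unitR_smul, ← sub_smul, hsc, hDv, if_pos rfl]
    have h₁' := sub_ne_zero.2 h₁
    have h₂' := sub_ne_zero.2 h₂
    generalize D x 0 0 • v = v'
    match_scalars
    field_simp
  · intro p _ hp
    simp [hD p hp, hp]
  · simp

end HighestVector

end

end MatrixUnits

set_option linter.unusedSectionVars false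

/-! ### Dressing by fundamental representations -/

noncomputable section FundamentalDressing

variable {m n : ℕ} {A V : Type*} [Ring A] [Algebra ℂ A] [AddCommGroup V] [Module ℂ V] [Module A V]

/-- The matrix unit `E_{ij}` in the `c`-th space. -/
def siteUnit (A : Type*) [Ring A] (c : Fin m) (i j : Fin n) :
    Matrix (Fin m → Fin n) (Fin m → Fin n) A :=
  onSite c (Matrix.single i j 1)

theorem siteUnit_isMatrixUnits (c : Fin m) :
    IsMatrixUnits (siteUnit A c : Fin n → Fin n → _) where
  mul i j k l := by
    rw [siteUnit, siteUnit, ← onSite_mul]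
    split_ifs with h
    · subst h; simp [siteUnit]
    · rw [Matrix.single_mul_single_of_ne _ _ _ _ h, onSite_zero]
  sum := by
    simp only [siteUnit]
    rw [← onSite_sum, ← onSite_one c]
    congr 1
    ext i j
    simp [Matrix.sum_apply, Matrix.single_apply, Matrix.one_apply, ite_and]

theorem siteUnit_commute {c c' : Fin m} (h : c ≠ c') (i j k l : Fin n) :
    Commute (siteUnit A c i j) (siteUnit A c' k l) := by
  refine onSite_commute h fun a b a' b' => ?_
  simp only [Matrix.single_apply]
  split_ifs <;> simp

theorem diagonal_commute_siteUnit (d : A) (c : Fin m) (i j : Fin n) :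
    Commute (Matrix.diagonal fun _ => d) (siteUnit A c i j) := by
  ext p q
  rw [Matrix.diagonal_mul, Matrix.mul_diagonal]
  simp only [siteUnit, onSite, Matrix.single_apply]
  split_ifs <;> simp

theorem fundR_eq (ħ : ℂ) (c : Fin m) (x : ℂ) :
    (fundR ħ A c x : Matrix (Fin n) (Fin n) _) = unitR ħ (siteUnit A c) x := by
  have hproj : proj n 0 = 1 := by simp [proj]
  have h : ∀ i j : Fin n, (Matrix.of fun k l => algebraMap ℂ A (normR ħ n 0 0 x (i, k) (j, l))) =
      (x - ħ)⁻¹ • ((x * if i = j then (1 : ℂ) else 0) • (1 : Matrix (Fin n) (Fin n) A) -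
        ħ • Matrix.single j i 1) := by
    intro i j
    ext k l
    simp only [normR, hproj, Matrix.one_kronecker_one, one_mul, mul_one, rMatrix, Matrix.of_apply,
      Matrix.smul_apply, Matrix.sub_apply, permP_apply, Matrix.one_apply, Prod.mk.injEq,
      Matrix.single_apply, Algebra.algebraMap_eq_smul_one, smul_eq_mul]
    by_cases h₁ : i = j <;> by_cases h₂ : k = l <;> by_cases h₃ : i = l <;> by_cases h₄ : k = j <;>
      simp [h₁, h₂, h₃, h₄, smul_smul, mul_sub, sub_smul, smul_sub, eq_comm] <;>
      simp_all <;> exact fun h => absurd h.symm h₄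
  ext i j p q
  have := congrFun (congrFun (h i j) (p c)) (q c)
  rw [Matrix.of_apply] at this
  have h1 : (1 : Matrix (Fin m → Fin n) (Fin m → Fin n) A) p q = onSite c 1 p q := by
    rw [onSite_one]
  simp only [fundR, unitR, siteUnit, Matrix.smul_apply, Matrix.sub_apply, h1]
  simp only [onSite, this, Matrix.smul_apply, Matrix.sub_apply]
  split_ifs <;> simp

/-- `D` dressed by the fundamental representations in the spaces `c ∈ l`. -/
def dressList (ħ : ℂ) (a : Fin m → ℂ) (D : ℂ → Matrix (Fin n) (Fin n) A) :
    List (Fin m) → ℂ → Matrix (Fin n) (Fin n) (Matrix (Fin m → Fin n) (Fin m → Fin n) A)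
  | [] => fun x => (D x).map fun d => Matrix.diagonal fun _ => d
  | c :: l => dress ħ (siteUnit A c) (a c) (dressList ħ a D l)

theorem dressList_eq (ħ : ℂ) (a : Fin m → ℂ) (D : ℂ → Matrix (Fin n) (Fin n) A)
    (l : List (Fin m)) (x : ℂ) :
    dressList ħ a D l x = (l.map fun c => fundR ħ A c (x + a c)).prod *
      (D x).map (fun d => Matrix.diagonal fun _ => d) *
      (l.map fun c => fundR ħ A c (x - a c)).reverse.prod := by
  induction l with
  | nil => simp [dressList]
  | cons c l ih =>
    rw [dressList, dress, ih]
    simp only [List.map_cons, List.prod_cons, List.reverse_cons, List.prod_append,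
      List.prod_nil, mul_one, fundR_eq, mul_assoc]

theorem coprodFund_eq (ħ : ℂ) (a : Fin m → ℂ) (D : ℂ → Matrix (Fin n) (Fin n) A) :
    coprodFund ħ a D = dressList ħ a D (List.finRange m) := by
  funext x
  rw [dressList_eq, coprodFund, List.ofFn_eq_map, List.ofFn_eq_map]

/-- Dressing in one further space requires entries that commute with the matrix units of that space;
this holds as long as the space has not been used. -/
theorem dressList_commute (ħ : ℂ) (a : Fin m → ℂ) (D : ℂ → Matrix (Fin n) (Fin n) A)
    {l : List (Fin m)} {c : Fin m} (hc : c ∉ l) (x : ℂ) (i j k k' : Fin n) :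
    Commute (dressList ħ a D l x i j) (siteUnit A c k k') := by
  induction l generalizing i j with
  | nil => exact diagonal_commute_siteUnit _ _ _ _
  | cons c' l ih =>
    rw [List.mem_cons, not_or] at hc
    have h : ∀ y p q, Commute (unitR ħ (siteUnit A c') y p q) (siteUnit A c k k') := fun y p q =>
      (unitR_commute (fun _ _ => siteUnit_commute hc.1 _ _ _ _) ħ y p q).symm
    simp only [dressList, dress, Matrix.mul_apply]
    exact Commute.sum_left _ _ _ fun q _ => Commute.mul_left
      (Commute.sum_left _ _ _ fun p _ => (h _ _ _).mul_left (ih hc.2 _ _)) (h _ _ _)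

theorem siteUnit_smul_apply (c : Fin m) (i j : Fin n) (f : (Fin m → Fin n) → V)
    (p : Fin m → Fin n) :
    (siteUnit A c i j • f) p = if p c = i then f (Function.update p c j) else 0 := by
  rw [siteUnit, onSite_smul_apply]
  simp only [Matrix.single_apply, ite_smul, one_smul, zero_smul, ite_and]
  by_cases h : p c = i
  · subst h; simp
  · simp [h, Ne.symm h]

/-- The functions with values in `W`. -/
def piSub (ι : Type*) (W : Submodule ℂ V) : Submodule ℂ (ι → V) := Submodule.pi Set.univ fun _ => W

theorem mem_piSub {ι : Type*} {W : Submodule ℂ V} {f : ι → V} : f ∈ piSub ι W ↔ ∀ p, f p ∈ W := by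
  simp [piSub]

theorem siteUnit_smul_mem {W : Submodule ℂ V} (c : Fin m) (i j : Fin n)
    {f : (Fin m → Fin n) → V} (hf : f ∈ piSub (Fin m → Fin n) W) : siteUnit A c i j • f ∈ piSub (Fin m → Fin n) W := by
  rw [mem_piSub] at hf ⊢
  intro p
  rw [siteUnit_smul_apply]
  split_ifs
  · exact hf _
  · exact W.zero_mem

variable [IsScalarTower ℂ A V] {ħ : ℂ} {W : Submodule ℂ V} {S : Set ℂ}

theorem diagonal_smul (d : A) (f : (Fin m → Fin n) → V) :
    (Matrix.diagonal fun _ => d : Matrix (Fin m → Fin n) (Fin m → Fin n) A) • f =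
      fun p => d • f p := by
  rw [Matrix.Module.diagonal_const_smul]
  rfl

theorem ReflData.map_diagonal {D : ℂ → Matrix (Fin n) (Fin n) A} (hD : ReflData ħ D W S) :
    ReflData ħ (fun x => (D x).map fun d =>
      (Matrix.diagonal fun _ => d : Matrix (Fin m → Fin n) (Fin m → Fin n) A)) (piSub (Fin m → Fin n) W) S where
  finite_compl := hD.finite_compl
  smul_mem x hx i j f hf := by
    rw [mem_piSub] at hf ⊢
    intro p
    rw [Matrix.map_apply, diagonal_smul]
    exact hD.smul_mem x hx i j _ (hf p)
  cont i j f hf := by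
    refine (WeakContOn.sum Finset.univ fun p _ => (hD.cont i j _ (mem_piSub.1 hf p)).map
      (LinearMap.single ℂ (fun _ : Fin m → Fin n => V) p)).congr fun x _ => ?_
    rw [Matrix.map_apply, diagonal_smul]
    funext p
    simp
  refl x hx y hy := agreeOn_refl_iff.2 fun f hf i j k l => by
    funext p
    have := hD.reflAt hx hy (mem_piSub.1 hf p) i j k l
    simp only [ReflAt, Matrix.map_apply, diagonal_smul, Pi.add_apply, Pi.sub_apply, Pi.smul_apply,
      ite_apply, Finset.sum_apply, Pi.zero_apply] at this ⊢
    exact this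

theorem ReflData.dressList {D : ℂ → Matrix (Fin n) (Fin n) A} (hD : ReflData ħ D W S)
    (a : Fin m → ℂ) {l : List (Fin m)} (hl : l.Nodup) :
    ReflData ħ (dressList ħ a D l) (piSub (Fin m → Fin n) W)
      {x | x ∈ S ∧ ∀ c ∈ l, x + a c ≠ ħ ∧ x - a c ≠ ħ} := by
  induction l with
  | nil =>
    have h : {x | x ∈ S ∧ ∀ c ∈ ([] : List (Fin m)), x + a c ≠ ħ ∧ x - a c ≠ ħ} = S := by simp
    rw [h]
    exact hD.map_diagonal
  | cons c l ih =>
    rw [List.nodup_cons] at hl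
    have := (ih hl.2).dress (siteUnit_isMatrixUnits c) (fun i j w hw => siteUnit_smul_mem c i j hw)
      (fun x i j k k' => dressList_commute ħ a D hl.1 x i j k k') (a c)
    have h : {x | x ∈ S ∧ ∀ c' ∈ c :: l, x + a c' ≠ ħ ∧ x - a c' ≠ ħ} =
        dressSet ħ (a c) {x | x ∈ S ∧ ∀ c ∈ l, x + a c ≠ ħ ∧ x - a c ≠ ħ} := by
      ext x
      simp only [dressSet, Set.mem_ofPred_eq, List.mem_cons, forall_eq_or_imp]
      tauto
    rw [h]
    exact this

/-- The regular points of `psiGen`. -/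
def psiSet (ħ : ℂ) (a : Fin m → ℂ) (S : Set ℂ) : Set ℂ :=
  {x | x ∈ tauSet ħ S ∧ ∀ c, x + a c ≠ ħ ∧ x - a c ≠ ħ}

theorem psiGen_eq (a : Fin m → ℂ) (D : ℂ → Matrix (Fin (n + 1)) (Fin (n + 1)) A) :
    psiGen ħ a D = dressList ħ a (tau ħ D) (List.finRange m) := coprodFund_eq _ _ _

/-- `tau` replaces `W` by `hwSub`, and the dressing tensors the module with the first-level spaces,
on which the R-matrices act without leaving the functions with values in `hwSub`. -/
theorem ReflData.psiGen {D : ℂ → Matrix (Fin (n + 1)) (Fin (n + 1)) A} (hD : ReflData ħ D W S)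
    (a : Fin m → ℂ) :
    ReflData ħ (psiGen ħ a D) (piSub (Fin m → Fin n) (hwSub D W S)) (psiSet ħ a S) := by
  have := hD.tau.dressList a (List.nodup_finRange m)
  rw [psiGen_eq]
  convert this using 1
  ext x
  simp [psiSet]

/-! ### The action on the highest weight vector -/

/-- `e_2 ⊗ ⋯ ⊗ e_2 ⊗ w`. -/
def highestTensor (m n : ℕ) (w : V) : (Fin m → Fin (n + 1)) → V := Pi.single (fun _ => 0) w

theorem highestTensor_apply (w : V) (p : Fin m → Fin (n + 1)) :
    highestTensor m n w p = if p = fun _ => 0 then w else 0 := by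
  rw [highestTensor, Pi.single_apply]

theorem siteUnit_smul_highestTensor (c : Fin m) (i : Fin (n + 1)) {j : Fin (n + 1)} (hj : j ≠ 0)
    (w : V) : siteUnit A c i j • highestTensor m n w = 0 := by
  funext p
  have h : Function.update p c j ≠ fun _ => 0 := fun h => hj (by simpa using congrFun h c)
  rw [siteUnit_smul_apply, highestTensor_apply, if_neg h]
  simp

theorem siteUnit_zero_smul_highestTensor (c : Fin m) (w : V) :
    siteUnit A c (0 : Fin (n + 1)) 0 • highestTensor m n w = highestTensor m n w := by
  funext p
  rw [siteUnit_smul_apply, highestTensor_apply, highestTensor_apply]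
  by_cases h : p c = 0
  · rw [if_pos h, ← h, Function.update_eq_self]
  · rw [if_neg h, if_neg fun h' => h (by rw [h'])]

theorem diagonal_smul_highestTensor (d : A) (w : V) :
    (Matrix.diagonal fun _ => d : Matrix (Fin m → Fin (n + 1)) (Fin m → Fin (n + 1)) A) •
      highestTensor m n w = highestTensor m n (d • w) := by
  rw [Matrix.Module.diagonal_const_smul]
  funext p
  simp [highestTensor_apply]

theorem highestTensor_add (w w' : V) :
    highestTensor m n (w + w') = highestTensor m n w + highestTensor m n w' := by
  simp [highestTensor, Pi.single_add]

theorem highestTensor_smul (c : ℂ) (w : V) :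
    highestTensor m n (c • w) = c • highestTensor m n w := by
  simp [highestTensor, Pi.single_smul]

@[simp] theorem highestTensor_zero : highestTensor m n (0 : V) = 0 := by
  simp [highestTensor]

/-- The eigenvalue of `ℝ(x + a) ⊗ ℝ(x - a)` on orthogonal basis vectors. -/
def rho (ħ a x : ℂ) : ℂ := (x - a - ħ)⁻¹ * (x + a - ħ)⁻¹ * (x ^ 2 - a ^ 2)

section

variable {D : ℂ → Matrix (Fin (n + 1)) (Fin (n + 1)) A} (a : Fin m → ℂ) {x : ℂ} {w : V}
  (hw : ∀ p, p ≠ 0 → D x p 0 • w = 0)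

include hw in
-- Dressing scales d_{ij} by `rho` but adds an inhomogeneous multiple of d_{00} on the diagonal.
-- With κ = ħ/(2x-ħ), independent of the dressing parameter, the combination d_{ij} + δ_{ij} κ
-- d_{00} is scaled homogeneously, so the factors simply multiply over the list.
theorem dressList_smul_highestTensor {l : List (Fin m)} (hl : l.Nodup)
    (hx : ∀ c ∈ l, x + a c ≠ ħ ∧ x - a c ≠ ħ) :
    (∀ p, p ≠ 0 → dressList ħ a D l x p 0 • highestTensor m n w = 0) ∧
    dressList ħ a D l x 0 0 • highestTensor m n w = highestTensor m n (D x 0 0 • w) ∧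
    (∀ i j, i ≠ 0 → i ≠ j → D x i j • w = 0 →
      dressList ħ a D l x i j • highestTensor m n w = 0) ∧
    (∀ κ : ℂ, (2 * x - ħ) * κ = ħ → ∀ i j, i ≠ 0 → j ≠ 0 →
      dressList ħ a D l x i j • highestTensor m n w +
          (if i = j then κ • highestTensor m n (D x 0 0 • w) else 0) =
        (l.map fun c => rho ħ (a c) x).prod • (highestTensor m n (D x i j • w) +
          if i = j then κ • highestTensor m n (D x 0 0 • w) else 0)) := by
  induction l with
  | nil =>
    simp only [dressList, Matrix.map_apply, diagonal_smul_highestTensor, List.map_nil,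
      List.prod_nil, one_smul]
    refine ⟨fun p hp => by rw [hw p hp, highestTensor_zero], trivial,
      fun i j _ _ h => by rw [h, highestTensor_zero], fun _ _ _ _ _ _ => trivial⟩
  | cons c l ih =>
    rw [List.nodup_cons] at hl
    obtain ⟨h₁, h₂, h₃, h₄⟩ := ih hl.2 fun c' hc' => hx c' (List.mem_cons_of_mem _ hc')
    obtain ⟨hp, hm⟩ := hx c List.mem_cons_self
    have hcomm : ∀ i j k k', Commute (dressList ħ a D l x i j) (siteUnit A c k k') :=
      fun i j k k' => dressList_commute ħ a D hl.1 x i j k k'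
    have hv : ∀ i j, j ≠ 0 → siteUnit A c i j • highestTensor m n w = 0 :=
      fun i j hj => siteUnit_smul_highestTensor c i hj w
    have key : ∀ i, i ≠ 0 → ∀ j, dressList ħ a D (c :: l) x i j • highestTensor m n w =
        ((x - a c - ħ)⁻¹ * (x + a c - ħ)⁻¹) •
        ((x ^ 2 - a c ^ 2) • dressList ħ a D l x i j • highestTensor m n w +
          (ħ ^ 2) • if i = j then highestTensor m n (D x 0 0 • w) else 0) := by
      intro i hi j
      have := dress_smul_highest (siteUnit_isMatrixUnits c) hcomm hv h₁ hi j (a := a c) (ħ := ħ)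
      rw [h₂, siteUnit_zero_smul_highestTensor] at this
      exact this
    refine ⟨fun p hp => ?_, ?_, ?_, ?_⟩
    · rw [key p hp, h₁ p hp, if_neg hp]; simp
    · rw [← h₂]
      exact dress_smul_highest_zero hcomm hv h₁ (siteUnit_zero_smul_highestTensor c w) hp hm
    · intro i j hi hij h
      rw [key i hi, h₃ i j hi hij h, if_neg hij]; simp
    · intro κ hκ i j hi hj
      rw [key i hi, List.map_cons, List.prod_cons, mul_smul (rho ħ (a c) x), ← h₄ κ hκ i j hi hj]
      have hp' := sub_ne_zero.2 hp
      have hm' := sub_ne_zero.2 hm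
      -- From (x²-a²) - ((x-ħ)²-a²) = ħ(2x-ħ) follows rho - 1 = ħ(2x-ħ)/((x-a-ħ)(x+a-ħ));
      -- multiplication by κ turns the numerator into ħ².
      have : (x - a c - ħ)⁻¹ * (x + a c - ħ)⁻¹ * ħ ^ 2 + κ = rho ħ (a c) x * κ := by
        rw [rho]
        field_simp
        linear_combination (-ħ) * hκ
      split_ifs
      · generalize dressList ħ a D l x i j • highestTensor m n w = v₁
        generalize highestTensor m n (D x 0 0 • w) = v₂
        rw [rho] at this ⊢
        linear_combination (norm := module) this • v₂
      · generalize dressList ħ a D l x i j • highestTensor m n w = v₁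
        rw [rho]; module

end

theorem IsHighest.mem_hwSub {D : ℂ → Matrix (Fin (n + 1)) (Fin (n + 1)) A} {Ω : V}
    (h : IsHighest D W S Ω) : Ω ∈ hwSub D W S :=
  ⟨h.mem, fun x hx p => h.lower x hx _ _ (Fin.succ_pos p)⟩

theorem IsHighest.tau {D : ℂ → Matrix (Fin (n + 1)) (Fin (n + 1)) A} {Ω : V}
    (h : IsHighest D W S Ω) : IsHighest (tau ħ D) (hwSub D W S) (tauSet ħ S) Ω where
  mem := h.mem_hwSub
  lower x hx i j hij := by
    rw [tau_apply, if_neg hij.ne', add_zero]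
    exact h.lower _ hx.1 _ _ (Fin.succ_lt_succ_iff.2 hij)

theorem highestTensor_mem {w : V} (h : w ∈ W) :
    highestTensor m n w ∈ piSub (Fin m → Fin (n + 1)) W := by
  rw [mem_piSub]
  intro p
  rw [highestTensor_apply]
  split_ifs
  · exact h
  · exact W.zero_mem

theorem IsHighest.psiGen {D : ℂ → Matrix (Fin (n + 2)) (Fin (n + 2)) A} {Ω : V}
    (h : IsHighest D W S Ω) (a : Fin m → ℂ) :
    IsHighest (psiGen ħ a D) (piSub (Fin m → Fin (n + 1)) (hwSub D W S)) (psiSet ħ a S) (highestTensor m n Ω) where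
  mem := highestTensor_mem h.mem_hwSub
  lower x hx i j hij := by
    have ht := h.tau (ħ := ħ)
    have := (dressList_smul_highestTensor (ħ := ħ) (D := OpenChain.tau ħ D) a (x := x) (w := Ω)
      (fun p hp => ht.lower x hx.1 _ _ (Fin.pos_iff_ne_zero.2 hp)) (List.nodup_finRange m)
      fun c _ => hx.2 c).2.2.1 i j (Fin.ne_zero_of_lt hij) hij.ne' (ht.lower x hx.1 i j hij)
    rwa [psiGen_eq]

/-- The sum can be regrouped as (X_i + κb) + ħ/(2u) ∑_{q=1}^{k} (X_q + κb), because (2u + kħ)κ = ħ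
makes the total coefficient of b equal to ħ/(2u). Each bracket scales by ρ, and so does the whole.
-/
theorem hatD_smul_of_rel {E : Type*} [AddCommGroup E] [Module ℂ E]
    {X Y : Fin (n + 1) → E} {b : E} {κ ρ u : ℂ} (hu : u ≠ 0) {k : ℕ} (hk : k ≤ n)
    (hκ : (2 * u + k * ħ) * κ = ħ) (hX : X 0 = b) (hY : Y 0 = b)
    (h : ∀ i, i ≠ 0 → X i + κ • b = ρ • (Y i + κ • b)) (i : Fin (n + 1)) (hi : i ≠ 0) :
    X i + ∑ q : Fin (n + 1), (if (q : ℕ) < k + 1 then (ħ / (2 * u)) • X q else 0) =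
      ρ • (Y i + ∑ q : Fin (n + 1), if (q : ℕ) < k + 1 then (ħ / (2 * u)) • Y q else 0) := by
  have h' : ∀ i, i ≠ 0 → X i = ρ • (Y i + κ • b) - κ • b := fun i hi => by
    rw [← h i hi, add_sub_cancel_right]
  have hc : ħ / (2 * u) * (1 - k * κ) = κ := by
    field_simp
    linear_combination -hκ
  have hcard : ∑ q : Fin n, (if (q : ℕ) + 1 < k + 1 then (1 : ℂ) else 0) = k := by
    simp only [Nat.add_lt_add_iff_right]
    rw [Fin.sum_univ_eq_sum_range (fun q => if q < k then (1 : ℂ) else 0) n, ← Finset.sum_filter]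
    have : (Finset.range n).filter (· < k) = Finset.range k := by
      ext q; simp only [Finset.mem_filter, Finset.mem_range]; omega
    rw [this]; simp
  have hsum : ∑ q : Fin n, (if (q : ℕ) + 1 < k + 1 then (ħ / (2 * u)) • X q.succ else 0) =
      (ρ • ∑ q : Fin n, if (q : ℕ) + 1 < k + 1 then (ħ / (2 * u)) • Y q.succ else 0) +
        (ħ / (2 * u) * (ρ - 1) * κ * k) • b := by
    rw [← hcard, Finset.mul_sum, Finset.sum_smul, Finset.smul_sum, ← Finset.sum_add_distrib]
    refine Finset.sum_congr rfl fun q _ => ?_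
    split_ifs
    · rw [h' _ (Fin.succ_ne_zero q)]; module
    · simp
  rw [Fin.sum_univ_succ, Fin.sum_univ_succ]
  simp only [Fin.val_succ, Fin.val_zero, Nat.zero_lt_succ, if_true]
  rw [hsum, h' i hi, hX, hY]
  linear_combination (norm := module) ((1 - ρ) * hc) • b

/-- The heart of the comparison for the levels i ≥ 3: on e_2^{⊗m} ⊗ w, the generators formed from
the dressed matrix differ from those formed from τ(D) by a scalar only. -/
theorem psiGen_hatD_smul {D : ℂ → Matrix (Fin (n + 2)) (Fin (n + 2)) A} (a : Fin m → ℂ)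
    {u : ℂ} {k : ℕ} (hu : u ≠ 0) (hk : 2 * u + k * ħ ≠ 0)
    (hx : u + ((k + 1 : ℕ) : ℂ) * ħ / 2 ∈ psiSet ħ a S) {w : V}
    (hw : w ∈ hwSub (tau ħ D) (hwSub D W S) (tauSet ħ S)) (i j : Fin (n + 1)) :
    hatD ħ (psiGen ħ a D) (k + 1) u i j • highestTensor m n w =
      ((List.finRange m).map fun c => rho ħ (a c) (u + ((k + 1 : ℕ) : ℂ) * ħ / 2)).prod •
        highestTensor m n (hatD ħ (tau ħ D) (k + 1) u i j • w) := by
  set x := u + ((k + 1 : ℕ) : ℂ) * ħ / 2 with hxdef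
  obtain ⟨h₁, h₂, h₃, h₄⟩ := dressList_smul_highestTensor (ħ := ħ) (D := tau ħ D) a (x := x)
    (w := w) (fun p hp => by
      obtain ⟨q, rfl⟩ := Fin.exists_succ_eq.2 hp
      exact hw.2 x hx.1 q) (List.nodup_finRange m) fun c _ => hx.2 c
  have hκ : (2 * u + k * ħ) * (ħ / (2 * u + k * ħ)) = ħ := by field_simp
  -- At x = u + (k+1)ħ/2 one has 2x - ħ = 2u + kħ, so the κ of the dressing is the κ needed to
  -- regroup the sum in D̂.
  have hκ' : (2 * x - ħ) * (ħ / (2 * u + k * ħ)) = ħ := by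
    rw [← hκ]
    rw [hκ, hxdef]
    push_cast
    rw [show 2 * (u + (k + 1) * ħ / 2) - ħ = 2 * u + k * ħ by ring, hκ]
  simp only [hatD, ← hxdef, psiGen_eq]
  by_cases hij : k + 1 ≤ (i : ℕ) ∧ k + 1 ≤ (j : ℕ)
  · rw [if_pos hij, if_pos hij]
    have hi : i ≠ 0 := by rintro rfl; simp at hij
    have hj : j ≠ 0 := by rintro rfl; simp at hij
    by_cases h : i = j
    · subst h
      have := hatD_smul_of_rel (ħ := ħ) hu (k := k) (by omega) hκ
        (X := fun i => dressList ħ a (tau ħ D) (List.finRange m) x i i • highestTensor m n w)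
        (Y := fun i => highestTensor m n (tau ħ D x i i • w)) h₂ rfl
        (fun i hi => by simpa using h₄ _ hκ' i i hi hi) i hi
      simp only [if_true, add_smul, Finset.sum_smul, ite_smul_zero', smul_assoc]
      rw [this, highestTensor_add]
      congr 2
      have hsum : ∀ f : Fin (n + 1) → V, highestTensor m n (∑ q, f q) =
          ∑ q, highestTensor m n (f q) := fun f =>
        map_sum (LinearMap.single ℂ (fun _ : Fin m → Fin (n + 1) => V) fun _ => 0) f _
      rw [hsum]
      refine Finset.sum_congr rfl fun q _ => ?_
      split_ifs
      · rw [highestTensor_smul]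
      · simp
    · rw [if_neg h, if_neg h, add_zero, add_zero]
      simpa [h] using h₄ _ hκ' i j hi hj
  · rw [if_neg hij, if_neg hij]; simp

end FundamentalDressing


/-! ### Intertwining along an inclusion of basis labels -/

section Inclusion

variable {ι κ A V : Type*} [Fintype ι] [DecidableEq ι] [Fintype κ] [DecidableEq κ] [Ring A]
  [AddCommGroup V] [Module A V]

/-- The inclusion of free modules given by a map of basis labels. -/
def incl (A : Type*) [Ring A] (e : ι → κ) : Matrix κ ι A := fun p i => if p = e i then 1 else 0

/-- The action of `incl` on vectors. -/
def push (e : ι → κ) (F : ι → V) : κ → V := fun p => ∑ i, if p = e i then F i else 0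

theorem mul_incl_apply (X : Matrix κ κ A) (e : ι → κ) (p : κ) (i : ι) :
    (X * incl A e) p i = X p (e i) := by
  simp [Matrix.mul_apply, incl]

/-- The second condition says that `X` maps the span of the selected basis vectors to itself; on it
`X` then acts as `Y`. -/
theorem incl_intertwine {e : ι → κ} (he : Function.Injective e) {X : Matrix κ κ A}
    {Y : Matrix ι ι A} (h : ∀ i i', X (e i) (e i') = Y i i')
    (h0 : ∀ p, (∀ i, p ≠ e i) → ∀ i', X p (e i') = 0) : X * incl A e = incl A e * Y := by
  ext p i'
  rw [mul_incl_apply, Matrix.mul_apply]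
  by_cases hp : ∃ i, p = e i
  · obtain ⟨i, rfl⟩ := hp
    rw [h, Finset.sum_eq_single i]
    · simp [incl]
    · intro b _ hb
      rw [incl, if_neg fun h => hb (he h).symm, zero_mul]
    · simp
  · push Not at hp
    rw [h0 p hp, Finset.sum_eq_zero]
    intro i _
    rw [incl, if_neg (hp i), zero_mul]

theorem intertwine_mul {E : Matrix κ ι A} {X X' : Matrix κ κ A} {Y Y' : Matrix ι ι A}
    (h : X * E = E * Y) (h' : X' * E = E * Y') : X * X' * E = E * (Y * Y') := by
  rw [Matrix.mul_assoc, h', ← Matrix.mul_assoc, h, Matrix.mul_assoc]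

theorem intertwine_list {β : Type*} {E : Matrix κ ι A} {X : β → Matrix κ κ A}
    {Y : β → Matrix ι ι A} (l : List β) (h : ∀ b, X b * E = E * Y b) :
    (l.map X).prod * E = E * (l.map Y).prod := by
  induction l with
  | nil => simp
  | cons b l ih =>
    rw [List.map_cons, List.map_cons, List.prod_cons, List.prod_cons]
    exact intertwine_mul (h b) ih

theorem smul_push {e : ι → κ} {X : Matrix κ κ A} {Y : Matrix ι ι A}
    (h : X * incl A e = incl A e * Y) (F : ι → V) : X • push e F = push e (Y • F) := by
  funext p
  simp only [push, Matrix.Module.smul_apply]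
  have h₁ : ∀ q, X p q • (∑ i, if q = e i then F i else 0) =
      ∑ i, if q = e i then X p q • F i else 0 := by
    intro q
    rw [Finset.smul_sum]
    exact Finset.sum_congr rfl fun i _ => by split_ifs <;> simp
  simp only [h₁]
  rw [Finset.sum_comm]
  have h₂ : ∀ i, (∑ q, if q = e i then X p q • F i else 0) = X p (e i) • F i := by simp
  have h₃ : ∀ i, (if p = e i then ∑ j, Y i j • F j else 0) =
      ∑ j, (if p = e i then Y i j else 0) • F j := by
    intro i; split_ifs <;> simp
  simp only [h₂, h₃]
  rw [Finset.sum_comm]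
  refine Finset.sum_congr rfl fun j _ => ?_
  rw [← Finset.sum_smul, ← mul_incl_apply X e, h, Matrix.mul_apply]
  simp [incl]

theorem push_single {e : ι → κ} (i : ι) (v : V) :
    push e (Pi.single i v) = Pi.single (e i) v := by
  funext p
  rw [push, Finset.sum_eq_single i]
  · simp [Pi.single_apply]
  · intro b _ hb; simp [hb]
  · simp

end Inclusion

/-! ### Entries of the operators of the trace formula -/

noncomputable section Entries

theorem normR_apply (ħ : ℂ) (n k p : ℕ) (x : ℂ) (i a j b : Fin n) :
    normR ħ n k p x (i, a) (j, b) =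
      if (k ≤ (i : ℕ) ∧ p ≤ (a : ℕ)) ∧ (k ≤ (j : ℕ) ∧ p ≤ (b : ℕ)) then
        (x - ħ)⁻¹ * (x * (if i = j ∧ a = b then 1 else 0) - ħ * if i = b ∧ a = j then 1 else 0)
      else 0 := by
  have h : proj n k ⊗ₖ proj n p = Matrix.diagonal fun s : Fin n × Fin n =>
      if k ≤ (s.1 : ℕ) ∧ p ≤ (s.2 : ℕ) then (1 : ℂ) else 0 := by
    rw [proj, proj, Matrix.diagonal_kronecker_diagonal]
    congr 1
    funext s
    by_cases h₁ : k ≤ (s.1 : ℕ) <;> by_cases h₂ : p ≤ (s.2 : ℕ) <;> simp [h₁, h₂]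
  rw [normR, h, Matrix.smul_apply, Matrix.mul_diagonal, Matrix.diagonal_mul, rMatrix,
    Matrix.sub_apply, Matrix.smul_apply, Matrix.smul_apply, permP_apply, Matrix.one_apply]
  simp only [Prod.mk.injEq, smul_eq_mul]
  by_cases h₁ : k ≤ (i : ℕ) ∧ p ≤ (a : ℕ) <;> by_cases h₂ : k ≤ (j : ℕ) ∧ p ≤ (b : ℕ) <;>
    simp [h₁, h₂]

theorem normR_succ (ħ : ℂ) (n k p : ℕ) (x : ℂ) (i a j b : Fin n) :
    normR ħ (n + 1) (k + 1) (p + 1) x (i.succ, a.succ) (j.succ, b.succ) =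
      normR ħ n k p x (i, a) (j, b) := by
  simp only [normR_apply, Fin.val_succ, Nat.add_le_add_iff_right, Fin.succ_inj]

theorem normR_zero_left (ħ : ℂ) (n k p : ℕ) (x : ℂ) (i a : Fin (n + 1)) (s : Fin (n + 1) × Fin (n + 1))
    (h : i = 0 ∨ a = 0) : normR ħ (n + 1) (k + 1) (p + 1) x (i, a) s = 0 := by
  obtain ⟨j, b⟩ := s
  rw [normR_apply, if_neg]
  rintro ⟨⟨h₁, h₂⟩, -⟩
  rcases h with rfl | rfl
  · simp at h₁
  · simp at h₂

variable {A : Type*} [Ring A] [Algebra ℂ A]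

theorem hatD_zero (ħ : ℂ) {n : ℕ} (D : ℂ → Matrix (Fin n) (Fin n) A) (u : ℂ) :
    hatD ħ D 0 u = D u := by
  ext i j
  simp [hatD]

/-- Compatibility of the closed formula for D̂^{(k+2)} with iteration of τ: the d_{11} contributions
of τ(D), one from the entry and k from the sum, add up to the single summand of the closed formula.
-/
theorem hatD_succ (ħ : ℂ) {n : ℕ} (D : ℂ → Matrix (Fin (n + 1)) (Fin (n + 1)) A) {k : ℕ} {u : ℂ}
    (hu : u ≠ 0) (hk : 2 * u + k * ħ ≠ 0) (hkn : k ≤ n) (i j : Fin n) :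
    hatD ħ D (k + 1) u i.succ j.succ = hatD ħ (tau ħ D) k u i j := by
  simp only [hatD, Fin.val_succ, Nat.add_le_add_iff_right, Fin.succ_inj, Fin.sum_univ_succ,
    Nat.add_lt_add_iff_right, Fin.val_zero, Nat.zero_lt_succ, if_true, tau_apply]
  have hx : u + ((k + 1 : ℕ) : ℂ) * ħ / 2 = u + k * ħ / 2 + ħ / 2 := by push_cast; ring
  rw [hx]
  split_ifs with h₁ h₂
  · have hcard : ∑ q : Fin n, (if (q : ℕ) < k then (1 : ℂ) else 0) = k := by
      rw [Fin.sum_univ_eq_sum_range (fun q => if q < k then (1 : ℂ) else 0) n, ← Finset.sum_filter]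
      have : (Finset.range n).filter (· < k) = Finset.range k := by
        ext q; simp only [Finset.mem_filter, Finset.mem_range]; omega
      rw [this]; simp
    generalize D (u + k * ħ / 2 + ħ / 2) 0 0 = b
    have hsum : ∑ q : Fin n, (if (q : ℕ) < k then (ħ / (2 * u)) •
          (D (u + k * ħ / 2 + ħ / 2) q.succ q.succ + (ħ / (2 * (u + k * ħ / 2))) • b) else 0) =
        (∑ q : Fin n, if (q : ℕ) < k then
          (ħ / (2 * u)) • D (u + k * ħ / 2 + ħ / 2) q.succ q.succ else 0) +
        (k * (ħ / (2 * u)) * (ħ / (2 * (u + k * ħ / 2)))) • b := by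
      rw [← hcard]
      simp only [Finset.sum_mul]
      rw [Finset.sum_smul, ← Finset.sum_add_distrib]
      refine Finset.sum_congr rfl fun q _ => ?_
      split_ifs
      · rw [smul_add, smul_smul, one_mul]
      · simp
    rw [hsum]
    -- Equivalent to ħ/(2u) = ħ/(2u+kħ) · (1 + kħ/(2u)), the balance of the coefficients of d_{11}.
    have hc : ħ / (2 * u) = ħ / (2 * (u + k * ħ / 2)) +
        k * (ħ / (2 * u)) * (ħ / (2 * (u + k * ħ / 2))) := by
      rw [show 2 * (u + k * ħ / 2) = 2 * u + ħ * k by ring]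
      rw [mul_comm (k : ℂ)] at hk
      field_simp
    have : (ħ / (2 * u)) • b = (ħ / (2 * (u + k * ħ / 2))) • b +
        (k * (ħ / (2 * u)) * (ħ / (2 * (u + k * ħ / 2)))) • b := by
      rw [← add_smul, ← hc]
    rw [this]
    abel
  · simp
  · rfl

/-- The factors live in different spaces, so no summation over intermediate labels is left. The
entries are multiplied in the order of the list, since they need not commute. -/
theorem prod_onSite_apply {S J : Type*} [DecidableEq S] [Fintype S] {n : ℕ} {σ : J → S}
    (hσ : Function.Injective σ) (X : J → Matrix (Fin n) (Fin n) A) {l : List J} (hl : l.Nodup)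
    (p q : S → Fin n) :
    (l.map fun j => onSite (σ j) (X j)).prod p q =
      open Classical in
      if ∀ x, (∀ j ∈ l, x ≠ σ j) → p x = q x then
        (l.map fun j => X j (p (σ j)) (q (σ j))).prod else 0 := by
  classical
  induction l generalizing p with
  | nil => simp [Matrix.one_apply, funext_iff]
  | cons j l ih =>
    rw [List.nodup_cons] at hl
    rw [List.map_cons, List.prod_cons, Matrix.mul_apply]
    have : ∀ r, onSite (σ j) (X j) p r * (l.map fun j => onSite (σ j) (X j)).prod r q =
        if ∀ x, x ≠ σ j → p x = r x then X j (p (σ j)) (r (σ j)) *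
          (l.map fun j => onSite (σ j) (X j)).prod r q else 0 := by
      intro r
      simp only [onSite]
      split_ifs <;> simp
    simp only [this]
    rw [sum_agree_off]
    simp only [Function.update_self, ih hl.2]
    have hne : ∀ j' ∈ l, σ j' ≠ σ j := fun j' hj' h => hl.1 (hσ h ▸ hj')
    rw [Finset.sum_eq_single (q (σ j))]
    · by_cases h : ∀ x, (∀ j' ∈ j :: l, x ≠ σ j') → p x = q x
      · rw [if_pos h, if_pos, List.map_cons, List.prod_cons]
        · congr 2
          refine List.map_congr_left fun j' hj' => ?_
          rw [Function.update_of_ne (hne j' hj')]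
        · intro x hx
          by_cases hxj : x = σ j
          · subst hxj; simp
          · rw [Function.update_of_ne hxj]
            exact h x (by simpa [hxj] using hx)
      · rw [if_neg h, if_neg, mul_zero]
        intro h'
        refine h fun x hx => ?_
        simp only [List.mem_cons, forall_eq_or_imp] at hx
        rw [← h' x hx.2, Function.update_of_ne hx.1]
    · intro a _ ha
      rw [if_neg, mul_zero]
      intro h
      have := h (σ j) fun j' hj' => (hne j' hj').symm
      simp only [Function.update_self] at this
      exact ha this
    · simp

/-- The configuration of row indices picked by the trace. -/
def braCfg {r : ℕ} (M : Fin r → ℕ) : ((k : Fin r) × Fin (M k)) → Fin (r + 1) := fun s => s.1.castSucc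

/-- The configuration of column indices picked by the trace. -/
def ketCfg {r : ℕ} (M : Fin r → ℕ) : ((k : Fin r) × Fin (M k)) → Fin (r + 1) := fun s => s.1.succ

theorem lowering_apply {r : ℕ} (M : Fin r → ℕ) (p q : ((k : Fin r) × Fin (M k)) → Fin (r + 1)) :
    lowering M A p q = if p = ketCfg M ∧ q = braCfg M then 1 else 0 := by
  have h : ∏ s : (k : Fin r) × Fin (M k),
      Matrix.single s.1.succ s.1.castSucc (1 : ℂ) (p s) (q s) =
      if p = ketCfg M ∧ q = braCfg M then 1 else 0 := by
    simp only [Matrix.single_apply, Finset.prod_ite_zero, Finset.mem_univ, true_implies,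
      Finset.prod_const_one]
    congr 1
    simp only [eq_iff_iff, funext_iff, ketCfg, braCfg, forall_and]
    exact ⟨fun h => ⟨fun s => (h.1 s).symm, fun s => (h.2 s).symm⟩,
      fun h => ⟨fun s => (h.1 s).symm, fun s => (h.2 s).symm⟩⟩
  rw [lowering, h]
  split_ifs <;> simp

theorem trace_mul_lowering {r : ℕ} (M : Fin r → ℕ) (X : AuxOp A M) :
    Matrix.trace (X * lowering M A) = X (braCfg M) (ketCfg M) := by
  simp only [Matrix.trace, Matrix.diag_apply, Matrix.mul_apply, lowering_apply, ite_and, mul_ite,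
    mul_one, mul_zero]
  rw [Finset.sum_comm]
  simp

/-- In each space of level i, tr(X E_{i+1,i}) is the entry X_{i,i+1}; the trace formula is thus one
matrix entry of the product of the dressed levels. -/
theorem betheTrace_eq (ħ : ℂ) {r : ℕ} (D : ℂ → Matrix (Fin (r + 1)) (Fin (r + 1)) A)
    (M : Fin r → ℕ) (π : (k : Fin r) → Equiv.Perm (Fin (M k)))
    (u : (k : Fin r) → Fin (M k) → ℂ) :
    betheTrace ħ D M π u =
      (List.ofFn fun k : Fin r => dressedD ħ D M π u k).prod (braCfg M) (ketCfg M) :=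
  trace_mul_lowering M _

end Entries


/-! ### Splitting off the first level -/

noncomputable section FirstLevel

variable {r : ℕ} {A V : Type*} [Ring A] [Algebra ℂ A] [AddCommGroup V] [Module ℂ V] [Module A V]
  [IsScalarTower ℂ A V] (M : Fin (r + 1) → ℕ)

/-- The basis labels of the spaces of the levels `≥ 2`. -/
abbrev UpperCfg {r : ℕ} (M : Fin (r + 1) → ℕ) : Type := ((k : Fin r) × Fin (M k.succ)) → Fin (r + 1)

/-- The basis labels of the spaces of the first level. -/
abbrev LowerCfg {r : ℕ} (M : Fin (r + 1) → ℕ) : Type := Fin (M 0) → Fin (r + 1)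

/-- The labels of `ℂ^{𝔫-1}` as labels of the subspace of `ℂ^𝔫` spanned by `e_2, …, e_𝔫`. -/
def embCfg (i : UpperCfg M × LowerCfg M) : ((k : Fin (r + 1)) × Fin (M k)) → Fin (r + 2) := fun s =>
  Fin.cases (motive := fun k => Fin (M k) → Fin (r + 2)) (fun j => (i.2 j).succ)
    (fun k j => (i.1 ⟨k, j⟩).succ) s.1 s.2

@[simp] theorem embCfg_zero (i : UpperCfg M × LowerCfg M) (j : Fin (M 0)) :
    embCfg M i ⟨0, j⟩ = (i.2 j).succ := rfl

@[simp] theorem embCfg_succ (i : UpperCfg M × LowerCfg M) (k : Fin r) (j : Fin (M k.succ)) :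
    embCfg M i ⟨k.succ, j⟩ = (i.1 ⟨k, j⟩).succ := rfl

theorem forall_site {M : Fin (r + 1) → ℕ} {P : ((k : Fin (r + 1)) × Fin (M k)) → Prop} :
    (∀ s, P s) ↔ (∀ j, P ⟨0, j⟩) ∧ ∀ s : (k : Fin r) × Fin (M k.succ), P ⟨s.1.succ, s.2⟩ := by
  constructor
  · exact fun h => ⟨fun j => h _, fun s => h _⟩
  · rintro ⟨h, h'⟩ ⟨k, j⟩
    refine Fin.cases (motive := fun k => ∀ j, P ⟨k, j⟩) h (fun k j => h' ⟨k, j⟩) k j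

theorem embCfg_injective : Function.Injective (embCfg M) := by
  rintro ⟨g, f⟩ ⟨g', f'⟩ h
  have h1 : f = f' := funext fun j => Fin.succ_injective _ (congrFun h ⟨0, j⟩)
  have h2 : g = g' := funext fun s => Fin.succ_injective _ (congrFun h ⟨s.1.succ, s.2⟩)
  rw [h1, h2]

theorem exists_eq_zero_of_forall_ne {p : ((k : Fin (r + 1)) × Fin (M k)) → Fin (r + 2)}
    (h : ∀ i, p ≠ embCfg M i) : ∃ s, p s = 0 := by
  by_contra h0
  push Not at h0
  refine h (fun s => (p ⟨s.1.succ, s.2⟩).pred (h0 _), fun j => (p ⟨0, j⟩).pred (h0 _)) ?_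
  funext s
  revert s
  rw [forall_site]
  constructor
  · intro j; simp
  · intro s; simp

theorem succ_site_ne_iff {k k' : Fin r} {j : Fin (M k.succ)} {j' : Fin (M k'.succ)} :
    ((⟨k.succ, j⟩ : (k : Fin (r + 1)) × Fin (M k)) ≠ ⟨k'.succ, j'⟩) ↔
      (⟨k, j⟩ : (k : Fin r) × Fin (M k.succ)) ≠ ⟨k', j'⟩ := by
  rw [not_iff_not]
  constructor
  · intro h
    obtain ⟨h1, h2⟩ := Sigma.mk.inj h
    obtain rfl := Fin.succ_injective _ h1
    rw [eq_of_heq h2]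
  · intro h
    obtain ⟨h1, h2⟩ := Sigma.mk.inj h
    subst h1
    rw [eq_of_heq h2]

theorem zero_site_ne_succ (k : Fin r) (j : Fin (M k.succ)) (c : Fin (M 0)) :
    (⟨0, c⟩ : (k : Fin (r + 1)) × Fin (M k)) ≠ ⟨k.succ, j⟩ := by
  intro h
  exact absurd (Sigma.mk.inj h).1 (Fin.succ_ne_zero k).symm

theorem zero_site_inj {c c' : Fin (M 0)} :
    ((⟨0, c⟩ : (k : Fin (r + 1)) × Fin (M k)) ≠ ⟨0, c'⟩) ↔ c ≠ c' := by
  rw [not_iff_not]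
  exact ⟨fun h => eq_of_heq (Sigma.mk.inj h).2, fun h => by rw [h]⟩

/-- Operators on the spaces of the levels `≥ 2` with coefficients in the operators on the spaces
of the first level, as operators on all spaces. -/
abbrev flatOp (Y : Matrix (UpperCfg M) (UpperCfg M) (Matrix (LowerCfg M) (LowerCfg M) A)) :
    Matrix (UpperCfg M × LowerCfg M) (UpperCfg M × LowerCfg M) A :=
  Matrix.compRingEquiv (UpperCfg M) (LowerCfg M) A Y

theorem flatOp_apply (Y : Matrix (UpperCfg M) (UpperCfg M) (Matrix (LowerCfg M) (LowerCfg M) A))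
    (i i' : UpperCfg M × LowerCfg M) : flatOp M Y i i' = Y i.1 i'.1 i.2 i'.2 := rfl

/-- The matrix of the inclusion given by `embCfg`. -/
abbrev embMat (A : Type*) [Ring A] : Matrix (((k : Fin (r + 1)) × Fin (M k)) → Fin (r + 2))
    (UpperCfg M × LowerCfg M) A := incl A (embCfg M)

/-- If the label 0 stands in one of the two active spaces, the projectors kill the entry; elsewhere
the row and column labels must agree, but the column has no label 0. -/
theorem onSites_eq_zero_of_zero (k b : ℕ) {s t : (k : Fin (r + 1)) × Fin (M k)} (ħ x : ℂ)
    {p : ((k : Fin (r + 1)) × Fin (M k)) → Fin (r + 2)} {s₀ : (k : Fin (r + 1)) × Fin (M k)}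
    (h : p s₀ = 0) {q : ((k : Fin (r + 1)) × Fin (M k)) → Fin (r + 2)} (hq : ∀ s, q s ≠ 0) :
    onSites A s t (normR ħ (r + 2) (k + 1) (b + 1) x) p q = 0 := by
  rw [onSites]
  split_ifs with hp
  · have : p s = 0 ∨ p t = 0 := by
      by_contra h'
      push Not at h'
      refine hq s₀ ?_
      rw [← hp s₀ (fun h1 => h'.1 (h1 ▸ h)) (fun h1 => h'.2 (h1 ▸ h)), h]
    rw [normR_zero_left _ _ _ _ _ _ _ _ this, map_zero]
  · rfl

theorem embCfg_ne_zero (i : UpperCfg M × LowerCfg M) (s) : embCfg M i s ≠ 0 := by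
  revert s
  rw [forall_site]
  exact ⟨fun _ => Fin.succ_ne_zero _, fun _ => Fin.succ_ne_zero _⟩

theorem onSites_succ_succ (ħ x : ℂ) (k b : Fin r) (j : Fin (M k.succ)) (c : Fin (M b.succ)) :
    onSites A (⟨k.succ, j⟩ : (k : Fin (r + 1)) × Fin (M k)) ⟨b.succ, c⟩
        (normR ħ (r + 2) (k.succ : Fin (r + 1)) ((b.succ : Fin (r + 1)) + 1) x) * embMat M A =
      embMat M A * flatOp M (onSites (Matrix (LowerCfg M) (LowerCfg M) A)
        (⟨k, j⟩ : (k : Fin r) × Fin (M k.succ)) ⟨b, c⟩ (normR ħ (r + 1) k (b + 1) x)) := by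
  refine incl_intertwine (embCfg_injective M) (fun i i' => ?_) fun p hp i' => ?_
  · rw [flatOp_apply, onSites, onSites]
    have : (∀ s, s ≠ (⟨k.succ, j⟩ : (k : Fin (r + 1)) × Fin (M k)) → s ≠ ⟨b.succ, c⟩ →
        embCfg M i s = embCfg M i' s) ↔ i.2 = i'.2 ∧
        ∀ s, s ≠ (⟨k, j⟩ : (k : Fin r) × Fin (M k.succ)) → s ≠ ⟨b, c⟩ → i.1 s = i'.1 s := by
      rw [forall_site]
      refine and_congr ?_ (forall_congr' fun s => ?_)
      · simp only [ne_eq, zero_site_ne_succ, not_false_eq_true, true_implies, embCfg_zero,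
          Fin.succ_inj, funext_iff]
      · rw [succ_site_ne_iff, succ_site_ne_iff, embCfg_succ, embCfg_succ, Fin.succ_inj]
    simp only [embCfg_succ, Fin.val_succ, normR_succ]
    by_cases h : i.2 = i'.2
    · by_cases h' : ∀ s, s ≠ (⟨k, j⟩ : (k : Fin r) × Fin (M k.succ)) → s ≠ ⟨b, c⟩ → i.1 s = i'.1 s
      · rw [if_pos (this.2 ⟨h, h'⟩), if_pos h', Matrix.algebraMap_matrix_apply, if_pos h]
      · rw [if_neg fun h1 => h' (this.1 h1).2, if_neg h']; rfl
    · rw [if_neg fun h1 => h (this.1 h1).1]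
      split_ifs
      · rw [Matrix.algebraMap_matrix_apply, if_neg h]
      · rfl
  · obtain ⟨s, hs⟩ := exists_eq_zero_of_forall_ne M hp
    exact onSites_eq_zero_of_zero M _ _ _ _ hs (embCfg_ne_zero M i')

/-- For level 2 both projectors are 𝕀^{(2)}, so on the span of e_2, …, e_𝔫 the reduced matrix is the
full normalized R-matrix of rank 𝔫-1, as it occurs in D'. -/
theorem onSites_succ_zero (ħ x : ℂ) (k : Fin r) (hk : (k : ℕ) = 0) (j : Fin (M k.succ))
    (c : Fin (M 0)) :
    onSites A (⟨k.succ, j⟩ : (k : Fin (r + 1)) × Fin (M k)) ⟨0, c⟩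
        (normR ħ (r + 2) (k.succ : Fin (r + 1)) ((0 : Fin (r + 1)) + 1) x) * embMat M A =
      embMat M A * flatOp M (onSite (⟨k, j⟩ : (k : Fin r) × Fin (M k.succ)) (fundR ħ A c x)) := by
  refine incl_intertwine (embCfg_injective M) (fun i i' => ?_) fun p hp i' => ?_
  · rw [flatOp_apply, onSites, onSite]
    have : (∀ s, s ≠ (⟨k.succ, j⟩ : (k : Fin (r + 1)) × Fin (M k)) → s ≠ ⟨0, c⟩ →
        embCfg M i s = embCfg M i' s) ↔ (∀ c', c' ≠ c → i.2 c' = i'.2 c') ∧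
        ∀ s, s ≠ (⟨k, j⟩ : (k : Fin r) × Fin (M k.succ)) → i.1 s = i'.1 s := by
      rw [forall_site]
      refine and_congr (forall_congr' fun c' => ?_) (forall_congr' fun s => ?_)
      · rw [zero_site_inj]
        simp only [ne_eq, zero_site_ne_succ, not_false_eq_true, true_implies, embCfg_zero,
          Fin.succ_inj]
      · rw [succ_site_ne_iff, embCfg_succ, embCfg_succ, Fin.succ_inj]
        simp only [ne_eq, (zero_site_ne_succ M _ _ _).symm, not_false_eq_true, true_implies]
    simp only [embCfg_succ, embCfg_zero, Fin.val_succ, Fin.val_zero, normR_succ, hk]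
    by_cases h' : ∀ s, s ≠ (⟨k, j⟩ : (k : Fin r) × Fin (M k.succ)) → i.1 s = i'.1 s
    · rw [if_pos h']
      simp only [fundR, onSite]
      by_cases h : ∀ c', c' ≠ c → i.2 c' = i'.2 c'
      · rw [if_pos (this.2 ⟨h, h'⟩), if_pos h]
      · rw [if_neg fun h1 => h (this.1 h1).1, if_neg h]
    · rw [if_neg fun h1 => h' (this.1 h1).2, if_neg h']; rfl
  · obtain ⟨s, hs⟩ := exists_eq_zero_of_forall_ne M hp
    exact onSites_eq_zero_of_zero M _ _ _ _ hs (embCfg_ne_zero M i')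

theorem onSite_hatD_eq_zero {s : (k : Fin (r + 1)) × Fin (M k)} (ħ x : ℂ) (k : ℕ)
    (D : ℂ → Matrix (Fin (r + 2)) (Fin (r + 2)) A)
    {p : ((k : Fin (r + 1)) × Fin (M k)) → Fin (r + 2)} {s₀ : (k : Fin (r + 1)) × Fin (M k)}
    (h : p s₀ = 0) {q : ((k : Fin (r + 1)) × Fin (M k)) → Fin (r + 2)} (hq : ∀ s, q s ≠ 0) :
    onSite s (hatD ħ D (k + 1) x) p q = 0 := by
  rw [onSite]
  split_ifs with hp
  · have : p s = 0 := by
      by_contra h'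
      refine hq s₀ ?_
      rw [← hp s₀ (fun h1 => h' (h1 ▸ h)), h]
    rw [hatD, this, if_neg]
    simp
  · rfl

theorem onSite_hatD_one (ħ x : ℂ) (D : ℂ → Matrix (Fin (r + 2)) (Fin (r + 2)) A) (k : Fin r)
    (hk : (k : ℕ) = 0) (j : Fin (M k.succ)) :
    onSite (⟨k.succ, j⟩ : (k : Fin (r + 1)) × Fin (M k))
        (hatD ħ D (k.succ : Fin (r + 1)) x) * embMat M A =
      embMat M A * flatOp M (onSite (⟨k, j⟩ : (k : Fin r) × Fin (M k.succ))
        ((tau ħ D x).map fun d => Matrix.diagonal fun _ => d)) := by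
  refine incl_intertwine (embCfg_injective M) (fun i i' => ?_) fun p hp i' => ?_
  · rw [flatOp_apply, onSite, onSite]
    have : (∀ s, s ≠ (⟨k.succ, j⟩ : (k : Fin (r + 1)) × Fin (M k)) →
        embCfg M i s = embCfg M i' s) ↔ i.2 = i'.2 ∧
        ∀ s, s ≠ (⟨k, j⟩ : (k : Fin r) × Fin (M k.succ)) → i.1 s = i'.1 s := by
      rw [forall_site]
      refine and_congr ?_ (forall_congr' fun s => ?_)
      · simp only [ne_eq, zero_site_ne_succ, not_false_eq_true, true_implies, embCfg_zero,
          Fin.succ_inj, funext_iff]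
      · rw [succ_site_ne_iff, embCfg_succ, embCfg_succ, Fin.succ_inj]
    simp only [embCfg_succ, Fin.val_succ, hk]
    by_cases h' : ∀ s, s ≠ (⟨k, j⟩ : (k : Fin r) × Fin (M k.succ)) → i.1 s = i'.1 s
    · rw [if_pos h', Matrix.map_apply, Matrix.diagonal_apply]
      by_cases h : i.2 = i'.2
      · rw [if_pos (this.2 ⟨h, h'⟩), if_pos h]; rfl
      · rw [if_neg fun h1 => h (this.1 h1).1, if_neg h]
    · rw [if_neg fun h1 => h' (this.1 h1).2, if_neg h']; rfl
  · obtain ⟨s, hs⟩ := exists_eq_zero_of_forall_ne M hp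
    exact onSite_hatD_eq_zero M _ _ _ _ hs (embCfg_ne_zero M i')

/-- Labels with `e_2` in all spaces of the first level. -/
def embTop (g : UpperCfg M) : ((k : Fin (r + 1)) × Fin (M k)) → Fin (r + 2) :=
  embCfg M (g, fun _ => 0)

theorem embTop_injective : Function.Injective (embTop M) := fun _ _ h =>
  congrArg Prod.fst (embCfg_injective M h)

@[simp] theorem embTop_zero (g : UpperCfg M) (j : Fin (M 0)) : embTop M g ⟨0, j⟩ = 1 := rfl

@[simp] theorem embTop_succ (g : UpperCfg M) (k : Fin r) (j : Fin (M k.succ)) :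
    embTop M g ⟨k.succ, j⟩ = (g ⟨k, j⟩).succ := rfl

theorem exists_of_forall_ne_embTop {p : ((k : Fin (r + 1)) × Fin (M k)) → Fin (r + 2)}
    (h : ∀ g, p ≠ embTop M g) : (∃ s : (k : Fin r) × Fin (M k.succ), p ⟨s.1.succ, s.2⟩ = 0) ∨
      ∃ c, p ⟨0, c⟩ ≠ 1 := by
  by_contra h0
  push Not at h0
  refine h (fun s => (p ⟨s.1.succ, s.2⟩).pred (h0.1 _)) ?_
  funext s
  revert s
  rw [forall_site]
  constructor
  · intro j; simp [h0.2]
  · intro s; simp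

/-- The projector with coefficients in an algebra. -/
def projA (A : Type*) [Ring A] [Algebra ℂ A] (n k : ℕ) : Matrix (Fin n) (Fin n) A :=
  Matrix.diagonal fun i => if k ≤ (i : ℕ) then 1 else 0

/-- For levels i ≥ 3 with e_2 in the first-level space, the permutation would bring e_2 into the
space of level i, where 𝕀^{(i)} annihilates it. Only the identity part x/(x-ħ), cut down by the
projector, remains. -/
theorem onSites_top (ħ x : ℂ) (k : Fin r) (hk : 1 ≤ (k : ℕ)) (j : Fin (M k.succ))
    (c : Fin (M 0)) :
    onSites A (⟨k.succ, j⟩ : (k : Fin (r + 1)) × Fin (M k)) ⟨0, c⟩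
        (normR ħ (r + 2) (k.succ : Fin (r + 1)) ((0 : Fin (r + 1)) + 1) x) * incl A (embTop M) =
      incl A (embTop M) * (((x - ħ)⁻¹ * x) •
        onSite (⟨k, j⟩ : (k : Fin r) × Fin (M k.succ)) (projA A (r + 1) k)) := by
  have hval : ∀ (p : ((k : Fin (r + 1)) × Fin (M k)) → Fin (r + 2)) (g : UpperCfg M),
      normR ħ (r + 2) (k.succ : Fin (r + 1)) ((0 : Fin (r + 1)) + 1) x
        (p ⟨k.succ, j⟩, p ⟨0, c⟩) (embTop M g ⟨k.succ, j⟩, embTop M g ⟨0, c⟩) =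
      if p ⟨k.succ, j⟩ = (g ⟨k, j⟩).succ ∧ p ⟨0, c⟩ = 1 ∧ (k : ℕ) ≤ g ⟨k, j⟩ then
        (x - ħ)⁻¹ * x else 0 := by
    intro p g
    rw [normR_apply, embTop_succ, embTop_zero]
    by_cases h₁ : p ⟨k.succ, j⟩ = (g ⟨k, j⟩).succ ∧ p ⟨0, c⟩ = 1
    · rw [h₁.1, h₁.2]
      by_cases h₂ : (k : ℕ) ≤ g ⟨k, j⟩
      · have h₃ : (g ⟨k, j⟩).succ ≠ 1 := by
          intro h
          have := congrArg Fin.val h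
          simp only [Fin.val_succ, Fin.val_one] at this
          omega
        simp [h₂, h₃]
      · simp [h₂]
    · rw [if_neg (c := p ⟨k.succ, j⟩ = _ ∧ _ ∧ _) fun h => h₁ ⟨h.1, h.2.1⟩]
      split_ifs with h₂ h₃
      · exfalso
        have := h₂.1.1
        rw [h₃.1] at this
        simp only [Fin.val_succ, Fin.val_one] at this
        omega
      · simp
      · rfl
  refine incl_intertwine (embTop_injective M) (fun g g' => ?_) fun p hp g' => ?_
  · rw [onSites, hval, Matrix.smul_apply, onSite]
    have : (∀ s, s ≠ (⟨k.succ, j⟩ : (k : Fin (r + 1)) × Fin (M k)) → s ≠ ⟨0, c⟩ →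
        embTop M g s = embTop M g' s) ↔
        ∀ s, s ≠ (⟨k, j⟩ : (k : Fin r) × Fin (M k.succ)) → g s = g' s := by
      rw [forall_site]
      constructor
      · intro h s hs
        have := h.2 s ((succ_site_ne_iff M).2 hs) (zero_site_ne_succ M _ _ _).symm
        simpa using this
      · intro h
        refine ⟨fun j _ _ => rfl, fun s hs _ => ?_⟩
        rw [embTop_succ, embTop_succ, h s ((succ_site_ne_iff M).1 hs)]
    simp only [this]
    split_ifs with h₁ h₂
    · rw [embTop_succ, Fin.succ_inj] at h₂
      rw [projA, Matrix.diagonal_apply, if_pos h₂.1, h₂.1, if_pos h₂.2.2,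
        Algebra.algebraMap_eq_smul_one]
    · rw [projA, Matrix.diagonal_apply]
      split_ifs with h₃ h₄
      · exact absurd ⟨by rw [embTop_succ, h₃], rfl, h₃ ▸ h₄⟩ h₂
      · simp
      · simp
    · simp
  · rw [onSites, hval]
    split_ifs with h₁ h₂
    · exfalso
      rcases exists_of_forall_ne_embTop M hp with ⟨s, hs⟩ | ⟨c', hc'⟩
      · by_cases hsk : s = ⟨k, j⟩
        · subst hsk
          rw [h₂.1] at hs
          exact Fin.succ_ne_zero _ hs
        · have := h₁ _ ((succ_site_ne_iff M).2 hsk) (zero_site_ne_succ M _ _ _).symm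
          rw [hs, embTop_succ] at this
          exact Fin.succ_ne_zero _ this.symm
      · by_cases hcc : c' = c
        · subst hcc; exact hc' h₂.2.1
        · exact hc' (h₁ _ (zero_site_ne_succ M _ _ _) ((zero_site_inj M).2 hcc))
    · simp
    · rfl

theorem onSite_hatD_top (ħ x : ℂ) (D : ℂ → Matrix (Fin (r + 2)) (Fin (r + 2)) A) (k : Fin r)
    (j : Fin (M k.succ)) :
    onSite (⟨k.succ, j⟩ : (k : Fin (r + 1)) × Fin (M k))
        (hatD ħ D (k.succ : Fin (r + 1)) x) * incl A (embTop M) =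
      incl A (embTop M) * onSite (⟨k, j⟩ : (k : Fin r) × Fin (M k.succ))
        ((hatD ħ D (k + 1) x).submatrix Fin.succ Fin.succ) := by
  refine incl_intertwine (embTop_injective M) (fun g g' => ?_) fun p hp g' => ?_
  · rw [onSite, onSite]
    have : (∀ s, s ≠ (⟨k.succ, j⟩ : (k : Fin (r + 1)) × Fin (M k)) →
        embTop M g s = embTop M g' s) ↔
        ∀ s, s ≠ (⟨k, j⟩ : (k : Fin r) × Fin (M k.succ)) → g s = g' s := by
      rw [forall_site]
      constructor
      · intro h s hs
        simpa using h.2 s ((succ_site_ne_iff M).2 hs)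
      · intro h
        refine ⟨fun j _ => rfl, fun s hs => ?_⟩
        rw [embTop_succ, embTop_succ, h s ((succ_site_ne_iff M).1 hs)]
    simp only [this, embTop_succ, Fin.val_succ, Matrix.submatrix_apply]
  · rw [onSite]
    split_ifs with h₁
    · rcases exists_of_forall_ne_embTop M hp with ⟨s, hs⟩ | ⟨c', hc'⟩
      · by_cases hsk : s = ⟨k, j⟩
        · subst hsk
          rw [hatD, hs, if_neg]
          simp
        · have := h₁ _ ((succ_site_ne_iff M).2 hsk)
          rw [hs, embTop_succ] at this
          exact absurd this.symm (Fin.succ_ne_zero _)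
      · exact absurd (h₁ _ (zero_site_ne_succ M _ _ _)) hc'
    · rfl

end FirstLevel


/-! ### The recursion step -/

noncomputable section RecursionStep

section Lists

theorem filter_lt_succ {r : ℕ} (k : Fin r) :
    (List.finRange (r + 1)).filter (· < k.succ) =
      0 :: ((List.finRange r).filter (· < k)).map Fin.succ := by
  rw [List.finRange_succ, List.filter_cons_of_pos (by simp), List.filter_map]
  congr 3
  funext b
  simp [Function.comp]

theorem prod_map_smul_absorb {β R : Type*} [Ring R] [Algebra ℂ R] (l : List β) (s : β → ℂ)
    {P Z : R} (h : P * Z = Z) : (l.map fun b => s b • P).prod * Z = (l.map s).prod • Z := by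
  induction l with
  | nil => simp
  | cons b l ih =>
    rw [List.map_cons, List.map_cons, List.prod_cons, List.prod_cons, mul_assoc, ih,
      smul_mul_smul_comm, h]

theorem absorb_prod_map_smul {β R : Type*} [Ring R] [Algebra ℂ R] (l : List β) (s : β → ℂ)
    {P Z : R} (h : Z * P = Z) : Z * (l.map fun b => s b • P).prod = (l.map s).prod • Z := by
  induction l with
  | nil => simp
  | cons b l ih =>
    rw [List.map_cons, List.map_cons, List.prod_cons, List.prod_cons, ← mul_assoc,
      mul_smul_comm, h, smul_mul_assoc, ih, smul_smul]

theorem smul_list_prod_of_forall {β R R' E E' : Type*} [Ring R] [Ring R'] [AddCommGroup E]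
    [AddCommGroup E'] [Module R E] [Module R' E'] (J : E' → E) (P : Set E') (X : β → R)
    (Y : β → R') (l : List β)
    (h : ∀ b ∈ l, ∀ F ∈ P, X b • J F = J (Y b • F) ∧ Y b • F ∈ P) :
    ∀ F ∈ P, (l.map X).prod • J F = J ((l.map Y).prod • F) ∧ (l.map Y).prod • F ∈ P := by
  induction l with
  | nil => intro F hF; simpa using hF
  | cons b l ih =>
    intro F hF
    obtain ⟨h₁, h₂⟩ := ih (fun b hb => h b (List.mem_cons_of_mem _ hb)) F hF
    obtain ⟨h₃, h₄⟩ := h b List.mem_cons_self _ h₂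
    simp only [List.map_cons, List.prod_cons, mul_smul]
    exact ⟨by rw [h₁, h₃], h₄⟩

end Lists

variable {r : ℕ} {A V : Type*} [Ring A] [Algebra ℂ A] [AddCommGroup V] [Module ℂ V] [Module A V]
  [IsScalarTower ℂ A V] (M : Fin (r + 1) → ℕ)

/-- Vectors in the spaces of all levels from vectors in `e_2, …, e_𝔫` components. -/
def embVec (F : UpperCfg M → LowerCfg M → V) : (((k : Fin (r + 1)) × Fin (M k)) → Fin (r + 2)) → V :=
  push (embCfg M) fun i => F i.1 i.2

theorem smul_embVec {X : Matrix (((k : Fin (r + 1)) × Fin (M k)) → Fin (r + 2))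
      (((k : Fin (r + 1)) × Fin (M k)) → Fin (r + 2)) A}
    {Y : Matrix (UpperCfg M) (UpperCfg M) (Matrix (LowerCfg M) (LowerCfg M) A)}
    (h : X * embMat M A = embMat M A * flatOp M Y) (F : UpperCfg M → LowerCfg M → V) :
    X • embVec M F = embVec M (Y • F) := by
  rw [embVec, smul_push h]
  congr 1
  funext i
  simp only [Matrix.Module.smul_apply, Fintype.sum_prod_type, flatOp_apply, Finset.sum_apply]

theorem embVec_highestTensor (H : UpperCfg M → V) :
    embVec M (fun g => highestTensor (M 0) r (H g)) = push (embTop M) H := by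
  funext p
  simp only [embVec, push, highestTensor_apply, Fintype.sum_prod_type]
  refine Finset.sum_congr rfl fun g _ => ?_
  rw [Finset.sum_eq_single (fun _ => 0)]
  · rw [if_pos rfl]; rfl
  · intro f _ hf; simp [hf]
  · simp

/-- Values in the vectors of the form `e_2^{⊗ M_1} ⊗ w` with `w ∈ W`. -/
def topSub (W : Submodule ℂ V) : Submodule ℂ (UpperCfg M → LowerCfg M → V) :=
  piSub _ (W.map (LinearMap.single ℂ (fun _ : LowerCfg M => V) fun _ => 0))

theorem mem_topSub {W : Submodule ℂ V} {F : UpperCfg M → LowerCfg M → V} :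
    F ∈ topSub M W ↔ ∃ H : UpperCfg M → V, (∀ g, H g ∈ W) ∧
      F = fun g => highestTensor (M 0) r (H g) := by
  rw [topSub, mem_piSub]
  simp only [Submodule.mem_map]
  constructor
  · intro h
    choose H hH using h
    exact ⟨H, fun g => (hH g).1, funext fun g => (hH g).2.symm⟩
  · rintro ⟨H, hH, rfl⟩ g
    exact ⟨H g, hH g, rfl⟩

theorem onSites_smul_mem {S : Type*} [DecidableEq S] [Fintype S] {n : ℕ} (s t : S)
    (Y : Matrix (Fin n × Fin n) (Fin n × Fin n) ℂ) {W : Submodule ℂ V} {F : (S → Fin n) → V}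
    (hF : F ∈ piSub (S → Fin n) W) : onSites A s t Y • F ∈ piSub (S → Fin n) W := by
  rw [mem_piSub] at hF ⊢
  intro p
  rw [Matrix.Module.smul_apply]
  refine W.sum_mem fun q _ => ?_
  rw [onSites]
  split_ifs
  · rw [algebraMap_smul]
    exact W.smul_mem _ (hF q)
  · simp

theorem list_prod_smul_mem {R E : Type*} [Ring R] [AddCommGroup E] [Module ℂ E] [Module R E]
    {P : Submodule ℂ E} (l : List R) (h : ∀ X ∈ l, ∀ F ∈ P, X • F ∈ P) :
    ∀ F ∈ P, l.prod • F ∈ P := by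
  induction l with
  | nil => intro F hF; simpa using hF
  | cons X l ih =>
    intro F hF
    rw [List.prod_cons, mul_smul]
    exact h X List.mem_cons_self _ (ih (fun Y hY => h Y (List.mem_cons_of_mem _ hY)) F hF)

/-- The spectral parameters at which all factors are defined. -/
structure RegPts (ħ : ℂ) (S : Set ℂ) {r : ℕ} (M : Fin r → ℕ) (u : (k : Fin r) → Fin (M k) → ℂ) :
    Prop where
  mem : ∀ k j, u k j + ħ / 2 + (k : ℕ) * ħ / 2 ∈ S
  two_ne : ∀ (k : Fin r) (j : Fin (M k)) (l : ℕ), 1 ≤ l → l ≤ (k : ℕ) → 2 * u k j + l * ħ ≠ 0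
  add_ne : ∀ (k b : Fin r) (j : Fin (M k)) (c : Fin (M b)), b < k →
    u k j + u b c + (((k : ℕ) : ℂ) - ((b : ℕ) : ℂ)) * ħ / 2 ≠ ħ
  sub_ne : ∀ (k b : Fin r) (j : Fin (M k)) (c : Fin (M b)), b < k →
    u k j - u b c + (((k : ℕ) : ℂ) - ((b : ℕ) : ℂ)) * ħ / 2 ≠ ħ

variable {M} {ħ : ℂ} {S : Set ℂ} {u : (k : Fin (r + 1)) → Fin (M k) → ℂ}

/-- Passing to rank 𝔫-1 lowers the level by one. The ħ/2 lost in the level index reappears as the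
shift in τ, and the first-level conditions on u_{ij} ± u_{1c} become the regularity of the dressing.
-/
theorem RegPts.succ (h : RegPts ħ S M u) :
    RegPts ħ (psiSet ħ (u 0) S) (fun k : Fin r => M k.succ) (fun k => u k.succ) where
  mem k j := by
    have hk : ((k.succ : Fin (r + 1)) : ℕ) = k + 1 := rfl
    refine ⟨⟨?_, ?_⟩, fun c => ⟨?_, ?_⟩⟩
    · have := h.mem k.succ j
      rw [hk] at this
      convert this using 1
      push_cast; ring
    · have := h.two_ne k.succ j (k + 1) (by omega) (by omega)
      intro h0
      apply this
      push_cast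
      linear_combination 2 * h0
    · have := h.add_ne k.succ 0 j c (Fin.succ_pos k)
      rw [hk, Fin.val_zero, Nat.cast_zero] at this
      intro h0
      apply this
      push_cast
      linear_combination h0
    · have := h.sub_ne k.succ 0 j c (Fin.succ_pos k)
      rw [hk, Fin.val_zero, Nat.cast_zero] at this
      intro h0
      apply this
      push_cast
      linear_combination h0
  two_ne k j l h₁ h₂ := h.two_ne k.succ j l h₁ (h₂.trans (Nat.le_succ _))
  add_ne k b j c hb := by
    have := h.add_ne k.succ b.succ j c (Fin.succ_lt_succ_iff.2 hb)
    simpa using this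
  sub_ne k b j c hb := by
    have := h.sub_ne k.succ b.succ j c (Fin.succ_lt_succ_iff.2 hb)
    simpa using this

variable (M u) in
/-- The factors of `R̄^{(i)}` that belong to the first level. -/
def rBarTop (ħ : ℂ) (A : Type*) [Ring A] [Algebra ℂ A] (k : Fin r) (j : Fin (M k.succ)) : AuxOp A M :=
  (List.ofFn fun c : Fin (M 0) =>
    onSites A (⟨k.succ, j⟩ : (k : Fin (r + 1)) × Fin (M k)) ⟨0, c⟩
      (normR ħ (r + 2) (k.succ : Fin (r + 1)) ((0 : Fin (r + 1)) + 1)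
        (u k.succ j + ħ / 2 + (k : ℕ) * ħ / 2 + u 0 c))).prod

variable (M u) in
/-- The factors of `R^{(i)}` that belong to the first level. -/
def rProdTop (ħ : ℂ) (A : Type*) [Ring A] [Algebra ℂ A] (k : Fin r) (j : Fin (M k.succ)) : AuxOp A M :=
  ((List.ofFn fun c : Fin (M 0) =>
    onSites A (⟨k.succ, j⟩ : (k : Fin (r + 1)) × Fin (M k)) ⟨0, c⟩
      (normR ħ (r + 2) (k.succ : Fin (r + 1)) ((0 : Fin (r + 1)) + 1)
        (u k.succ j + ħ / 2 + (k : ℕ) * ħ / 2 - u 0 c))).reverse).prod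

variable (M u) in
-- The product runs over decreasing b, so the first-level factors stand at its right end, next to
-- D̂; all others are the factors of the formula of rank 𝔫-1.
theorem exists_rBar_split (k : Fin r) (j : Fin (M k.succ)) :
    ∃ X : AuxOp A M, rBar ħ M (fun _ => 1) u k.succ j = X * rBarTop M u ħ A k j ∧
      X * embMat M A = embMat M A * flatOp M (rBar ħ (A := Matrix (LowerCfg M) (LowerCfg M) A)
        (fun k : Fin r => M k.succ) (fun _ => 1) (fun k => u k.succ) k j) := by
  refine ⟨((((List.finRange r).filter (· < k)).reverse).map fun b : Fin r =>
    (List.ofFn fun c : Fin (M b.succ) =>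
      onSites A (⟨k.succ, j⟩ : (k : Fin (r + 1)) × Fin (M k)) ⟨b.succ, c⟩
        (normR ħ (r + 2) (k.succ : Fin (r + 1)) ((b.succ : Fin (r + 1)) + 1)
          (u k.succ j + u b.succ c + (((k : ℕ) : ℂ) - ((b : ℕ) : ℂ)) * ħ / 2))).prod).prod, ?_, ?_⟩
  rotate_left
  · rw [rBar]
    rw [show ∀ Z, embMat M A * flatOp M Z = embMat M A * (Matrix.compRingEquiv _ _ A) Z from
      fun _ => rfl, map_list_prod, List.map_map]
    refine intertwine_list _ fun b => ?_
    rw [Function.comp, map_list_prod, List.ofFn_eq_map, List.ofFn_eq_map, List.map_map]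
    exact intertwine_list _ fun c => onSites_succ_succ M ħ _ k b j c
  · rw [rBar, filter_lt_succ, List.reverse_cons, List.map_append, List.prod_append,
      ← List.map_reverse, List.map_map, List.map_singleton, List.prod_singleton, rBarTop]
    refine congrArg₂ _ (congrArg _ (List.map_congr_left fun b _ => congrArg _ (congrArg _
      (funext fun c => congrArg _ (congrArg _ ?_))))) (congrArg _ (congrArg _
      (funext fun c => congrArg _ (congrArg _ ?_))))
    · simp
    · simp only [Fin.val_succ, Fin.val_zero]; push_cast; ring

variable (M u) in
-- Here b increases, so the first-level factors stand at the left end and again touch D̂.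
theorem exists_rProd_split (k : Fin r) (j : Fin (M k.succ)) :
    ∃ X : AuxOp A M, rProd ħ M (fun _ => 1) u k.succ j = rProdTop M u ħ A k j * X ∧
      X * embMat M A = embMat M A * flatOp M (rProd ħ (A := Matrix (LowerCfg M) (LowerCfg M) A)
        (fun k : Fin r => M k.succ) (fun _ => 1) (fun k => u k.succ) k j) := by
  refine ⟨(((List.finRange r).filter (· < k)).map fun b : Fin r =>
    (List.ofFn fun c : Fin (M b.succ) =>
      onSites A (⟨k.succ, j⟩ : (k : Fin (r + 1)) × Fin (M k)) ⟨b.succ, c⟩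
        (normR ħ (r + 2) (k.succ : Fin (r + 1)) ((b.succ : Fin (r + 1)) + 1)
          (u k.succ j - u b.succ c + (((k : ℕ) : ℂ) - ((b : ℕ) : ℂ)) * ħ / 2))).reverse.prod).prod,
    ?_, ?_⟩
  rotate_left
  · rw [rProd]
    rw [show ∀ Z, embMat M A * flatOp M Z = embMat M A * (Matrix.compRingEquiv _ _ A) Z from
      fun _ => rfl, map_list_prod, List.map_map]
    refine intertwine_list _ fun b => ?_
    rw [Function.comp, map_list_prod, List.ofFn_eq_map, List.ofFn_eq_map, ← List.map_reverse,
      ← List.map_reverse, List.map_map]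
    exact intertwine_list _ fun c => onSites_succ_succ M ħ _ k b j c
  · rw [rProd, filter_lt_succ, List.map_cons, List.prod_cons, List.map_map, rProdTop]
    refine congrArg₂ _ (congrArg _ (congrArg _ (congrArg _
      (funext fun c => congrArg _ (congrArg _ ?_))))) (congrArg _ (List.map_congr_left fun b _ =>
      congrArg _ (congrArg _ (congrArg _ (funext fun c => congrArg _ (congrArg _ ?_))))))
    · simp only [Fin.val_succ, Fin.val_zero]; push_cast; ring
    · simp

/-- For level 2 the first-level factors around D̂^{(2)} are literally the definition of D'; no
condition on the vector is needed. -/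
theorem top_intertwine_one (D : ℂ → Matrix (Fin (r + 2)) (Fin (r + 2)) A) (k : Fin r)
    (hk : (k : ℕ) = 0) (j : Fin (M k.succ)) :
    rBarTop M u ħ A k j * onSite (⟨k.succ, j⟩ : (k : Fin (r + 1)) × Fin (M k))
        (hatD ħ D (k.succ : Fin (r + 1)) (u k.succ j + ħ / 2)) * rProdTop M u ħ A k j *
        embMat M A = embMat M A * flatOp M (onSite (⟨k, j⟩ : (k : Fin r) × Fin (M k.succ))
          (hatD ħ (psiGen ħ (u 0) D) k (u k.succ j + ħ / 2))) := by
  have honSite : ∀ l : List (Matrix (Fin (r + 1)) (Fin (r + 1)) (Matrix (LowerCfg M) (LowerCfg M) A)),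
      onSite (⟨k, j⟩ : (k : Fin r) × Fin (M k.succ)) l.prod = (l.map (onSite ⟨k, j⟩)).prod := by
    intro l
    induction l with
    | nil => simp [onSite_one]
    | cons X l ih => rw [List.prod_cons, onSite_mul, ih, List.map_cons, List.prod_cons]
  have e : hatD ħ (psiGen ħ (u 0) D) k (u k.succ j + ħ / 2) =
      psiGen ħ (u 0) D (u k.succ j + ħ / 2) := by rw [hk, hatD_zero]
  rw [e, psiGen, coprodFund, onSite_mul, onSite_mul, honSite, honSite]
  rw [show ∀ Z, embMat M A * flatOp M Z = embMat M A * (Matrix.compRingEquiv _ _ A) Z from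
      fun _ => rfl, map_mul, map_mul, map_list_prod, map_list_prod]
  refine intertwine_mul (intertwine_mul ?_ (onSite_hatD_one M ħ _ D k hk j)) ?_
  · rw [rBarTop, List.ofFn_eq_map, List.ofFn_eq_map, List.map_map, List.map_map]
    refine intertwine_list _ fun c => ?_
    have := onSites_succ_zero (A := A) M ħ (u k.succ j + ħ / 2 + (k : ℕ) * ħ / 2 + u 0 c) k hk j c
    rw [this, hk]
    simp [Function.comp]
  · rw [rProdTop, List.ofFn_eq_map, List.ofFn_eq_map, ← List.map_reverse, ← List.map_reverse,
      List.map_map, List.map_map]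
    refine intertwine_list _ fun c => ?_
    have := onSites_succ_zero (A := A) M ħ (u k.succ j + ħ / 2 + (k : ℕ) * ħ / 2 - u 0 c) k hk j c
    rw [this, hk]
    simp [Function.comp]

theorem onSite_projA_mul {s : (k : Fin r) × Fin (M k.succ)} {k : ℕ}
    {X : Matrix (Fin (r + 1)) (Fin (r + 1)) A} (h : ∀ i j : Fin (r + 1), (i : ℕ) < k → X i j = 0) :
    onSite s (projA A (r + 1) k) * onSite s X = onSite s X := by
  rw [← onSite_mul, projA]
  congr 1
  ext i j
  rw [Matrix.diagonal_mul]
  split_ifs with hi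
  · rw [one_mul]
  · rw [h i j (not_le.1 hi), zero_mul]

theorem onSite_mul_projA {s : (k : Fin r) × Fin (M k.succ)} {k : ℕ}
    {X : Matrix (Fin (r + 1)) (Fin (r + 1)) A} (h : ∀ i j : Fin (r + 1), (j : ℕ) < k → X i j = 0) :
    onSite s X * onSite s (projA A (r + 1) k) = onSite s X := by
  rw [← onSite_mul, projA]
  congr 1
  ext i j
  rw [Matrix.mul_diagonal]
  split_ifs with hi
  · rw [mul_one]
  · rw [h i j (not_le.1 hi), mul_zero]

/-- The scalars y'/(y'-ħ) at y' = y + u_{1c} and y' = y - u_{1c} multiply to `rho`, and the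
projectors are absorbed by D̂, whose rows and columns of small index vanish. -/
theorem top_intertwine_projA (D : ℂ → Matrix (Fin (r + 2)) (Fin (r + 2)) A) (k : Fin r)
    (hk : 1 ≤ (k : ℕ)) (j : Fin (M k.succ)) :
    rBarTop M u ħ A k j * onSite (⟨k.succ, j⟩ : (k : Fin (r + 1)) × Fin (M k))
        (hatD ħ D (k.succ : Fin (r + 1)) (u k.succ j + ħ / 2)) * rProdTop M u ħ A k j *
        incl A (embTop M) = incl A (embTop M) *
      (((List.finRange (M 0)).map fun c =>
          rho ħ (u 0 c) (u k.succ j + ħ / 2 + (k : ℕ) * ħ / 2)).prod •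
        onSite (⟨k, j⟩ : (k : Fin r) × Fin (M k.succ))
          ((hatD ħ D (k + 1) (u k.succ j + ħ / 2)).submatrix Fin.succ Fin.succ)) := by
  set y := u k.succ j + ħ / 2 + (k : ℕ) * ħ / 2 with hy
  set Z := onSite (⟨k, j⟩ : (k : Fin r) × Fin (M k.succ))
          ((hatD ħ D (k + 1) (u k.succ j + ħ / 2)).submatrix Fin.succ Fin.succ) with hZ
  have h₁ : onSite (⟨k, j⟩ : (k : Fin r) × Fin (M k.succ)) (projA A (r + 1) k) * Z = Z := by
    refine onSite_projA_mul fun i j hi => ?_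
    rw [Matrix.submatrix_apply, hatD, if_neg]
    simp only [Fin.val_succ]; omega
  have h₂ : Z * onSite (⟨k, j⟩ : (k : Fin r) × Fin (M k.succ)) (projA A (r + 1) k) = Z := by
    refine onSite_mul_projA fun i j hi => ?_
    rw [Matrix.submatrix_apply, hatD, if_neg]
    simp only [Fin.val_succ]; omega
  have e : ((List.finRange (M 0)).map fun c => rho ħ (u 0 c) y).prod • Z =
      ((List.finRange (M 0)).map fun c => ((y + u 0 c - ħ)⁻¹ * (y + u 0 c)) •
          onSite (⟨k, j⟩ : (k : Fin r) × Fin (M k.succ)) (projA A (r + 1) k)).prod * Z *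
        ((List.finRange (M 0)).reverse.map fun c => ((y - u 0 c - ħ)⁻¹ * (y - u 0 c)) •
          onSite (⟨k, j⟩ : (k : Fin r) × Fin (M k.succ)) (projA A (r + 1) k)).prod := by
    rw [prod_map_smul_absorb _ _ h₁, smul_mul_assoc, absorb_prod_map_smul _ _ h₂, smul_smul,
      List.map_reverse, List.prod_reverse, ← List.prod_map_mul]
    congr 3
    funext c
    rw [rho]; ring
  rw [e]
  refine intertwine_mul (intertwine_mul ?_ (onSite_hatD_top M ħ _ D k j)) ?_
  · rw [rBarTop, List.ofFn_eq_map]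
    exact intertwine_list _ fun c => onSites_top M ħ _ k hk j c
  · rw [rProdTop, List.ofFn_eq_map, ← List.map_reverse]
    exact intertwine_list _ fun c => onSites_top M ħ _ k hk j c

/-- For k ≥ 1 the entries involve only d_{11} and the lower block, which preserve `hwSub`; the
creation entries d_{1j} do not occur. -/
theorem hatD_smul_mem_hwSub {D : ℂ → Matrix (Fin (r + 1)) (Fin (r + 1)) A} {W : Submodule ℂ V}
    (hD : ReflData ħ D W S) {k : ℕ} (hk : 1 ≤ k) {x : ℂ} (hx : x + k * ħ / 2 ∈ S) {w : V}
    (hw : w ∈ hwSub D W S) (i j : Fin (r + 1)) : hatD ħ D k x i j • w ∈ hwSub D W S := by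
  have hd : ∀ i, D (x + k * ħ / 2) i i • w ∈ hwSub D W S := fun i => by
    refine Fin.cases ?_ (fun i => ?_) i
    · exact hD.diag_smul_mem_hwSub hw hx
    · exact hD.block_smul_mem_hwSub hw hx i i
  rw [hatD]
  split_ifs with h₁ h₂
  · rw [add_smul, Finset.sum_smul]
    refine Submodule.add_mem _ (h₂ ▸ hd i) (Submodule.sum_mem _ fun q _ => ?_)
    split_ifs
    · rw [smul_assoc]; exact Submodule.smul_mem _ _ (hd q)
    · simp
  · rw [add_zero]
    obtain ⟨i', rfl⟩ := Fin.exists_succ_eq.2 (show i ≠ 0 by rintro rfl; simp at h₁; omega)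
    obtain ⟨j', rfl⟩ := Fin.exists_succ_eq.2 (show j ≠ 0 by rintro rfl; simp at h₁; omega)
    exact hD.block_smul_mem_hwSub hw hx i' j'
  · simp

end RecursionStep


/-! ### Comparison of the trace formulas of ranks 𝔫 and 𝔫-1 -/

noncomputable section Recursion

variable {r : ℕ} {A V : Type*} [Ring A] [Algebra ℂ A] [AddCommGroup V] [Module ℂ V] [Module A V]
  [IsScalarTower ℂ A V] {M : Fin (r + 1) → ℕ} {ħ : ℂ} {S : Set ℂ}
  {u : (k : Fin (r + 1)) → Fin (M k) → ℂ} {W : Submodule ℂ V}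

theorem rBar_smul_mem {r : ℕ} {M : Fin r → ℕ} {u : (k : Fin r) → Fin (M k) → ℂ}
    {F : (((k : Fin r) × Fin (M k)) → Fin (r + 1)) → V} (k : Fin r) (j : Fin (M k))
    (hF : F ∈ piSub (((k : Fin r) × Fin (M k)) → Fin (r + 1)) W) :
    rBar ħ (A := A) M (fun _ => 1) u k j • F ∈
      piSub (((k : Fin r) × Fin (M k)) → Fin (r + 1)) W := by
  refine list_prod_smul_mem _ (fun X hX F hF => ?_) F hF
  obtain ⟨b, -, rfl⟩ := List.mem_map.1 hX
  refine list_prod_smul_mem _ (fun X hX F hF => ?_) F hF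
  obtain ⟨c, rfl⟩ := (List.mem_ofFn' _ _).1 hX
  exact onSites_smul_mem _ _ _ hF

theorem rProd_smul_mem {r : ℕ} {M : Fin r → ℕ} {u : (k : Fin r) → Fin (M k) → ℂ}
    {F : (((k : Fin r) × Fin (M k)) → Fin (r + 1)) → V} (k : Fin r) (j : Fin (M k))
    (hF : F ∈ piSub (((k : Fin r) × Fin (M k)) → Fin (r + 1)) W) :
    rProd ħ (A := A) M (fun _ => 1) u k j • F ∈
      piSub (((k : Fin r) × Fin (M k)) → Fin (r + 1)) W := by
  refine list_prod_smul_mem _ (fun X hX F hF => ?_) F hF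
  obtain ⟨b, -, rfl⟩ := List.mem_map.1 hX
  refine list_prod_smul_mem _ (fun X hX F hF => ?_) F hF
  obtain ⟨c, rfl⟩ := (List.mem_ofFn' _ _).1 (List.mem_reverse.1 hX)
  exact onSites_smul_mem _ _ _ hF

/-- Both operators send e_2^{⊗M_1} ⊗ H to the product of the `rho` times D̂^{(i-1)}[τ(D)] on H: one
because the reduced R-matrices become scalars, the other by the homogeneous scaling under dressing.
The image has e_2 in the first-level spaces again, so the argument can be repeated. -/
theorem top_smul {D : ℂ → Matrix (Fin (r + 2)) (Fin (r + 2)) A} (hD : ReflData ħ D W S)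
    (hu : RegPts ħ S M u) (k : Fin r) (hk : 1 ≤ (k : ℕ)) (j : Fin (M k.succ))
    {F : UpperCfg M → LowerCfg M → V}
    (hF : F ∈ topSub M (hwSub (tau ħ D) (hwSub D W S) (tauSet ħ S))) :
    (rBarTop M u ħ A k j * onSite (⟨k.succ, j⟩ : (k : Fin (r + 1)) × Fin (M k))
        (hatD ħ D (k.succ : Fin (r + 1)) (u k.succ j + ħ / 2)) * rProdTop M u ħ A k j) •
        embVec M F = embVec M (onSite (⟨k, j⟩ : (k : Fin r) × Fin (M k.succ))
          (hatD ħ (psiGen ħ (u 0) D) k (u k.succ j + ħ / 2)) • F) ∧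
    onSite (⟨k, j⟩ : (k : Fin r) × Fin (M k.succ))
          (hatD ħ (psiGen ħ (u 0) D) k (u k.succ j + ħ / 2)) • F ∈
      topSub M (hwSub (tau ħ D) (hwSub D W S) (tauSet ħ S)) := by
  obtain ⟨H, hH, rfl⟩ := (mem_topSub M).1 hF
  obtain ⟨k', hk'⟩ := Nat.exists_eq_add_of_le' hk
  set w := u k.succ j + ħ / 2 with hw
  have hmem : w + (k : ℕ) * ħ / 2 ∈ psiSet ħ (u 0) S := hu.succ.mem k j
  -- In terms of u, the three exclusions on w = u + ħ/2 are 2u + lħ ≠ 0 for l = 1, k and k+1.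
  have hw0 : w ≠ 0 := by
    have := hu.two_ne k.succ j 1 le_rfl (by simp)
    intro h0
    apply this
    rw [hw] at h0
    push_cast
    linear_combination 2 * h0
  have hk1 : 2 * w + (k' : ℕ) * ħ ≠ 0 := by
    have := hu.two_ne k.succ j (k' + 1) (by omega) (by simp; omega)
    intro h0
    apply this
    rw [hw] at h0
    push_cast
    linear_combination h0
  have hk2 : 2 * w + (k : ℕ) * ħ ≠ 0 := by
    have := hu.two_ne k.succ j (k + 1) (by omega) (by simp)
    intro h0
    apply this
    rw [hw] at h0
    push_cast
    linear_combination h0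
  set ρ := ((List.finRange (M 0)).map fun c => rho ħ (u 0 c) (w + (k : ℕ) * ħ / 2)).prod with hρ
  have key : onSite (⟨k, j⟩ : (k : Fin r) × Fin (M k.succ))
      (hatD ħ (psiGen ħ (u 0) D) k w) • (fun g => highestTensor (M 0) r (H g)) =
      fun g => highestTensor (M 0) r (ρ • (onSite (⟨k, j⟩ : (k : Fin r) × Fin (M k.succ))
        (hatD ħ (tau ħ D) k w) • H) g) := by
    funext g
    rw [onSite_smul_apply, onSite_smul_apply, Finset.smul_sum]
    have hsum : ∀ f : Fin (r + 1) → V, highestTensor (M 0) r (∑ q, f q) =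
        ∑ q, highestTensor (M 0) r (f q) := fun f =>
      map_sum (LinearMap.single ℂ (fun _ : LowerCfg M => V) fun _ => 0) f _
    rw [hsum]
    refine Finset.sum_congr rfl fun a _ => ?_
    rw [highestTensor_smul, hρ]
    rw [hk'] at hmem hk2 ⊢
    exact psiGen_hatD_smul (u 0) hw0 hk1 hmem (hH _) _ _
  rw [key]
  refine ⟨?_, (mem_topSub M).2 ⟨_, fun g => ?_, rfl⟩⟩
  · rw [embVec_highestTensor, embVec_highestTensor,
      smul_push (top_intertwine_projA D k hk j) H]
    congr 1
    have e : (hatD ħ D (k + 1) w).submatrix Fin.succ Fin.succ = hatD ħ (tau ħ D) k w := by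
      ext i j
      exact hatD_succ ħ D hw0 hk2 (by omega) i j
    rw [← hw, e, ← hρ]
    funext g
    rw [smul_assoc]
    rfl
  · refine Submodule.smul_mem _ _ ?_
    rw [onSite_smul_apply]
    exact Submodule.sum_mem _ fun a _ => hatD_smul_mem_hwSub hD.tau hk hmem.1 (hH _) _ _

theorem level_smul {D : ℂ → Matrix (Fin (r + 2)) (Fin (r + 2)) A} (hD : ReflData ħ D W S)
    (hu : RegPts ħ S M u) (k : Fin r) (hk : 1 ≤ (k : ℕ)) :
    ∀ F ∈ topSub M (hwSub (tau ħ D) (hwSub D W S) (tauSet ħ S)),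
    dressedD ħ D M (fun _ => 1) u k.succ • embVec M F =
      embVec M (dressedD ħ (psiGen ħ (u 0) D) (fun k => M k.succ) (fun _ => 1)
        (fun k => u k.succ) k • F) ∧
      dressedD ħ (psiGen ħ (u 0) D) (fun k => M k.succ) (fun _ => 1) (fun k => u k.succ) k • F ∈
        topSub M (hwSub (tau ħ D) (hwSub D W S) (tauSet ħ S)) := by
  rw [dressedD, dressedD, List.ofFn_eq_map, List.ofFn_eq_map]
  refine smul_list_prod_of_forall (embVec M)
    {F | F ∈ topSub M (hwSub (tau ħ D) (hwSub D W S) (tauSet ħ S))} _ _ _ fun j _ F hF => ?_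
  obtain ⟨X, hX, hX'⟩ := exists_rBar_split (A := A) (ħ := ħ) M u k j
  obtain ⟨Z, hZ, hZ'⟩ := exists_rProd_split (A := A) (ħ := ħ) M u k j
  have h₁ := rProd_smul_mem (A := Matrix (LowerCfg M) (LowerCfg M) A) (ħ := ħ)
    (u := fun k => u k.succ) k j hF
  obtain ⟨h₂, h₃⟩ := top_smul hD hu k hk j h₁
  refine ⟨?_, ?_⟩
  · rw [hX, hZ]
    simp only [Equiv.Perm.coe_one, id_eq] at h₂ ⊢
    rw [show ∀ a b c d e : AuxOp A M, a * b * c * (d * e) = a * (b * c * d) * e from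
      fun a b c d e => by simp only [mul_assoc], mul_smul, mul_smul, smul_embVec M hZ', h₂,
      smul_embVec M hX', mul_smul, mul_smul]
  · rw [mul_smul, mul_smul]
    exact rBar_smul_mem (A := Matrix (LowerCfg M) (LowerCfg M) A) (ħ := ħ)
      (u := fun k => u k.succ) k j h₃

/-- Level 2 may change the first-level labels, so it is compared on all vectors without e_1 and not
just on those with e_2 in the first-level spaces. -/
theorem level_one_intertwine (D : ℂ → Matrix (Fin (r + 2)) (Fin (r + 2)) A) (k : Fin r)
    (hk : (k : ℕ) = 0) :
    dressedD ħ D M (fun _ => 1) u k.succ * embMat M A =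
      embMat M A * flatOp M (dressedD ħ (psiGen ħ (u 0) D) (fun k => M k.succ) (fun _ => 1)
        (fun k => u k.succ) k) := by
  rw [dressedD, dressedD, List.ofFn_eq_map, List.ofFn_eq_map]
  rw [show ∀ Z, embMat M A * flatOp M Z = embMat M A * (Matrix.compRingEquiv _ _ A) Z from
      fun _ => rfl, map_list_prod, List.map_map]
  refine intertwine_list _ fun j => ?_
  obtain ⟨X, hX, hX'⟩ := exists_rBar_split (A := A) (ħ := ħ) M u k j
  obtain ⟨Z, hZ, hZ'⟩ := exists_rProd_split (A := A) (ħ := ħ) M u k j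
  rw [hX, hZ, Function.comp, map_mul, map_mul]
  rw [show ∀ a b c d e : AuxOp A M, a * b * c * (d * e) = a * (b * c * d) * e from
      fun a b c d e => by simp only [mul_assoc]]
  exact intertwine_mul (intertwine_mul hX' (top_intertwine_one D k hk j)) hZ'

theorem upper_smul {D : ℂ → Matrix (Fin (r + 2)) (Fin (r + 2)) A} (hD : ReflData ħ D W S)
    (hu : RegPts ħ S M u) {F : UpperCfg M → LowerCfg M → V}
    (hF : F ∈ topSub M (hwSub (tau ħ D) (hwSub D W S) (tauSet ħ S))) :
    (List.ofFn fun k : Fin r => dressedD ħ D M (fun _ => 1) u k.succ).prod • embVec M F =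
      embVec M ((List.ofFn fun k : Fin r => dressedD ħ (psiGen ħ (u 0) D) (fun k => M k.succ)
        (fun _ => 1) (fun k => u k.succ) k).prod • F) := by
  cases r with
  | zero => simp
  | succ r =>
    -- The leftmost factor, level 2, acts last. All levels i ≥ 3 act while the first-level spaces
    -- still carry e_2.
    rw [List.ofFn_succ, List.ofFn_succ, List.prod_cons, List.prod_cons, List.ofFn_eq_map,
      List.ofFn_eq_map, mul_smul, mul_smul]
    obtain ⟨h₁, -⟩ := smul_list_prod_of_forall (embVec M)
      {F | F ∈ topSub M (hwSub (tau ħ D) (hwSub D W S) (tauSet ħ S))} _ _ (List.finRange r)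
      (fun k _ F hF => level_smul hD hu k.succ (by simp) F hF) F hF
    rw [h₁, smul_embVec M (level_one_intertwine D 0 rfl)]

theorem dressedD_zero (D : ℂ → Matrix (Fin (r + 2)) (Fin (r + 2)) A) :
    dressedD ħ D M (fun _ => 1) u 0 = ((List.finRange (M 0)).map fun j =>
      onSite (⟨0, j⟩ : (k : Fin (r + 1)) × Fin (M k)) (D (u 0 j + ħ / 2))).prod := by
  rw [dressedD, List.ofFn_eq_map]
  congr 2
  funext j
  have h0 : (List.finRange (r + 1)).filter (· < (0 : Fin (r + 1))) = [] := by
    rw [List.filter_eq_nil_iff]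
    simp
  rw [rBar, rProd, h0]
  simp only [List.reverse_nil, List.map_nil, List.prod_nil, one_mul, mul_one,
    Equiv.Perm.coe_one, id_eq, Fin.val_zero, hatD_zero]

theorem contractB_smul (D : ℂ → Matrix (Fin (r + 2)) (Fin (r + 2)) A) {m : ℕ} (a : Fin m → ℂ)
    (X : Matrix (Fin m → Fin (r + 1)) (Fin m → Fin (r + 1)) A) (w : V) :
    contractB ħ D a X • w = ∑ p : Fin m → Fin (r + 1),
      (List.ofFn fun c : Fin m => hatB ħ D (a c) (p c)).prod • (X • highestTensor m r w) p := by
  rw [contractB, Finset.sum_smul]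
  refine Finset.sum_congr rfl fun p _ => ?_
  rw [mul_smul]
  congr 1
  rw [Matrix.Module.smul_apply, Finset.sum_eq_single (fun _ => 0)]
  · rw [highestTensor_apply, if_pos rfl]
  · intro q _ hq; rw [highestTensor_apply, if_neg hq, smul_zero]
  · simp

theorem ketCfg_eq : ketCfg M = embCfg M (ketCfg (fun k : Fin r => M k.succ), fun _ => 0) := by
  funext s
  revert s
  rw [forall_site]
  exact ⟨fun j => rfl, fun s => rfl⟩

/-- The first level has no R-matrices, and the trace fixes its row labels to 1; the entries d_{1j}
of the row B̂ remain, in the order of the spaces. -/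
theorem firstLevel_smul_apply (D : ℂ → Matrix (Fin (r + 2)) (Fin (r + 2)) A)
    (F : UpperCfg M → LowerCfg M → V) :
    (dressedD ħ D M (fun _ => 1) u 0 • embVec M F) (braCfg M) =
      ∑ p : LowerCfg M, (List.ofFn fun c : Fin (M 0) => hatB ħ D (u 0 c) (p c)).prod •
        F (braCfg fun k : Fin r => M k.succ) p := by
  classical
  have hentry : ∀ i : UpperCfg M × LowerCfg M,
      dressedD ħ D M (fun _ => 1) u 0 (braCfg M) (embCfg M i) =
      if i.1 = braCfg (fun k : Fin r => M k.succ) then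
        (List.ofFn fun c : Fin (M 0) => hatB ħ D (u 0 c) (i.2 c)).prod else 0 := by
    intro i
    have hiff : (∀ x, (∀ j ∈ List.finRange (M 0),
        x ≠ (⟨0, j⟩ : (k : Fin (r + 1)) × Fin (M k))) → braCfg M x = embCfg M i x) ↔
        i.1 = braCfg fun k : Fin r => M k.succ := by
      rw [forall_site, funext_iff]
      constructor
      · intro h s
        have : (s.1.castSucc).succ = (i.1 s).succ :=
          h.2 s fun j _ => (zero_site_ne_succ M s.1 s.2 j).symm
        exact (Fin.succ_injective _ this).symm
      · intro h
        refine ⟨fun j hj => absurd rfl (hj j (List.mem_finRange j)), fun s _ => ?_⟩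
        rw [embCfg_succ, h s]
        rfl
    rw [dressedD_zero, prod_onSite_apply (fun c c' h => by
      by_contra h'; exact (zero_site_inj M).2 h' h) (fun j => D (u 0 j + ħ / 2))
      (List.nodup_finRange _), List.ofFn_eq_map]
    by_cases h : i.1 = braCfg fun k : Fin r => M k.succ
    · rw [if_pos h, if_pos (hiff.2 h)]
      rfl
    · rw [if_neg h, if_neg fun h' => h (hiff.1 h')]
  rw [Matrix.Module.smul_apply]
  simp only [embVec, push]
  have h₁ : ∀ q, dressedD ħ D M (fun _ => 1) u 0 (braCfg M) q •
      (∑ i : UpperCfg M × LowerCfg M, if q = embCfg M i then F i.1 i.2 else 0) =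
      ∑ i : UpperCfg M × LowerCfg M, if q = embCfg M i then
        dressedD ħ D M (fun _ => 1) u 0 (braCfg M) q • F i.1 i.2 else 0 := by
    intro q
    rw [Finset.smul_sum]
    exact Finset.sum_congr rfl fun i _ => by split_ifs <;> simp
  simp only [h₁]
  rw [Finset.sum_comm]
  simp only [Finset.sum_ite_eq', Finset.mem_univ, if_true, hentry, Fintype.sum_prod_type]
  rw [Finset.sum_eq_single (braCfg fun k : Fin r => M k.succ)]
  · simp
  · intro g _ hg; simp [hg]
  · simp

theorem entry_smul {ι R E : Type*} [Fintype ι] [DecidableEq ι] [Ring R] [AddCommGroup E]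
    [Module R E] (X : Matrix ι ι R) (i j : ι) (w : E) :
    X i j • w = (X • (Pi.single j w : ι → E)) i := by
  rw [Matrix.Module.smul_apply, Finset.sum_eq_single j]
  · simp
  · intro b _ hb; simp [hb]
  · simp

/-- The trace formula of rank `𝔫` in terms of the trace formula of rank `𝔫 - 1`. -/
theorem betheTrace_smul {D : ℂ → Matrix (Fin (r + 2)) (Fin (r + 2)) A} (hD : ReflData ħ D W S)
    (hu : RegPts ħ S M u) {Ω : V} (hΩ : IsHighest D W S Ω) :
    betheTrace ħ D M (fun _ => 1) u • Ω = contractB ħ D (u 0)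
      (betheTrace ħ (psiGen ħ (u 0) D) (fun k => M k.succ) (fun _ => 1)
        (fun k => u k.succ)) • Ω := by
  have hF : (Pi.single (ketCfg fun k : Fin r => M k.succ) (highestTensor (M 0) r Ω) :
      UpperCfg M → LowerCfg M → V) ∈ topSub M (hwSub (tau ħ D) (hwSub D W S) (tauSet ħ S)) := by
    refine (mem_topSub M).2 ⟨Pi.single (ketCfg fun k : Fin r => M k.succ) Ω, fun g => ?_, ?_⟩
    · rw [Pi.single_apply]
      split_ifs
      · exact hΩ.tau.mem_hwSub
      · exact Submodule.zero_mem _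
    · funext g
      by_cases h : g = ketCfg fun k : Fin r => M k.succ
      · subst h; simp
      · simp [h]
  have hket : (Pi.single (ketCfg M) Ω : (((k : Fin (r + 1)) × Fin (M k)) → Fin (r + 2)) → V) =
      embVec M (Pi.single (ketCfg fun k : Fin r => M k.succ) (highestTensor (M 0) r Ω)) := by
    rw [ketCfg_eq, ← push_single, embVec]
    congr 1
    funext i
    simp only [Pi.single_apply, Prod.ext_iff]
    by_cases h : i.1 = ketCfg fun k : Fin r => M k.succ
    · simp [h, highestTensor_apply]
    · simp [h]
  rw [betheTrace_eq, List.ofFn_succ, List.prod_cons, entry_smul, mul_smul, hket, upper_smul hD hu hF,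
    firstLevel_smul_apply, contractB_smul]
  refine Finset.sum_congr rfl fun p _ => ?_
  congr 1
  rw [betheTrace_eq, entry_smul]

end Recursion


/-! ### Permutations of the auxiliary spaces -/

noncomputable section SitePermutation

variable {S : Type*} [DecidableEq S] [Fintype S] {n : ℕ} {A V : Type*} [Ring A] [AddCommGroup V]
  [Module A V]

/-- The permutation operator of the auxiliary spaces. -/
def sitePerm (A : Type*) [Ring A] (n : ℕ) (σ : Equiv.Perm S) : Matrix (S → Fin n) (S → Fin n) A :=
  fun p q => if p ∘ σ = q then 1 else 0

theorem sitePerm_mul_apply (σ : Equiv.Perm S) (X : Matrix (S → Fin n) (S → Fin n) A)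
    (p q : S → Fin n) : (sitePerm A n σ * X) p q = X (p ∘ σ) q := by
  simp [Matrix.mul_apply, sitePerm]

theorem mul_sitePerm_apply (σ : Equiv.Perm S) (X : Matrix (S → Fin n) (S → Fin n) A)
    (p q : S → Fin n) : (X * sitePerm A n σ) p q = X p (q ∘ σ.symm) := by
  have : ∀ x : S → Fin n, x ∘ σ = q ↔ x = q ∘ σ.symm := fun x => by
    constructor
    · rintro rfl; funext s; simp
    · rintro rfl; funext s; simp
  simp [Matrix.mul_apply, sitePerm, this]

theorem sitePerm_smul_apply (σ : Equiv.Perm S) (F : (S → Fin n) → V) (p : S → Fin n) :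
    (sitePerm A n σ • F) p = F (p ∘ σ) := by
  rw [Matrix.Module.smul_apply, Finset.sum_eq_single (p ∘ σ)]
  · simp [sitePerm]
  · intro q _ hq; rw [sitePerm, if_neg (Ne.symm hq), zero_smul]
  · simp

theorem sitePerm_mul_onSite (σ : Equiv.Perm S) (s : S) (X : Matrix (Fin n) (Fin n) A) :
    sitePerm A n σ * onSite s X = onSite (σ s) X * sitePerm A n σ := by
  ext p q
  rw [sitePerm_mul_apply, mul_sitePerm_apply, onSite, onSite]
  have : (∀ x, x ≠ s → (p ∘ σ) x = q x) ↔ ∀ x, x ≠ σ s → p x = (q ∘ σ.symm) x := by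
    rw [← σ.forall_congr_right (q := fun x => x ≠ σ s → p x = (q ∘ σ.symm) x)]
    simp
  simp only [this]
  simp only [Function.comp, Equiv.symm_apply_apply]

theorem sitePerm_mul_onSites [Algebra ℂ A] (σ : Equiv.Perm S) (s t : S)
    (Y : Matrix (Fin n × Fin n) (Fin n × Fin n) ℂ) :
    sitePerm A n σ * onSites A s t Y = onSites A (σ s) (σ t) Y * sitePerm A n σ := by
  ext p q
  rw [sitePerm_mul_apply, mul_sitePerm_apply, onSites, onSites]
  have : (∀ x, x ≠ s → x ≠ t → (p ∘ σ) x = q x) ↔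
      ∀ x, x ≠ σ s → x ≠ σ t → p x = (q ∘ σ.symm) x := by
    rw [← σ.forall_congr_right (q := fun x => x ≠ σ s → x ≠ σ t → p x = (q ∘ σ.symm) x)]
    simp
  simp only [this]
  simp only [Function.comp, Equiv.symm_apply_apply]

theorem sitePerm_mul_self {σ : Equiv.Perm S} (h : ∀ s, σ (σ s) = s) :
    sitePerm A n σ * sitePerm A n σ = 1 := by
  ext p q
  rw [sitePerm_mul_apply, sitePerm, Matrix.one_apply]
  have : (p ∘ σ) ∘ σ = p := funext fun s => by simp [h]
  rw [this]

theorem intertwine_prod {β R : Type*} [Monoid R] {g : R} {X Y : β → R} (l : List β)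
    (h : ∀ b ∈ l, g * X b = Y b * g) : g * (l.map X).prod = (l.map Y).prod * g := by
  induction l with
  | nil => simp
  | cons b l ih =>
    rw [List.map_cons, List.map_cons, List.prod_cons, List.prod_cons, ← mul_assoc,
      h b List.mem_cons_self, mul_assoc, ih fun b hb => h b (List.mem_cons_of_mem _ hb), mul_assoc]

end SitePermutation

/-! ### Independence of the labels of the auxiliary spaces -/

noncomputable section Relabel

variable (ħ : ℂ) {r : ℕ} {A : Type*} [Ring A] [Algebra ℂ A]
  (D : ℂ → Matrix (Fin (r + 1)) (Fin (r + 1)) A)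
  (M : Fin r → ℕ) (π : (k : Fin r) → Equiv.Perm (Fin (M k))) (u : (k : Fin r) → Fin (M k) → ℂ)

theorem sitePerm_mul_dressedD (k : Fin r) :
    sitePerm A (r + 1) (Equiv.sigmaCongrRight π) * dressedD ħ D M (fun _ => 1) u k =
      dressedD ħ D M π u k * sitePerm A (r + 1) (Equiv.sigmaCongrRight π) := by
  rw [dressedD, dressedD, List.ofFn_eq_map, List.ofFn_eq_map]
  refine intertwine_prod _ fun j _ => ?_
  have h₁ : sitePerm A (r + 1) (Equiv.sigmaCongrRight π) * rBar ħ M (fun _ => 1) u k j =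
      rBar ħ M π u k j * sitePerm A (r + 1) (Equiv.sigmaCongrRight π) := by
    rw [rBar, rBar]
    refine intertwine_prod _ fun b _ => ?_
    rw [List.ofFn_eq_map, List.ofFn_eq_map]
    exact intertwine_prod _ fun c _ => sitePerm_mul_onSites _ _ _ _
  have h₂ : sitePerm A (r + 1) (Equiv.sigmaCongrRight π) * rProd ħ M (fun _ => 1) u k j =
      rProd ħ M π u k j * sitePerm A (r + 1) (Equiv.sigmaCongrRight π) := by
    rw [rProd, rProd]
    refine intertwine_prod _ fun b _ => ?_
    rw [List.ofFn_eq_map, List.ofFn_eq_map, ← List.map_reverse, ← List.map_reverse]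
    exact intertwine_prod _ fun c _ => sitePerm_mul_onSites _ _ _ _
  rw [← mul_assoc, ← mul_assoc, h₁, mul_assoc (rBar ħ M π u k j), sitePerm_mul_onSite, mul_assoc,
    mul_assoc, h₂]
  simp only [mul_assoc]
  rfl

/-- The trace formula does not depend on the labels of the auxiliary spaces. -/
theorem betheTrace_relabel : betheTrace ħ D M π u = betheTrace ħ D M (fun _ => 1) u := by
  rw [betheTrace_eq, betheTrace_eq, List.ofFn_eq_map, List.ofFn_eq_map]
  have := intertwine_prod (List.finRange r) fun k _ => sitePerm_mul_dressedD ħ D M π u k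
  have := congrFun (congrFun this (braCfg M)) (ketCfg M)
  rw [sitePerm_mul_apply, mul_sitePerm_apply] at this
  -- The row and column labels picked by the trace depend on the level only, so a permutation within
  -- the levels does not change them.
  exact this.symm

end Relabel

/-! ### Exchange of two spaces of the first level -/

noncomputable section Exchange

variable {n : ℕ} {B : Type*} [Ring B] [Algebra ℂ B]

/-- The Yang–Baxter equation in braid form: P R(y-z) interchanges the spectral parameters of two
neighbouring factors while the spaces stay in place. -/
theorem unitR_exchange {e f : Fin n → Fin n → B} {P : B} (he : ∀ i j, P * e i j = f i j * P)
    (hf : ∀ i j, P * f i j = e i j * P) (hP : P * P = 1)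
    (hs : ∀ i l, ∑ j, e j i * f l j = f l i * P) (ħ y z : ℂ) (i l : Fin n) :
    ((y - z) • P - ħ • 1) * (unitR ħ e y * unitR ħ f z) i l =
      (unitR ħ e z * unitR ħ f y) i l * ((y - z) • P - ħ • 1) := by
  have key : ∀ y z, (unitR ħ e y * unitR ħ f z) i l = ((y - ħ)⁻¹ * (z - ħ)⁻¹) •
      ((y * z * if i = l then 1 else 0) • (1 : B) - (ħ * y) • f l i - (ħ * z) • e l i +
        (ħ * ħ) • (f l i * P)) := by
    intro y z
    rw [← hs, Matrix.mul_apply]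
    have : ∀ j, unitR ħ e y i j * unitR ħ f z j l = ((y - ħ)⁻¹ * (z - ħ)⁻¹) •
        ((if i = j then (y * z * if j = l then 1 else 0) • (1 : B) - (ħ * y) • f l j else 0) -
          (if j = l then (ħ * z) • e j i else 0) + (ħ * ħ) • (e j i * f l j)) := by
      intro j
      simp only [unitR, smul_mul_smul_comm]
      congr 1
      simp only [sub_mul, mul_sub, smul_mul_smul_comm, one_mul, mul_one]
      split_ifs <;> simp <;> module
    simp only [this]
    rw [← Finset.smul_sum, Finset.sum_add_distrib, Finset.sum_sub_distrib, ← Finset.smul_sum]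
    simp
  have hP' : P * (f l i * P) = e l i := by rw [← mul_assoc, hf, mul_assoc, hP, mul_one]
  have hP'' : f l i * P * P = f l i := by rw [mul_assoc, hP, mul_one]
  rw [key, key]
  simp only [smul_mul_assoc, mul_smul_comm, sub_mul, mul_sub, add_mul, mul_add, one_mul, mul_one,
    he, hf, hP', hP'']
  rw [mul_comm (z - ħ)⁻¹]
  module

variable {m : ℕ} {A : Type*} [Ring A] [Algebra ℂ A]

/-- The intertwiner `P R(x)` of the spaces `c` and `c'`. -/
def braidR (ħ : ℂ) (A : Type*) [Ring A] [Algebra ℂ A] (n : ℕ) (c c' : Fin m) (x : ℂ) :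
    Matrix (Fin m → Fin n) (Fin m → Fin n) A :=
  x • sitePerm A n (Equiv.swap c c') - ħ • 1

theorem sitePerm_mul_siteUnit (c c' t : Fin m) (i j : Fin n) :
    sitePerm A n (Equiv.swap c c') * siteUnit A t i j =
      siteUnit A (Equiv.swap c c' t) i j * sitePerm A n (Equiv.swap c c') :=
  sitePerm_mul_onSite _ _ _

theorem sum_siteUnit_mul_siteUnit {c c' : Fin m} (h : c ≠ c') (i l : Fin n) :
    ∑ j, siteUnit A c j i * siteUnit A c' l j =
      siteUnit A c' l i * sitePerm A n (Equiv.swap c c') := by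
  ext p q
  rw [mul_sitePerm_apply, Matrix.sum_apply]
  simp only [siteUnit, onSite_mul_onSite_apply h]
  rw [onSite]
  have : (∀ x, x ≠ c' → p x = (q ∘ (Equiv.swap c c').symm) x) ↔
      (∀ x, x ≠ c → x ≠ c' → p x = q x) ∧ p c = q c' := by
    constructor
    · intro hx
      refine ⟨fun x h₁ h₂ => ?_, ?_⟩
      · rw [hx x h₂]; simp [Equiv.swap_apply_of_ne_of_ne h₁ h₂]
      · rw [hx c h]; simp
    · rintro ⟨h₁, h₂⟩ x hx
      by_cases hxc : x = c
      · subst hxc; simp [h₂]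
      · rw [h₁ x hxc hx]; simp [Equiv.swap_apply_of_ne_of_ne hxc hx]
  simp only [this]
  by_cases h₁ : ∀ x, x ≠ c → x ≠ c' → p x = q x
  · simp only [eq_true h₁, true_and, if_true]
    simp only [Matrix.single_apply, Function.comp, Equiv.symm_swap, Equiv.swap_apply_right]
    simp only [ite_and, mul_ite, mul_one, mul_zero]
    by_cases h₂ : p c = q c' <;> by_cases h₃ : i = q c <;> by_cases h₄ : l = p c' <;>
      simp [h₂, h₃, h₄]
    exact fun h => absurd h.symm h₂
  · simp [h₁]

theorem braidR_mul_fundR {c c' : Fin m} (h : c ≠ c') (ħ y z : ℂ) (i l : Fin n) :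
    braidR ħ A n c c' (y - z) *
        (fundR ħ A c y * fundR ħ A c' z : Matrix (Fin n) (Fin n) _) i l =
      (fundR ħ A c z * fundR ħ A c' y : Matrix (Fin n) (Fin n) _) i l * braidR ħ A n c c' (y - z) := by
  rw [fundR_eq, fundR_eq, fundR_eq, fundR_eq]
  refine unitR_exchange (fun i j => ?_) (fun i j => ?_) (sitePerm_mul_self (by simp))
    (sum_siteUnit_mul_siteUnit h) ħ y z i l
  · rw [sitePerm_mul_siteUnit, Equiv.swap_apply_left]
  · rw [sitePerm_mul_siteUnit, Equiv.swap_apply_right]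

theorem braidR_commute_siteUnit {c c' t : Fin m} (h : t ≠ c) (h' : t ≠ c') (ħ x : ℂ)
    (i j : Fin n) : Commute (braidR ħ A n c c' x) (siteUnit A t i j) := by
  have : Commute (sitePerm A n (Equiv.swap c c')) (siteUnit A t i j) := by
    have := sitePerm_mul_siteUnit (A := A) c c' t i j
    rwa [Equiv.swap_apply_of_ne_of_ne h h'] at this
  exact (this.smul_left x).sub_left ((Commute.one_left _).smul_left ħ)

theorem braidR_comm (c c' : Fin m) (ħ x : ℂ) : braidR ħ A n c c' x = braidR ħ A n c' c x := by
  rw [braidR, braidR, Equiv.swap_comm]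

/-- `g` intertwines the entries of `X` and `Y`. -/
def EntryIntertwine {ι : Type*} (g : B) (X Y : Matrix ι ι B) : Prop :=
  ∀ i j, g * X i j = Y i j * g

theorem EntryIntertwine.mul {ι : Type*} [Fintype ι] {g : B} {X Y X' Y' : Matrix ι ι B}
    (h : EntryIntertwine g X Y) (h' : EntryIntertwine g X' Y') :
    EntryIntertwine g (X * X') (Y * Y') := fun i j => by
  rw [Matrix.mul_apply, Matrix.mul_apply, Finset.mul_sum, Finset.sum_mul]
  refine Finset.sum_congr rfl fun p _ => ?_
  rw [← mul_assoc, h, mul_assoc, h', mul_assoc]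

theorem EntryIntertwine.one {ι : Type*} [DecidableEq ι] (g : B) :
    EntryIntertwine g (1 : Matrix ι ι B) 1 := fun i j => by
  rw [Matrix.one_apply]
  split_ifs <;> simp

theorem EntryIntertwine.list_prod {ι β : Type*} [Fintype ι] [DecidableEq ι] {g : B}
    {X Y : β → Matrix ι ι B} (l : List β) (h : ∀ b ∈ l, EntryIntertwine g (X b) (Y b)) :
    EntryIntertwine g (l.map X).prod (l.map Y).prod := by
  induction l with
  | nil => exact EntryIntertwine.one g
  | cons b l ih =>
    rw [List.map_cons, List.map_cons, List.prod_cons, List.prod_cons]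
    exact (h b List.mem_cons_self).mul (ih fun b hb => h b (List.mem_cons_of_mem _ hb))

theorem EntryIntertwine.hatD {g : B} {D D' : ℂ → Matrix (Fin n) (Fin n) B}
    (h : ∀ x, EntryIntertwine g (D x) (D' x)) (ħ : ℂ) (k : ℕ) (x : ℂ) :
    EntryIntertwine g (hatD ħ D k x) (hatD ħ D' k x) := fun i j => by
  simp only [OpenChain.hatD]
  split_ifs
  · rw [mul_add, add_mul, h, Finset.mul_sum, Finset.sum_mul]
    congr 1
    refine Finset.sum_congr rfl fun a _ => ?_
    split_ifs
    · rw [mul_smul_comm, smul_mul_assoc, h]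
    · simp
  · rw [mul_add, add_mul, h, mul_zero, zero_mul]
  · simp

theorem EntryIntertwine.dressedD {r : ℕ} {M : Fin r → ℕ} {g : B}
    {D D' : ℂ → Matrix (Fin (r + 1)) (Fin (r + 1)) B} (h : ∀ x, EntryIntertwine g (D x) (D' x))
    (ħ : ℂ) (π : (k : Fin r) → Equiv.Perm (Fin (M k))) (u : (k : Fin r) → Fin (M k) → ℂ)
    (k : Fin r) : EntryIntertwine g (dressedD ħ D M π u k) (dressedD ħ D' M π u k) := by
  have hs : ∀ (s t : (k : Fin r) × Fin (M k)) Y,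
      EntryIntertwine g (onSites B s t Y : AuxOp B M) (onSites B s t Y) := fun s t Y p q => by
    rw [onSites]
    split_ifs
    · exact (Algebra.commutes _ _).symm
    · simp
  rw [OpenChain.dressedD, OpenChain.dressedD, List.ofFn_eq_map, List.ofFn_eq_map]
  refine EntryIntertwine.list_prod _ fun j _ => .mul (.mul ?_ ?_) ?_
  · refine EntryIntertwine.list_prod _ fun b _ => ?_
    rw [List.ofFn_eq_map]
    exact EntryIntertwine.list_prod _ fun c _ => hs _ _ _
  · intro p q
    rw [onSite, onSite]
    split_ifs
    · exact EntryIntertwine.hatD h ħ k _ _ _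
    · simp
  · refine EntryIntertwine.list_prod _ fun b _ => ?_
    rw [List.ofFn_eq_map, ← List.map_reverse]
    exact EntryIntertwine.list_prod _ fun c _ => hs _ _ _

/-- Apart from entries of `D`, the trace formula contains complex numbers only, which commute with
g. -/
theorem EntryIntertwine.betheTrace {r : ℕ} {M : Fin r → ℕ} {g : B}
    {D D' : ℂ → Matrix (Fin (r + 1)) (Fin (r + 1)) B} (h : ∀ x, EntryIntertwine g (D x) (D' x))
    (ħ : ℂ) (π : (k : Fin r) → Equiv.Perm (Fin (M k))) (u : (k : Fin r) → Fin (M k) → ℂ) :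
    g * betheTrace ħ D M π u = betheTrace ħ D' M π u * g := by
  rw [betheTrace_eq, betheTrace_eq, List.ofFn_eq_map, List.ofFn_eq_map]
  exact EntryIntertwine.list_prod _ (fun k _ => EntryIntertwine.dressedD h ħ π u k) _ _

theorem exists_finRange_split (i : Fin m) : ∃ l₁ l₂ : List (Fin (m + 1)),
    List.finRange (m + 1) = l₁ ++ i.castSucc :: i.succ :: l₂ := by
  refine ⟨(List.finRange (m + 1)).take i, (List.finRange (m + 1)).drop (i + 2), ?_⟩
  conv_lhs => rw [← List.take_append_drop i (List.finRange (m + 1))]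
  congr 1
  rw [List.drop_eq_getElem_cons (by simp), List.drop_eq_getElem_cons (by simp)]
  simp only [List.getElem_finRange]
  rfl

theorem dressList_congr {ħ : ℂ} {a a' : Fin m → ℂ} (D : ℂ → Matrix (Fin n) (Fin n) A)
    {l : List (Fin m)} (h : ∀ c ∈ l, a c = a' c) : dressList ħ a D l = dressList ħ a' D l := by
  induction l with
  | nil => rfl
  | cons c l ih =>
    rw [dressList, dressList, h c List.mem_cons_self,
      ih fun c hc => h c (List.mem_cons_of_mem _ hc)]

/-- The braid matrix of c and c' commutes with everything dressed before (inside) and after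
(outside) these two spaces. It exchanges the parameters in the pair on the left, and also in the
pair on the right. -/
theorem dressList_exchange (ħ : ℂ) (a : Fin m → ℂ) (D : ℂ → Matrix (Fin n) (Fin n) A)
    {c c' : Fin m} (l₁ l₂ : List (Fin m)) (hl : (l₁ ++ c :: c' :: l₂).Nodup) (x : ℂ) :
    EntryIntertwine (braidR ħ A n c c' (a c - a c')) (dressList ħ a D (l₁ ++ c :: c' :: l₂) x)
      (dressList ħ (a ∘ Equiv.swap c c') D (l₁ ++ c :: c' :: l₂) x) := by
  induction l₁ with
  | nil =>
    simp only [List.nil_append, List.nodup_cons, List.mem_cons, not_or] at hl ⊢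
    obtain ⟨⟨hcc, hc⟩, hc', -⟩ := hl
    have e : dressList ħ (a ∘ Equiv.swap c c') D l₂ = dressList ħ a D l₂ :=
      dressList_congr D fun t ht => by
        rw [Function.comp, Equiv.swap_apply_of_ne_of_ne]
        · rintro rfl; exact hc ht
        · rintro rfl; exact hc' ht
    simp only [dressList, dress, e, Function.comp, Equiv.swap_apply_left, Equiv.swap_apply_right,
      ← fundR_eq]
    have h₁ : EntryIntertwine (braidR ħ A n c c' (a c - a c'))
        (fundR ħ A c (x + a c) * fundR ħ A c' (x + a c'))
        (fundR ħ A c (x + a c') * fundR ħ A c' (x + a c)) := fun i l => by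
      have := braidR_mul_fundR (A := A) hcc ħ (x + a c) (x + a c') i l
      rwa [add_sub_add_left_eq_sub] at this
    have h₂ : EntryIntertwine (braidR ħ A n c c' (a c - a c')) (dressList ħ a D l₂ x)
        (dressList ħ a D l₂ x) := fun i j => by
      have hcomm : ∀ t ∉ l₂, ∀ k k', Commute (dressList ħ a D l₂ x i j) (siteUnit A t k k') :=
        fun t ht => dressList_commute ħ a D ht x i j
      -- The permutation is a sum of products of matrix units of c and c', with which the inner part
      -- commutes.
      have hP : sitePerm A n (Equiv.swap c c') =
          ∑ j : Fin n, ∑ l : Fin n, siteUnit A c j l * siteUnit A c' l j := by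
        rw [Finset.sum_comm]
        simp only [sum_siteUnit_mul_siteUnit hcc]
        rw [← Finset.sum_mul, (siteUnit_isMatrixUnits c').sum, one_mul]
      have : Commute (dressList ħ a D l₂ x i j) (sitePerm A n (Equiv.swap c c')) := by
        rw [hP]
        exact Commute.sum_right _ _ _ fun p _ => Commute.sum_right _ _ _ fun q _ =>
          (hcomm c hc _ _).mul_right (hcomm c' hc' _ _)
      exact ((this.smul_right _).sub_right ((Commute.one_right _).smul_right ħ)).symm
    -- On the right the order of the spaces is reversed and the parameters enter with a minus sign;
    -- the two reversals cancel in the argument of the braid matrix.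
    have h₃ : EntryIntertwine (braidR ħ A n c c' (a c - a c'))
        (fundR ħ A c' (x - a c') * fundR ħ A c (x - a c))
        (fundR ħ A c' (x - a c) * fundR ħ A c (x - a c')) := fun i l => by
      have := braidR_mul_fundR (A := A) (Ne.symm hcc) ħ (x - a c') (x - a c) i l
      rwa [sub_sub_sub_cancel_left, braidR_comm] at this
    have := (h₁.mul h₂).mul h₃
    simpa only [Matrix.mul_assoc] using this
  | cons t l₁ ih =>
    rw [List.cons_append, List.nodup_cons] at hl
    have htc : t ≠ c := by rintro rfl; exact hl.1 (by simp)
    have htc' : t ≠ c' := by rintro rfl; exact hl.1 (by simp)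
    have ht : ∀ y, EntryIntertwine (braidR ħ A n c c' (a c - a c')) (unitR ħ (siteUnit A t) y)
        (unitR ħ (siteUnit A t) y) := fun y i j =>
      unitR_commute (fun k l => braidR_commute_siteUnit htc htc' ħ _ k l) ħ y i j
    simp only [List.cons_append, dressList, dress, Function.comp,
      Equiv.swap_apply_of_ne_of_ne htc htc']
    exact ((ht _).mul (ih hl.2)).mul (ht _)

end Exchange


/-! ### Symmetry and recursion -/

noncomputable section Symmetry

variable {r : ℕ} {A V : Type*} [Ring A] [Algebra ℂ A] [AddCommGroup V] [Module ℂ V] [Module A V]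
  [IsScalarTower ℂ A V] {ħ : ℂ} {S : Set ℂ} {W : Submodule ℂ V}

/-- Creation operators may be exchanged on vectors of `W` only, so the vector to which the rows B̂
are applied has to be located in `W`. -/
theorem betheTrace_smul_mem {D : ℂ → Matrix (Fin (r + 1)) (Fin (r + 1)) A}
    (hD : ReflData ħ D W S) {M : Fin r → ℕ} {u : (k : Fin r) → Fin (M k) → ℂ}
    (hu : RegPts ħ S M u) {w : V} (hw : w ∈ W) : betheTrace ħ D M (fun _ => 1) u • w ∈ W := by
  rw [betheTrace_eq, entry_smul]
  refine mem_piSub.1 (list_prod_smul_mem (P := piSub _ W) _ (fun X hX F hF => ?_) _ ?_) _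
  · obtain ⟨k, rfl⟩ := (List.mem_ofFn' _ _).1 hX
    refine list_prod_smul_mem _ (fun X hX F hF => ?_) F hF
    obtain ⟨j, rfl⟩ := (List.mem_ofFn' _ _).1 hX
    rw [mul_smul, mul_smul]
    refine rBar_smul_mem k j ?_
    have h := rProd_smul_mem (A := A) (ħ := ħ) (u := u) k j hF
    rw [mem_piSub] at h ⊢
    intro p
    rw [onSite_smul_apply]
    refine W.sum_mem fun q _ => ?_
    have hx := hu.mem k j
    rw [hatD]
    split_ifs
    · rw [add_smul, Finset.sum_smul]
      refine W.add_mem (hD.smul_mem _ hx _ _ _ (h _)) (W.sum_mem fun a _ => ?_)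
      split_ifs
      · rw [smul_assoc]; exact W.smul_mem _ (hD.smul_mem _ hx _ _ _ (h _))
      · simp
    · rw [add_zero]; exact hD.smul_mem _ hx _ _ _ (h _)
    · simp
  · rw [mem_piSub]
    intro p
    rw [Pi.single_apply]
    split_ifs
    · exact hw
    · exact W.zero_mem

variable {m : ℕ}

/-- The product of the rows `B̂` applied to a vector. -/
def rowB (ħ : ℂ) (D : ℂ → Matrix (Fin (r + 2)) (Fin (r + 2)) A) (a : Fin m → ℂ)
    (v : (Fin m → Fin (r + 1)) → V) : V :=
  ∑ p : Fin m → Fin (r + 1), ((List.finRange m).map fun c => hatB ħ D (a c) (p c)).prod • v p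

theorem contractB_smul_eq (D : ℂ → Matrix (Fin (r + 2)) (Fin (r + 2)) A) (a : Fin m → ℂ)
    (X : Matrix (Fin m → Fin (r + 1)) (Fin m → Fin (r + 1)) A) (w : V) :
    contractB ħ D a X • w = rowB ħ D a (X • highestTensor m r w) := by
  rw [contractB_smul, rowB]
  simp only [List.ofFn_eq_map]

theorem listB_smul_mem {D : ℂ → Matrix (Fin (r + 2)) (Fin (r + 2)) A} (hD : ReflData ħ D W S)
    {a : Fin m → ℂ} (ha : ∀ c, a c + ħ / 2 ∈ S) (p : Fin m → Fin (r + 1)) (l : List (Fin m)) :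
    ∀ w ∈ W, (l.map fun c => hatB ħ D (a c) (p c)).prod • w ∈ W := by
  refine list_prod_smul_mem _ fun X hX w hw => ?_
  obtain ⟨c, -, rfl⟩ := List.mem_map.1 hX
  exact hD.smul_mem _ (ha c) _ _ _ hw

/-- The exchange relation of two creation operators, read as a statement on rows: the term with
interchanged indices is the permutation acting on the components of v. -/
theorem rowB_exchange {D : ℂ → Matrix (Fin (r + 2)) (Fin (r + 2)) A} (hD : ReflData ħ D W S)
    {a : Fin (m + 1) → ℂ} (ha : ∀ c, a c + ħ / 2 ∈ S) (i : Fin m)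
    {v : (Fin (m + 1) → Fin (r + 1)) → V} (hv : v ∈ piSub _ W) :
    (a i.castSucc - a i.succ - ħ) • rowB ħ D a v =
      rowB ħ D (a ∘ Equiv.swap i.castSucc i.succ)
        (braidR ħ A (r + 1) i.castSucc i.succ (a i.castSucc - a i.succ) • v) := by
  obtain ⟨l₁, l₂, hl⟩ := exists_finRange_split i
  have hnd := List.nodup_finRange (m + 1)
  rw [hl] at hnd
  set c := i.castSucc with hc
  set c' := i.succ with hc'
  have hcl₁ : c ∉ l₁ := fun h => by
    have := (List.nodup_append.1 hnd).2.2 _ h c (by simp); exact this rfl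
  have hcl₁' : c' ∉ l₁ := fun h => by
    have := (List.nodup_append.1 hnd).2.2 _ h c' (by simp); exact this rfl
  have h₂ := (List.nodup_append.1 hnd).2.1
  simp only [List.nodup_cons, List.mem_cons, not_or] at h₂
  have hswap : ∀ (l : List (Fin (m + 1))), c ∉ l → c' ∉ l → ∀ p p' : Fin (m + 1) → Fin (r + 1),
      (∀ t, t ≠ c → t ≠ c' → p t = p' t) →
      l.map (fun t => hatB ħ D ((a ∘ Equiv.swap c c') t) (p' t)) =
        l.map fun t => hatB ħ D (a t) (p t) := by
    intro l hcl hcl' p p' hpp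
    refine List.map_congr_left fun t ht => ?_
    have h : t ≠ c := by rintro rfl; exact hcl ht
    have h' : t ≠ c' := by rintro rfl; exact hcl' ht
    rw [Function.comp, Equiv.swap_apply_of_ne_of_ne h h', hpp t h h']
  have hsmul : braidR ħ A (r + 1) c c' (a c - a c') • v =
      (a c - a c') • (sitePerm A (r + 1) (Equiv.swap c c') • v) - ħ • v := by
    rw [braidR, sub_smul, smul_assoc, smul_assoc, one_smul]
  have hlin : rowB ħ D (a ∘ Equiv.swap c c')
      ((a c - a c') • (sitePerm A (r + 1) (Equiv.swap c c') • v) - ħ • v) =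
      (a c - a c') • rowB ħ D (a ∘ Equiv.swap c c') (sitePerm A (r + 1) (Equiv.swap c c') • v) -
        ħ • rowB ħ D (a ∘ Equiv.swap c c') v := by
    simp only [rowB, Pi.sub_apply, Pi.smul_apply, smul_sub, Finset.sum_sub_distrib,
      Finset.smul_sum, smul_smul_comm_of_tower]
  have hperm : rowB ħ D (a ∘ Equiv.swap c c') (sitePerm A (r + 1) (Equiv.swap c c') • v) =
      ∑ p : Fin (m + 1) → Fin (r + 1), ((List.finRange (m + 1)).map fun t =>
        hatB ħ D ((a ∘ Equiv.swap c c') t) ((p ∘ Equiv.swap c c') t)).prod • v p := by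
    rw [rowB]
    refine Fintype.sum_equiv (Equiv.arrowCongr (Equiv.swap c c') (Equiv.refl _)) _ _ fun p => ?_
    have e : Equiv.arrowCongr (Equiv.swap c c') (Equiv.refl _) p = p ∘ Equiv.swap c c' := by
      funext t; simp [Equiv.arrowCongr]
    rw [sitePerm_smul_apply, e]
    congr 3
    funext t
    simp
  rw [hsmul, hlin, hperm]
  simp only [rowB, Finset.smul_sum]
  rw [← Finset.sum_sub_distrib]
  refine Finset.sum_congr rfl fun p _ => ?_
  rw [hl]
  simp only [List.map_append, List.map_cons, List.prod_append, List.prod_cons, mul_smul]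
  rw [hswap l₁ hcl₁ hcl₁' p (p ∘ Equiv.swap c c')
      (fun t h h' => by simp [Equiv.swap_apply_of_ne_of_ne h h']),
    hswap l₁ hcl₁ hcl₁' p p (fun _ _ _ => rfl),
    hswap l₂ (fun h => h₂.1.2 h) h₂.2.1 p (p ∘ Equiv.swap c c')
      (fun t h h' => by simp [Equiv.swap_apply_of_ne_of_ne h h']),
    hswap l₂ (fun h => h₂.1.2 h) h₂.2.1 p p (fun _ _ _ => rfl)]
  have hw := listB_smul_mem hD ha p l₂ (v p) (mem_piSub.1 hv p)
  generalize (l₂.map fun t => hatB ħ D (a t) (p t)).prod • v p = w at hw ⊢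
  have key := hD.creation_comm hw (ha c) (ha c') (p c) (p c')
  have hsc := smul_smul_comm_of_tower (A := A) (V := V)
  simp only [Function.comp, Equiv.swap_apply_left, Equiv.swap_apply_right, hatB]
  have := congrArg (fun v => (l₁.map fun t => hatB ħ D (a t) (p t)).prod • v) key
  simp only [smul_sub, hsc, add_sub_add_right_eq_sub, hatB] at this
  exact this

/-- The vector on the right of the recursion, as a function of the parameters of the first
level. -/
def recVec (ħ : ℂ) (D : ℂ → Matrix (Fin (r + 2)) (Fin (r + 2)) A) (M : Fin r → ℕ)
    (u : (k : Fin r) → Fin (M k) → ℂ) (Ω : V) (a : Fin m → ℂ) : V :=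
  rowB ħ D a (betheTrace ħ (psiGen ħ a D) M (fun _ => 1) u • highestTensor m r Ω)

theorem RegPts.congr_psiSet {M : Fin r → ℕ} {u : (k : Fin r) → Fin (M k) → ℂ} {a : Fin m → ℂ}
    (h : RegPts ħ (psiSet ħ a S) M u) (σ : Equiv.Perm (Fin m)) :
    RegPts ħ (psiSet ħ (a ∘ σ) S) M u :=
  { h with mem := fun k j => ⟨(h.mem k j).1, fun c => (h.mem k j).2 (σ c)⟩ }

/-- The braid matrix released by the two rows passes through the trace formula of D', swapping the
parameters there. It then meets e_2^{⊗m}, where P = 1 and its value is a_i - a_{i+1} - ħ. This is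
the factor on the other side, and it can be cancelled. -/
theorem recVec_swap_of_ne {D : ℂ → Matrix (Fin (r + 2)) (Fin (r + 2)) A} (hD : ReflData ħ D W S)
    {M : Fin r → ℕ} {u : (k : Fin r) → Fin (M k) → ℂ} {a : Fin (m + 1) → ℂ}
    (ha : ∀ c, a c + ħ / 2 ∈ S) (hu : RegPts ħ (psiSet ħ a S) M u) {Ω : V}
    (hΩ : IsHighest D W S Ω) (i : Fin m) (h : a i.castSucc - a i.succ ≠ ħ) :
    recVec ħ D M u Ω (a ∘ Equiv.swap i.castSucc i.succ) = recVec ħ D M u Ω a := by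
  obtain ⟨l₁, l₂, hl⟩ := exists_finRange_split i
  have hg : ∀ x, EntryIntertwine
      (braidR ħ A (r + 1) i.castSucc i.succ (a i.castSucc - a i.succ)) (psiGen ħ a D x)
      (psiGen ħ (a ∘ Equiv.swap i.castSucc i.succ) D x) := fun x => by
    rw [psiGen_eq, psiGen_eq, hl]
    exact dressList_exchange ħ a _ l₁ l₂ (hl ▸ List.nodup_finRange _) x
  have hmem : betheTrace ħ (psiGen ħ a D) M (fun _ => 1) u • highestTensor (m + 1) r Ω ∈
      piSub _ W := by
    have := betheTrace_smul_mem (hD.psiGen a) hu (hΩ.psiGen (ħ := ħ) a).mem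
    rw [mem_piSub] at this ⊢
    exact fun p => (this p).1
  have hfix : sitePerm A (r + 1) (Equiv.swap i.castSucc i.succ) • highestTensor (m + 1) r Ω =
      highestTensor (m + 1) r Ω := by
    funext p
    rw [sitePerm_smul_apply, highestTensor_apply, highestTensor_apply]
    refine if_congr ?_ rfl rfl
    constructor
    · intro hp; funext t
      simpa using congrFun hp (Equiv.swap i.castSucc i.succ t)
    · rintro rfl; rfl
  have hfix' : braidR ħ A (r + 1) i.castSucc i.succ (a i.castSucc - a i.succ) •
      highestTensor (m + 1) r Ω = (a i.castSucc - a i.succ - ħ) • highestTensor (m + 1) r Ω := by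
    rw [braidR, sub_smul, smul_assoc, smul_assoc, one_smul, hfix]
    exact (sub_smul _ _ _).symm
  have key := rowB_exchange hD ha i hmem
  rw [← mul_smul, EntryIntertwine.betheTrace hg, mul_smul, hfix',
    smul_smul_comm_of_tower] at key
  have hlin : ∀ (c : ℂ) (a : Fin (m + 1) → ℂ) (v : (Fin (m + 1) → Fin (r + 1)) → V),
      rowB ħ D a (c • v) = c • rowB ħ D a v := fun c a v => by
    simp only [rowB, Pi.smul_apply, Finset.smul_sum, smul_smul_comm_of_tower]
  rw [hlin] at key
  exact (smul_right_injective V (sub_ne_zero.2 h) key).symm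

theorem recVec_swap {D : ℂ → Matrix (Fin (r + 2)) (Fin (r + 2)) A} (hD : ReflData ħ D W S)
    {M : Fin r → ℕ} {u : (k : Fin r) → Fin (M k) → ℂ} {a : Fin (m + 1) → ℂ}
    (ha : ∀ c, a c + ħ / 2 ∈ S) (hu : RegPts ħ (psiSet ħ a S) M u) {Ω : V}
    (hΩ : IsHighest D W S Ω) (i : Fin m) :
    recVec ħ D M u Ω (a ∘ Equiv.swap i.castSucc i.succ) = recVec ħ D M u Ω a := by
  by_cases h : a i.castSucc - a i.succ = ħ
  · by_cases hħ : ħ = 0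
    · congr 1
      funext t
      rw [hħ, sub_eq_zero] at h
      simp only [Function.comp, Equiv.swap_apply_def]
      split_ifs with h₁ h₂
      · rw [h₁, h]
      · rw [h₂, h]
      · rfl
    -- When the difference is ħ, the opposite difference is -ħ ≠ ħ, so the swap is applied to the
    -- swapped parameters and read backwards; for ħ = 0 the two parameters coincide.
    · have := recVec_swap_of_ne hD (a := a ∘ Equiv.swap i.castSucc i.succ)
        (fun c => ha _) (hu.congr_psiSet _) hΩ i (by
          simp only [Function.comp, Equiv.swap_apply_left, Equiv.swap_apply_right]
          intro h'
          apply hħ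
          linear_combination (-1 / 2) * h - (1 / 2) * h')
      rw [← this]
      congr 1
      funext t
      simp
  · exact recVec_swap_of_ne hD ha hu hΩ i h

theorem recVec_perm {D : ℂ → Matrix (Fin (r + 2)) (Fin (r + 2)) A} (hD : ReflData ħ D W S)
    {M : Fin r → ℕ} {u : (k : Fin r) → Fin (M k) → ℂ} {Ω : V}
    (hΩ : IsHighest D W S Ω) {m : ℕ} {a : Fin m → ℂ} (ha : ∀ c, a c + ħ / 2 ∈ S)
    (hu : RegPts ħ (psiSet ħ a S) M u) (σ : Equiv.Perm (Fin m)) :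
    recVec ħ D M u Ω (a ∘ σ) = recVec ħ D M u Ω a := by
  cases m with
  | zero => congr 1; funext t; exact t.elim0
  | succ m =>
    have hσ : σ ∈ Submonoid.closure
        (Set.range fun i : Fin m => Equiv.swap i.castSucc i.succ) := by
      rw [Equiv.Perm.mclosure_swap_castSucc_succ]; trivial
    induction hσ using Submonoid.closure_induction generalizing a with
    | mem σ h => obtain ⟨i, rfl⟩ := h; exact recVec_swap hD ha hu hΩ i
    | one => rfl
    | mul σ τ _ _ hσ hτ =>
      have : a ∘ (σ * τ : Equiv.Perm (Fin (m + 1))) = (a ∘ σ) ∘ τ := rfl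
      rw [this, hτ (a := a ∘ σ) (fun c => ha _) (hu.congr_psiSet σ), hσ ha hu]

theorem RegPts.perm {M : Fin r → ℕ} {u : (k : Fin r) → Fin (M k) → ℂ} (h : RegPts ħ S M u)
    (π : (k : Fin r) → Equiv.Perm (Fin (M k))) : RegPts ħ S M fun k j => u k (π k j) where
  mem k _ := h.mem k _
  two_ne k _ := h.two_ne k _
  add_ne k b _ _ := h.add_ne k b _ _
  sub_ne k b _ _ := h.sub_ne k b _ _

end Symmetry

/-- The trace formula agrees with the recursive form on a highest weight vector, and is
symmetric. -/
theorem betheTrace_eq_betheRec_and_symm {ħ : ℂ} (r : ℕ) : ∀ {A V : Type*} [Ring A] [Algebra ℂ A]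
    [AddCommGroup V] [Module ℂ V] [Module A V] [IsScalarTower ℂ A V] {S : Set ℂ}
    {W : Submodule ℂ V} {D : ℂ → Matrix (Fin (r + 1)) (Fin (r + 1)) A} (_ : ReflData ħ D W S)
    {M : Fin r → ℕ} {u : (k : Fin r) → Fin (M k) → ℂ} (_ : RegPts ħ S M u) {Ω : V}
    (_ : IsHighest D W S Ω), betheTrace ħ D M (fun _ => 1) u • Ω = betheRec ħ r D M u • Ω ∧
      ∀ π : (k : Fin r) → Equiv.Perm (Fin (M k)),
        betheTrace ħ D M (fun _ => 1) (fun k j => u k (π k j)) • Ω =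
          betheTrace ħ D M (fun _ => 1) u • Ω := by
  induction r with
  | zero =>
    intro A V _ _ _ _ _ _ S W D hD M u hu Ω hΩ
    have h : ∀ u : (k : Fin 0) → Fin (M k) → ℂ, betheTrace ħ D M (fun _ => 1) u = 1 := fun u => by
      rw [betheTrace_eq, List.ofFn_zero, List.prod_nil, Matrix.one_apply, if_pos]
      funext s
      exact s.1.elim0
    exact ⟨by rw [h]; rfl, fun π => by rw [h, h]⟩
  | succ r ih =>
    intro A V _ _ _ _ _ _ S W D hD M u hu Ω hΩ
    have hrec : ∀ u (_ : RegPts ħ S M u), betheTrace ħ D M (fun _ => 1) u • Ω =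
        recVec ħ D (fun k => M k.succ) (fun k => u k.succ) Ω (u 0) := fun u hu => by
      rw [betheTrace_smul hD hu hΩ, contractB_smul_eq]; rfl
    -- The induction hypothesis is used for operators on the first-level spaces with coefficients in
    -- `A`, for vectors with values in `hwSub`; this is why algebra, module and subspace are
    -- quantified inside the induction.
    have ih' := ih (hD.psiGen (u 0)) hu.succ (hΩ.psiGen (u 0))
    refine ⟨?_, fun π => ?_⟩
    · rw [hrec u hu, recVec, ih'.1, ← contractB_smul_eq]
      rfl
    · have hp := hu.perm π
      rw [hrec _ hp, hrec u hu]
      have h₁ := recVec_perm hD hΩ (a := u 0) (M := fun k => M k.succ)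
        (u := fun k j => u k.succ (π k.succ j)) (fun c => by simpa using hu.mem 0 c)
        (hu.succ.perm fun k => π k.succ) (π 0)
      have h₂ : recVec ħ D (fun k => M k.succ) (fun k j => u k.succ (π k.succ j)) Ω (u 0) =
          recVec ħ D (fun k => M k.succ) (fun k => u k.succ) Ω (u 0) := by
        rw [recVec, ih'.2 fun k => π k.succ]
        rfl
      exact h₁.trans h₂


/-! ### Polynomial monodromy matrices -/

noncomputable section Monodromy

/-- The RTT relations for the coefficients of `∑ u^{d-m} τ_m`. -/
structure RttCoeffs {n : ℕ} {A : Type*} [Ring A] [Algebra ℂ A] (ħ : ℂ) (d : ℕ) (f₀ : ℂ)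
    (τ : ℕ → Matrix (Fin n) (Fin n) A) : Prop where
  ne_zero : f₀ ≠ 0
  zero : τ 0 = f₀ • 1
  vanish : ∀ m, d < m → τ m = 0
  comm : ∀ r s i j k l, τ (r + 1) i j * τ s k l - τ s k l * τ (r + 1) i j -
    (τ r i j * τ (s + 1) k l - τ (s + 1) k l * τ r i j) =
      ħ • (τ r k j * τ s i l - τ s k j * τ r i l)

/-- The polynomial `∑ u^{d-m} τ_m`. -/
def polyT {n : ℕ} {A : Type*} [Ring A] [Algebra ℂ A] (d : ℕ) (τ : ℕ → Matrix (Fin n) (Fin n) A)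
    (u : ℂ) : Matrix (Fin n) (Fin n) A :=
  ∑ m ∈ Finset.range (d + 1), u ^ (d - m) • τ m

section Coefficients

variable {n : ℕ} {A : Type*} [Ring A] [Algebra ℂ A]

theorem polyT_apply (d : ℕ) (τ : ℕ → Matrix (Fin n) (Fin n) A) (u : ℂ) (i j : Fin n) :
    polyT d τ u i j = ∑ m ∈ Finset.range (d + 1), u ^ (d - m) • τ m i j := by
  simp [polyT, Matrix.sum_apply]

/-- Multiplication by x or y shifts the index of the coefficients. The boundary terms disappear: τ_0
is scalar and drops out of commutators, and τ_{d+1} = 0. -/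
theorem RttCoeffs.rtt {ħ f₀ : ℂ} {d : ℕ} {τ : ℕ → Matrix (Fin n) (Fin n) A}
    (h : RttCoeffs ħ d f₀ τ) (x y : ℂ) :
    rMat ħ n A (x - y) * leg₁ (polyT d τ x) * leg₂ (polyT d τ y) =
      leg₂ (polyT d τ y) * leg₁ (polyT d τ x) * rMat ħ n A (x - y) := by
  rw [rtt_iff]
  intro i j k l
  set c : ℕ → ℕ → A := fun m m' => τ m i j * τ m' k l - τ m' k l * τ m i j with hc
  have hexp : ∀ (x y : ℂ) (i j k l : Fin n), polyT d τ x i j * polyT d τ y k l =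
      ∑ m ∈ Finset.range (d + 1), ∑ m' ∈ Finset.range (d + 1),
        (x ^ (d - m) * y ^ (d - m')) • (τ m i j * τ m' k l) := by
    intro x y i j k l
    rw [polyT_apply, polyT_apply, Finset.sum_mul_sum]
    simp only [smul_mul_smul_comm]
  have hexp' : ∀ (x y : ℂ) (i j k l : Fin n), polyT d τ y k l * polyT d τ x i j =
      ∑ m ∈ Finset.range (d + 1), ∑ m' ∈ Finset.range (d + 1),
        (x ^ (d - m) * y ^ (d - m')) • (τ m' k l * τ m i j) := by
    intro x y i j k l
    rw [hexp, Finset.sum_comm]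
    simp only [mul_comm]
  have hc0 : ∀ m', c 0 m' = 0 := fun m' => by
    simp only [hc, h.zero, Matrix.smul_apply, Matrix.one_apply]
    split_ifs <;> simp
  have hc0' : ∀ m, c m 0 = 0 := fun m => by
    simp only [hc, h.zero, Matrix.smul_apply, Matrix.one_apply]
    split_ifs <;> simp
  have hcd : ∀ m', c (d + 1) m' = 0 := fun m' => by
    simp [hc, h.vanish (d + 1) (Nat.lt_succ_self d)]
  have hcd' : ∀ m, c m (d + 1) = 0 := fun m => by
    simp [hc, h.vanish (d + 1) (Nat.lt_succ_self d)]
  have shift : ∀ (x : ℂ) (g : ℕ → A), g 0 = 0 → g (d + 1) = 0 →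
      x • ∑ m ∈ Finset.range (d + 1), x ^ (d - m) • g m =
        ∑ m ∈ Finset.range (d + 1), x ^ (d - m) • g (m + 1) := by
    intro x g h0 h1
    rw [Finset.sum_range_succ', Finset.sum_range_succ, h0, h1, smul_zero, smul_zero, add_zero,
      add_zero, Finset.smul_sum]
    refine Finset.sum_congr rfl fun m hm => ?_
    rw [smul_smul, ← pow_succ', show d - (m + 1) + 1 = d - m by
      have := Finset.mem_range.1 hm; omega]
  have hcomm : polyT d τ x i j * polyT d τ y k l - polyT d τ y k l * polyT d τ x i j =
      ∑ m ∈ Finset.range (d + 1), x ^ (d - m) •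
        ∑ m' ∈ Finset.range (d + 1), y ^ (d - m') • c m m' := by
    rw [hexp, hexp', ← Finset.sum_sub_distrib]
    refine Finset.sum_congr rfl fun m _ => ?_
    rw [← Finset.sum_sub_distrib, Finset.smul_sum]
    refine Finset.sum_congr rfl fun m' _ => ?_
    rw [smul_smul, hc, smul_sub]
  have h₁ := shift x (fun m => ∑ m' ∈ Finset.range (d + 1), y ^ (d - m') • c m m')
    (by simp [hc0]) (by simp [hcd])
  have h₂ : ∀ m, y • ∑ m' ∈ Finset.range (d + 1), y ^ (d - m') • c m m' =
      ∑ m' ∈ Finset.range (d + 1), y ^ (d - m') • c m (m' + 1) := fun m =>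
    shift y (c m) (hc0' m) (hcd' m)
  rw [sub_smul, hcomm, h₁, hexp, hexp' x y i l k j, ← Finset.sum_sub_distrib, Finset.smul_sum,
    Finset.smul_sum, ← Finset.sum_sub_distrib]
  refine Finset.sum_congr rfl fun m _ => ?_
  rw [smul_comm, h₂, ← smul_sub, ← Finset.sum_sub_distrib, Finset.smul_sum,
    ← Finset.sum_sub_distrib, Finset.smul_sum]
  refine Finset.sum_congr rfl fun m' _ => ?_
  rw [← smul_sub, smul_smul, hc, h.comm, ← smul_sub, smul_comm]

/-- `T⁻¹(-u)`. -/
def invT (d : ℕ) (τ : ℕ → Matrix (Fin n) (Fin n) A) (u : ℂ) : Matrix (Fin n) (Fin n) A :=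
  Ring.inverse (polyT d τ (-u))

/-- The points at which `T⁻¹(-u)` exists. -/
def invSet (d : ℕ) (τ : ℕ → Matrix (Fin n) (Fin n) A) : Set ℂ := {x | IsUnit (polyT d τ (-x))}

/-- Conjugation by P interchanges the two spaces and commutes with R. -/
theorem permP_conj {R X X' Y Y' : Matrix (Fin n × Fin n) (Fin n × Fin n) A}
    (hR : permP A n * R = R * permP A n) (hX : permP A n * X = X' * permP A n)
    (hY : permP A n * Y = Y' * permP A n) (h : R * X * Y = Y * X * R) :
    R * X' * Y' = Y' * X' * R := by
  have h₁ : permP A n * (R * X * Y) = R * X' * Y' * permP A n := by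
    rw [← mul_assoc, ← mul_assoc, hR, mul_assoc R, hX, mul_assoc, mul_assoc, hY]
    simp only [mul_assoc]
  have h₂ : permP A n * (Y * X * R) = Y' * X' * R * permP A n := by
    rw [← mul_assoc, ← mul_assoc, hY, mul_assoc Y', hX, mul_assoc, mul_assoc, hR]
    simp only [mul_assoc]
  have h₃ := congrArg (fun Z => permP A n * Z * permP A n) h
  rw [h₁, h₂, mul_assoc, mul_assoc _ (permP A n), permP_mul_permP, mul_one, mul_one] at h₃
  exact h₃

theorem RttCoeffs.rtt_swap {ħ f₀ : ℂ} {d : ℕ} {τ : ℕ → Matrix (Fin n) (Fin n) A}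
    (h : RttCoeffs ħ d f₀ τ) (x y : ℂ) :
    rMat ħ n A (x - y) * leg₂ (polyT d τ x) * leg₁ (polyT d τ y) =
      leg₁ (polyT d τ y) * leg₂ (polyT d τ x) * rMat ħ n A (x - y) :=
  permP_conj (rMat_comm_permP ħ _) (permP_mul_leg₁ _) (permP_mul_leg₂ _) (h.rtt x y)

/-- The RTT relation at arguments y and -x, multiplied from both sides by the inverse of T₁(-x). -/
theorem RttCoeffs.cross {ħ f₀ : ℂ} {d : ℕ} {τ : ℕ → Matrix (Fin n) (Fin n) A}
    (h : RttCoeffs ħ d f₀ τ) {x : ℂ} (hx : x ∈ invSet d τ) (y : ℂ) :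
    leg₁ (invT d τ x) * rMat ħ n A (x + y) * leg₂ (polyT d τ y) =
      leg₂ (polyT d τ y) * rMat ħ n A (x + y) * leg₁ (invT d τ x) := by
  have hx₁ : leg₁ (invT d τ x) * leg₁ (polyT d τ (-x)) = 1 := by
    rw [← leg₁_mul, invT, Ring.inverse_mul_cancel _ hx, leg₁_one]
  have hx₁' : leg₁ (polyT d τ (-x)) * leg₁ (invT d τ x) = 1 := by
    rw [← leg₁_mul, invT, Ring.mul_inverse_cancel _ hx, leg₁_one]
  have := h.rtt_swap y (-x)
  rw [show y - -x = x + y by ring] at this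
  calc leg₁ (invT d τ x) * rMat ħ n A (x + y) * leg₂ (polyT d τ y)
      = leg₁ (invT d τ x) * (rMat ħ n A (x + y) * leg₂ (polyT d τ y) *
          leg₁ (polyT d τ (-x))) * leg₁ (invT d τ x) := by
        simp only [mul_assoc, hx₁', mul_one]
    _ = (leg₁ (invT d τ x) * leg₁ (polyT d τ (-x))) * leg₂ (polyT d τ y) *
          rMat ħ n A (x + y) * leg₁ (invT d τ x) := by
        rw [this]; simp only [mul_assoc]
    _ = _ := by rw [hx₁, one_mul]

theorem RttCoeffs.exchangeRel {ħ f₀ : ℂ} {d : ℕ} {τ : ℕ → Matrix (Fin n) (Fin n) A}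
    (h : RttCoeffs ħ d f₀ τ) {x y : ℂ} (hx : x ∈ invSet d τ) (hy : y ∈ invSet d τ) :
    ExchangeRel ħ (polyT d τ) (invT d τ) x y := by
  have hx₁ : leg₁ (invT d τ x) * leg₁ (polyT d τ (-x)) = 1 := by
    rw [← leg₁_mul, invT, Ring.inverse_mul_cancel _ hx, leg₁_one]
  have hx₁' : leg₁ (polyT d τ (-x)) * leg₁ (invT d τ x) = 1 := by
    rw [← leg₁_mul, invT, Ring.mul_inverse_cancel _ hx, leg₁_one]
  have hy₂ : leg₂ (invT d τ y) * leg₂ (polyT d τ (-y)) = 1 := by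
    rw [← leg₂_mul, invT, Ring.inverse_mul_cancel _ hy, leg₂_one]
  have hy₂' : leg₂ (polyT d τ (-y)) * leg₂ (invT d τ y) = 1 := by
    rw [← leg₂_mul, invT, Ring.mul_inverse_cancel _ hy, leg₂_one]
  refine ⟨h.rtt x y, h.cross hx y, ?_, ?_⟩
  · have := h.rtt x (-y)
    rw [sub_neg_eq_add] at this
    calc leg₁ (polyT d τ x) * rMat ħ n A (x + y) * leg₂ (invT d τ y)
        = (leg₂ (invT d τ y) * leg₂ (polyT d τ (-y))) * leg₁ (polyT d τ x) *
            rMat ħ n A (x + y) * leg₂ (invT d τ y) := by rw [hy₂, one_mul]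
      _ = leg₂ (invT d τ y) * (leg₂ (polyT d τ (-y)) * leg₁ (polyT d τ x) *
            rMat ħ n A (x + y)) * leg₂ (invT d τ y) := by simp only [mul_assoc]
      _ = leg₂ (invT d τ y) * rMat ħ n A (x + y) * leg₁ (polyT d τ x) *
            (leg₂ (polyT d τ (-y)) * leg₂ (invT d τ y)) := by
          rw [← this]; simp only [mul_assoc]
      _ = _ := by rw [hy₂', mul_one]
  · have := h.rtt_swap (-y) (-x)
    rw [show -y - -x = x - y by ring] at this
    calc rMat ħ n A (x - y) * leg₁ (invT d τ x) * leg₂ (invT d τ y)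
        = leg₂ (invT d τ y) * ((leg₁ (invT d τ x) * leg₁ (polyT d τ (-x))) *
            leg₂ (polyT d τ (-y))) * rMat ħ n A (x - y) * leg₁ (invT d τ x) *
            leg₂ (invT d τ y) := by rw [hx₁, one_mul, hy₂, one_mul]
      _ = leg₂ (invT d τ y) * leg₁ (invT d τ x) * (leg₁ (polyT d τ (-x)) *
            leg₂ (polyT d τ (-y)) * rMat ħ n A (x - y)) * leg₁ (invT d τ x) *
            leg₂ (invT d τ y) := by simp only [mul_assoc]
      _ = leg₂ (invT d τ y) * leg₁ (invT d τ x) * rMat ħ n A (x - y) *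
            (leg₂ (polyT d τ (-y)) * ((leg₁ (polyT d τ (-x)) * leg₁ (invT d τ x)) *
            leg₂ (invT d τ y))) := by
          rw [← this]; simp only [mul_assoc]
      _ = _ := by rw [hx₁', one_mul, hy₂', mul_one]

/-- For a diagonal matrix with scalar entries the equation reduces to one scalar identity for each
pair of diagonal places. -/
theorem kMinus_refl (ħ : ℂ) (a : ℕ) (c x y : ℂ) :
    reflL ħ (fun x => (kMinus n a c x).map (algebraMap ℂ A)) x y =
      reflR ħ (fun x => (kMinus n a c x).map (algebraMap ℂ A)) x y := by
  set κ : ℂ → Fin n → ℂ := fun x i => if (i : ℕ) < a then x - c else -x - c with hκ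
  have hk : ∀ x, (kMinus n a c x).map (algebraMap ℂ A) =
      Matrix.diagonal fun i => κ x i • (1 : A) := fun x => by
    ext i j
    simp only [kMinus, Matrix.map_apply, Matrix.diagonal_apply, hκ]
    split_ifs <;> simp [Algebra.algebraMap_eq_smul_one]
  have key : ∀ i k, (x - y) * (κ x i * κ y i - κ x k * κ y k) +
      (x + y) * (κ x k * κ y i - κ y k * κ x i) = 0 := by
    intro i k
    simp only [hκ]
    split_ifs <;> ring
  have hcomm : ∀ x y i j k l, (kMinus n a c x).map (algebraMap ℂ A) i j *
      (kMinus n a c y).map (algebraMap ℂ A) k l = (kMinus n a c y).map (algebraMap ℂ A) k l *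
      (kMinus n a c x).map (algebraMap ℂ A) i j := fun x y i j k l => Algebra.commutes _ _
  have hcomm' : (kMinus n a c y).map (algebraMap ℂ A) * (kMinus n a c x).map (algebraMap ℂ A) =
      (kMinus n a c x).map (algebraMap ℂ A) * (kMinus n a c y).map (algebraMap ℂ A) := by
    rw [hk, hk, Matrix.diagonal_mul_diagonal, Matrix.diagonal_mul_diagonal]
    congr 1
    funext i
    rw [smul_mul_smul_comm, smul_mul_smul_comm, mul_comm]
  ext ⟨i, k⟩ ⟨j, l⟩
  rw [reflL_apply, reflR_apply, hcomm', hcomm y x k l i j]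
  have h : (x - y) • ((if k = j then ((kMinus n a c x).map (algebraMap ℂ A) *
        (kMinus n a c y).map (algebraMap ℂ A)) i l else 0) -
      (if i = l then ((kMinus n a c x).map (algebraMap ℂ A) *
        (kMinus n a c y).map (algebraMap ℂ A)) k j else 0)) +
      (x + y) • ((kMinus n a c x).map (algebraMap ℂ A) k j *
        (kMinus n a c y).map (algebraMap ℂ A) i l - (kMinus n a c y).map (algebraMap ℂ A) k j *
        (kMinus n a c x).map (algebraMap ℂ A) i l) = 0 := by
    rw [hk, hk, Matrix.diagonal_mul_diagonal]
    simp only [Matrix.diagonal_apply, smul_mul_smul_comm, mul_one]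
    by_cases hkj : k = j <;> by_cases hil : i = l <;> simp [hkj, hil]
    linear_combination (norm := module) (key l j) • (1 : A)
  linear_combination (norm := module) (-ħ) • h

end Coefficients

end Monodromy


/-! ### Weak continuity in finite-dimensional algebras -/

noncomputable section FiniteDimensional

variable {E : Type*} [Ring E] [Algebra ℂ E] {S : Set ℂ}

theorem weakContOn_complex {f : ℂ → ℂ} (hf : ContinuousOn f S) : WeakContOn f S := fun φ => by
  have : ∀ z : ℂ, φ z = z * φ 1 := fun z => by
    rw [← smul_eq_mul, ← map_smul, smul_eq_mul, mul_one]
  exact (hf.mul continuousOn_const).congr fun x _ => this _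

/-- Expanding the first factor in a finite basis gives scalar continuous coordinates times left
multiples of the second factor. -/
theorem WeakContOn.mul [Module.Finite ℂ E] {f g : ℂ → E} (hf : WeakContOn f S)
    (hg : WeakContOn g S) : WeakContOn (fun x => f x * g x) S := by
  let b := Module.finBasis ℂ E
  have h : ∀ x, f x * g x = ∑ i, b.coord i (f x) • (b i * g x) := fun x => by
    conv_lhs => rw [← b.sum_repr (f x), Finset.sum_mul]
    exact Finset.sum_congr rfl fun i _ => by rw [smul_mul_assoc, Module.Basis.coord_apply]
  simp only [h]
  exact WeakContOn.sum _ fun i _ => WeakContOn.smul (hf (b.coord i))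
    (hg.map (LinearMap.mulLeft ℂ (b i)))

theorem WeakContOn.list_prod [Module.Finite ℂ E] {β : Type*} {f : β → ℂ → E} (l : List β)
    (hf : ∀ b ∈ l, WeakContOn (f b) S) : WeakContOn (fun x => (l.map fun b => f b x).prod) S := by
  induction l with
  | nil => simpa using weakContOn_const 1
  | cons b l ih =>
    simp only [List.map_cons, List.prod_cons]
    exact (hf b List.mem_cons_self).mul (ih fun b hb => hf b (List.mem_cons_of_mem _ hb))

theorem WeakContOn.matrix {F : Type*} [AddCommGroup F] [Module ℂ F] {ι κ : Type*} [Fintype ι]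
    [Fintype κ] [DecidableEq ι] [DecidableEq κ] {f : ℂ → Matrix ι κ F}
    (hf : ∀ i j, WeakContOn (fun x => f x i j) S) : WeakContOn f S := by
  have : f = fun x => ∑ i, ∑ j, Matrix.singleLinearMap ℂ i j (f x i j) := by
    funext x
    exact Matrix.matrix_eq_sum_single (f x)
  rw [this]
  exact WeakContOn.sum _ fun i _ => WeakContOn.sum _ fun j _ => (hf i j).map _

variable {N : Type*} [Fintype N] [DecidableEq N]

/-- Through the matrix model the inverse is the adjugate divided by a nonvanishing determinant, both
polynomial in the entries. -/
theorem WeakContOn.ringInverse (Φ : E ≃ₐ[ℂ] Matrix N N ℂ) {f : ℂ → E} (hf : WeakContOn f S)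
    (hu : ∀ x ∈ S, IsUnit (f x)) : WeakContOn (fun x => Ring.inverse (f x)) S := by
  have hcont : ContinuousOn (fun x => Φ (f x)) S := by
    refine continuousOn_pi.2 fun i => continuousOn_pi.2 fun j => ?_
    exact hf (LinearMap.comp (Matrix.entryLinearMap ℂ ℂ i j) Φ.toLinearMap)
  have hdet : ∀ x ∈ S, (Φ (f x)).det ≠ 0 := fun x hx =>
    ((Matrix.isUnit_iff_isUnit_det _).1 ((hu x hx).map Φ)).ne_zero
  have hinv : ∀ x ∈ S, Ring.inverse (f x) =
      Φ.symm ((Φ (f x)).det⁻¹ • (Φ (f x)).adjugate) := fun x hx => by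
    have h : f x * Φ.symm ((Φ (f x)).det⁻¹ • (Φ (f x)).adjugate) = 1 := by
      apply Φ.injective
      rw [map_mul, AlgEquiv.apply_symm_apply, mul_smul_comm, Matrix.mul_adjugate, smul_smul,
        inv_mul_cancel₀ (hdet x hx), one_smul, map_one]
    rw [← mul_one (Ring.inverse (f x)), ← h, ← mul_assoc, Ring.inverse_mul_cancel _ (hu x hx),
      one_mul]
  refine WeakContOn.congr ?_ hinv
  refine WeakContOn.map (WeakContOn.smul ?_ (WeakContOn.matrix fun i j => weakContOn_complex ?_))
    Φ.symm.toLinearMap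
  · exact ((continuous_id.matrix_det).comp_continuousOn hcont).inv₀ hdet
  · exact ((continuous_id.matrix_adjugate).matrix_elem i j).comp_continuousOn hcont

/-- In the variable v = 1/u the determinant is a polynomial whose value at v = 0 is the determinant
of the invertible leading coefficient. It has finitely many zeros; u = 0 is added by hand. -/
theorem finite_not_isUnit (Φ : E ≃ₐ[ℂ] Matrix N N ℂ) (d : ℕ) (τ : ℕ → E) (h : IsUnit (τ 0)) :
    {u : ℂ | ¬ IsUnit (∑ m ∈ Finset.range (d + 1), u ^ (d - m) • τ m)}.Finite := by
  set Q : Matrix N N (Polynomial ℂ) :=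
    ∑ m ∈ Finset.range (d + 1), (Polynomial.X ^ m : Polynomial ℂ) • (Φ (τ m)).map Polynomial.C
    with hQ
  have heval : ∀ v : ℂ, Q.det.eval v =
      (Φ (∑ m ∈ Finset.range (d + 1), v ^ m • τ m)).det := fun v => by
    rw [← Polynomial.coe_evalRingHom, RingHom.map_det]
    congr 1
    ext i j
    simp [hQ, Matrix.sum_apply, map_sum]
    exact Finset.sum_congr rfl fun _ _ => mul_comm _ _
  have h0 : Q.det ≠ 0 := by
    intro h0
    have := heval 0
    rw [h0, Polynomial.eval_zero, Finset.sum_range_succ', Finset.sum_eq_zero, zero_add, pow_zero,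
      one_smul] at this
    · exact ((Matrix.isUnit_iff_isUnit_det _).1 (h.map Φ)).ne_zero this.symm
    · intro m _; simp
  refine ((Q.det.roots.toFinset.finite_toSet.image (·⁻¹)).union (Set.finite_singleton 0)).subset ?_
  intro u hu
  by_cases hu0 : u = 0
  · exact Or.inr hu0
  · refine Or.inl ⟨u⁻¹, ?_, inv_inv u⟩
    simp only [Finset.mem_coe, Multiset.mem_toFinset]
    rw [Polynomial.mem_roots h0, Polynomial.IsRoot, heval]
    by_contra hne
    apply hu
    have e : ∑ m ∈ Finset.range (d + 1), u ^ (d - m) • τ m =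
        u ^ d • ∑ m ∈ Finset.range (d + 1), (u⁻¹) ^ m • τ m := by
      rw [Finset.smul_sum]
      refine Finset.sum_congr rfl fun m hm => ?_
      rw [smul_smul, inv_pow, ← pow_sub₀ _ hu0 (Nat.lt_succ_iff.1 (Finset.mem_range.1 hm))]
    rw [e]
    have h1 : IsUnit (∑ m ∈ Finset.range (d + 1), (u⁻¹) ^ m • τ m) := by
      rw [← MulEquiv.isUnit_map Φ, Matrix.isUnit_iff_isUnit_det]
      exact isUnit_iff_ne_zero.2 hne
    have h2 : IsUnit (u ^ d) := isUnit_iff_ne_zero.2 (pow_ne_zero _ hu0)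
    rw [Algebra.smul_def]
    exact (h2.map (algebraMap ℂ E)).mul h1

end FiniteDimensional

/-! ### The monodromy matrix of the open chain -/

noncomputable section OpenMonodromy

variable {n : ℕ} {V : Type*} [AddCommGroup V] [Module ℂ V] [FiniteDimensional ℂ V]

/-- Operators on `ℂⁿ ⊗ V` as complex matrices. -/
def matrixEnd (n : ℕ) (V : Type*) [AddCommGroup V] [Module ℂ V] [FiniteDimensional ℂ V] :
    Matrix (Fin n) (Fin n) (Module.End ℂ V) ≃ₐ[ℂ]
      Matrix (Fin n × Fin (Module.finrank ℂ V)) (Fin n × Fin (Module.finrank ℂ V)) ℂ :=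
  (algEquivMatrix (Module.finBasis ℂ V)).mapMatrix.trans (Matrix.compAlgEquiv _ _ ℂ ℂ)

/-- `T(u) K⁻(u) T⁻¹(-u)`. -/
def openD (d : ℕ) (τ : ℕ → Matrix (Fin n) (Fin n) (Module.End ℂ V)) (a : ℕ) (c u : ℂ) :
    Matrix (Fin n) (Fin n) (Module.End ℂ V) :=
  polyT d τ u * (kMinus n a c u).map (algebraMap ℂ (Module.End ℂ V)) * invT d τ u

variable {ħ f₀ : ℂ} {d : ℕ} {τ : ℕ → Matrix (Fin n) (Fin n) (Module.End ℂ V)}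

theorem weakContOn_polyT (S : Set ℂ) : WeakContOn (polyT d τ) S :=
  WeakContOn.sum _ fun m _ => WeakContOn.smul (by fun_prop) (weakContOn_const _)

theorem weakContOn_openD (a : ℕ) (c : ℂ) : WeakContOn (openD d τ a c) (invSet d τ) := by
  refine WeakContOn.mul (WeakContOn.mul (weakContOn_polyT _) ?_) ?_
  · refine WeakContOn.matrix fun i j => ?_
    have : (fun x => (kMinus n a c x).map (algebraMap ℂ (Module.End ℂ V)) i j) =
        fun x => kMinus n a c x i j • (1 : Module.End ℂ V) := by
      funext x
      rw [Matrix.map_apply, Algebra.algebraMap_eq_smul_one]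
    rw [this]
    refine WeakContOn.smul ?_ (weakContOn_const _)
    simp only [kMinus, Matrix.diagonal_apply]
    split_ifs <;> fun_prop
  · exact WeakContOn.ringInverse (matrixEnd n V)
      ((weakContOn_polyT Set.univ).comp continuousOn_neg fun _ _ => trivial) fun x hx => hx

theorem RttCoeffs.finite_compl (h : RttCoeffs ħ d f₀ τ) : (invSet d τ)ᶜ.Finite := by
  have h0 : IsUnit (τ 0) := by
    rw [h.zero]
    have : IsUnit (algebraMap ℂ (Matrix (Fin n) (Fin n) (Module.End ℂ V)) f₀) :=
      (isUnit_iff_ne_zero.2 h.ne_zero).map _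
    rwa [Algebra.algebraMap_eq_smul_one] at this
  exact (finite_not_isUnit (matrixEnd n V) d τ h0).preimage (f := fun x : ℂ => -x)
    neg_injective.injOn

theorem openD_smul_apply (i j : Fin n) (w : V) :
    ∃ φ : Matrix (Fin n) (Fin n) (Module.End ℂ V) →ₗ[ℂ] V, ∀ X, φ X = X i j • w :=
  ⟨(LinearMap.applyₗ w).comp (Matrix.entryLinearMap ℂ (Module.End ℂ V) i j), fun _ => rfl⟩

theorem RttCoeffs.reflData (h : RttCoeffs ħ d f₀ τ) (a : ℕ) (c : ℂ) :
    ReflData ħ (openD d τ a c) (⊤ : Submodule ℂ V) (invSet d τ) where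
  finite_compl := h.finite_compl
  smul_mem _ _ _ _ _ _ := trivial
  cont i j w _ := by
    obtain ⟨φ, hφ⟩ := openD_smul_apply (V := V) i j w
    simp only [← hφ]
    exact (weakContOn_openD a c).map φ
  refl x hx y hy := by
    refine agreeOn_refl_dress (h.exchangeRel hx hy)
      (D := fun x => (kMinus n a c x).map (algebraMap ℂ (Module.End ℂ V)))
      (fun i j k l => Algebra.commute_algebraMap_left (kMinus n a c x i j) _)
      (fun i j k l => Algebra.commute_algebraMap_right (kMinus n a c y k l) _)
      (fun i j k l => Algebra.commute_algebraMap_right (kMinus n a c y k l) _)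
      (fun i j k l => Algebra.commute_algebraMap_left (kMinus n a c x i j) _)
      (fun _ _ _ _ => trivial) (fun _ _ _ _ => trivial) ?_
    rw [kMinus_refl]
    exact fun _ _ _ _ => rfl

/-- The highest weight conditions for the coefficients. -/
structure HighestCoeffs (d : ℕ) (τ : ℕ → Matrix (Fin n) (Fin n) (Module.End ℂ V)) (Ω : V)
    (lam : Fin n → ℕ → ℂ) : Prop where
  ne_zero : Ω ≠ 0
  lower : ∀ m i j, j < i → τ m i j • Ω = 0
  diag : ∀ i m, τ m i i • Ω = lam i m • Ω

/-- The eigenvalues of `t_{ii}(u)` on the highest weight vector. -/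
def polyLam (d : ℕ) (lam : ℕ → ℂ) (u : ℂ) : ℂ := ∑ m ∈ Finset.range (d + 1), u ^ (d - m) • lam m

variable {Ω : V} {lam : Fin n → ℕ → ℂ}

theorem HighestCoeffs.polyT_lower (hΩ : HighestCoeffs d τ Ω lam) (u : ℂ) {i j : Fin n}
    (hij : j < i) : polyT d τ u i j • Ω = 0 := by
  rw [polyT_apply, Finset.sum_smul]
  exact Finset.sum_eq_zero fun m _ => by rw [smul_assoc, hΩ.lower m i j hij, smul_zero]

theorem HighestCoeffs.polyT_diag (hΩ : HighestCoeffs d τ Ω lam) (u : ℂ) (i : Fin n) :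
    polyT d τ u i i • Ω = polyLam d (lam i) u • Ω := by
  rw [polyT_apply, polyLam, Finset.sum_smul, Finset.sum_smul]
  exact Finset.sum_congr rfl fun m _ => by rw [smul_assoc, hΩ.diag, smul_assoc]

theorem HighestCoeffs.finite_zeros (hΩ : HighestCoeffs d τ Ω lam) (h : RttCoeffs ħ d f₀ τ)
    (i : Fin n) : {u | polyLam d (lam i) u = 0}.Finite := by
  have h0 : lam i 0 = f₀ := by
    have := hΩ.diag i 0
    rw [h.zero, Matrix.smul_apply, Matrix.one_apply_eq, smul_assoc, one_smul] at this
    exact (smul_left_injective ℂ hΩ.ne_zero this).symm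
  have := finite_not_isUnit (Matrix.uniqueAlgEquiv (m := Unit) (R := ℂ) (A := ℂ)).symm d (lam i)
    (by rw [h0]; exact isUnit_iff_ne_zero.2 h.ne_zero)
  simpa [isUnit_iff_ne_zero, polyLam] using this

theorem sum_ite_lt_smul {F : Type*} [AddCommGroup F] [Module ℂ F] (j : Fin n) (v w : F) :
    (∑ a : Fin n, if a < j then v else if a = j then w else 0) = (j : ℕ) • v + w := by
  have h : ∀ a : Fin n, (if a < j then v else if a = j then w else 0) =
      (if a < j then v else 0) + if a = j then w else 0 := fun a => by
    split_ifs with h₁ h₂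
    · subst h₂; exact absurd h₁ (lt_irrefl _)
    all_goals simp
  rw [Finset.sum_congr rfl fun a _ => h a, Finset.sum_add_distrib, ← Finset.sum_filter,
    Finset.sum_const, show Finset.univ.filter (· < j) = Finset.Iio j by ext; simp, Fin.card_Iio]
  simp

/-- Induction on the column j. For a < j the cross relation turns (x+u) n_{ka}(x) t_{aj}(u) Ω into ħ
Z, where Z is the (k,j) entry of T⁻¹(-x) T(u) on Ω; for a > j the term is zero. Counting the indices
a < j gives (x+u-jħ) Z = (x+u) λ_j(u) n_{kj}(x) Ω. -/
theorem invT_smul_eq_zero (h : RttCoeffs ħ d f₀ τ) (hΩ : HighestCoeffs d τ Ω lam) {x : ℂ}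
    (hx : x ∈ invSet d τ) (hlam : ∀ j : Fin n, polyLam d (lam j) (-x + (j : ℕ) * ħ) ≠ 0)
    (j : Fin n) : ∀ k, j < k → invT d τ x k j • Ω = 0 := by
  induction j using WellFoundedLT.induction with
  | ind j ih =>
  intro k hjk
  set y := invT d τ x k j • Ω with hy
  have hS : ∀ u, (x + u - (j : ℕ) * ħ) • (invT d τ x * polyT d τ u) k j • Ω =
      ((x + u) * polyLam d (lam j) u) • y := by
    intro u
    have hcross := (cross_iff ħ (x + u) _ _).1 (h.cross hx u)
    set Z := (invT d τ x * polyT d τ u) k j • Ω with hZ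
    have hsum : (x + u) • Z = ∑ a : Fin n, if a < j then ħ • Z else
        if a = j then ((x + u) * polyLam d (lam j) u) • y else 0 := by
      conv_lhs => rw [hZ, Matrix.mul_apply, Finset.sum_smul, Finset.smul_sum]
      refine Finset.sum_congr rfl fun a _ => ?_
      rw [mul_smul]
      split_ifs with h₁ h₂
      · have := congrArg (fun X : Module.End ℂ V => X • Ω) (hcross k a a j)
        simp only [smul_assoc, sub_smul, mul_smul, if_true, if_neg hjk.ne', sub_zero] at this
        rw [ih a h₁ k (h₁.trans hjk), smul_zero, sub_zero] at this
        exact this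
      · subst h₂
        rw [hΩ.polyT_diag, smul_smul_comm_of_tower, smul_smul]
      · rw [hΩ.polyT_lower u (lt_of_le_of_ne (not_lt.1 h₁) (Ne.symm h₂)), smul_zero, smul_zero]
    rw [sum_ite_lt_smul] at hsum
    rw [sub_smul, hsum, ← Nat.cast_smul_eq_nsmul ℂ, smul_smul]
    abel
  -- If jħ ≠ 0, the choice u = -x + jħ kills the left side but not the scalar on the right. If jħ =
  -- 0, the factor x+u cancels, and continuity allows u = -x, where T⁻¹(-x) T(u) = 1 has no
  -- off-diagonal entry.
  by_cases hj : ((j : ℕ) : ℂ) * ħ = 0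
  · have hlin : ∃ φ : Matrix (Fin n) (Fin n) (Module.End ℂ V) →ₗ[ℂ] V, ∀ X,
        φ X = (invT d τ x * X) k j • Ω := by
      obtain ⟨φ, hφ⟩ := openD_smul_apply (V := V) k j Ω
      exact ⟨φ.comp (LinearMap.mulLeft ℂ (invT d τ x)), fun X => hφ _⟩
    obtain ⟨φ, hφ⟩ := hlin
    have hc : Continuous fun u => polyLam d (lam j) u := by unfold polyLam; fun_prop
    have := WeakContOn.eqOn_of_finite ((weakContOn_polyT (d := d) (τ := τ) Set.univ).map φ)
      (WeakContOn.smul hc.continuousOn (weakContOn_const y)) (by simp) (Set.finite_singleton (-x))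
      (fun u _ hu => by
        rw [hφ]
        have h1 := hS u
        rw [hj, sub_zero, mul_smul] at h1
        have hne : x + u ≠ 0 := fun h0 => hu (by
          rw [Set.mem_singleton_iff]; linear_combination h0)
        exact smul_right_injective V hne h1) (-x) trivial
    rw [hφ, invT, Ring.inverse_mul_cancel _ hx, Matrix.one_apply_ne hjk.ne', zero_smul] at this
    have h2 := hlam j
    rw [hj, add_zero] at h2
    exact eq_zero_of_smul h2 this.symm
  · have := hS (-x + (j : ℕ) * ħ)
    rw [show x + (-x + (j : ℕ) * ħ) - (j : ℕ) * ħ = 0 by ring, zero_smul,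
      show x + (-x + (j : ℕ) * ħ) = (j : ℕ) * ħ by ring] at this
    exact eq_zero_of_smul (mul_ne_zero hj (hlam j)) this.symm

/-- Vanishing of each summand is needed because K⁻ puts different scalars between the factors. The
cross relation shows that 2x times every summand with b ≤ j equals ħ Q, where Q is the full sum
applied to Ω; the other summands vanish. The j+1 equal terms give 2xQ = (j+1)ħQ, so Q = 0 and each
summand is zero. -/
theorem polyT_invT_smul_eq_zero (h : RttCoeffs ħ d f₀ τ) (hΩ : HighestCoeffs d τ Ω lam) {x : ℂ}
    (hx : x ∈ invSet d τ) (hlam : ∀ j : Fin n, polyLam d (lam j) (-x + (j : ℕ) * ħ) ≠ 0)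
    (hx0 : x ≠ 0) (hxj : ∀ j : Fin n, 2 * x - ((j : ℕ) + 1) * ħ ≠ 0) {i j : Fin n} (hij : j < i)
    (b : Fin n) : polyT d τ x i b • invT d τ x b j • Ω = 0 := by
  have hcross := (cross_iff ħ (x + x) _ _).1 (h.cross hx x)
  set Q := (polyT d τ x * invT d τ x) i j • Ω with hQ
  have hterm : ∀ b, b ≤ j → (x + x) • polyT d τ x i b • invT d τ x b j • Ω = ħ • Q := by
    intro b hb
    have := congrArg (fun X : Module.End ℂ V => X • Ω) (hcross b j i b)
    simp only [smul_assoc, sub_smul, mul_smul, if_true, if_neg hij.ne', zero_smul] at this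
    rwa [hΩ.polyT_lower x (hb.trans_lt hij), smul_zero, zero_sub, zero_sub, smul_neg, smul_neg,
      neg_inj] at this
  have hterm' : ∀ b, j < b → polyT d τ x i b • invT d τ x b j • Ω = 0 := fun b hb => by
    rw [invT_smul_eq_zero h hΩ hx hlam j b hb, smul_zero]
  have hsum : (x + x) • Q = ∑ b : Fin n, if b < j then ħ • Q else if b = j then ħ • Q else 0 := by
    conv_lhs => rw [hQ, Matrix.mul_apply, Finset.sum_smul, Finset.smul_sum]
    refine Finset.sum_congr rfl fun b _ => ?_
    rw [mul_smul]
    split_ifs with h₁ h₂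
    · exact hterm b h₁.le
    · exact hterm b h₂.le
    · rw [hterm' b (lt_of_le_of_ne (not_lt.1 h₁) (Ne.symm h₂)), smul_zero]
  rw [sum_ite_lt_smul, ← Nat.cast_smul_eq_nsmul ℂ, smul_smul, ← add_smul] at hsum
  have hQ0 : Q = 0 := by
    refine eq_zero_of_smul (hxj j) ?_
    rw [sub_smul, two_mul, hsum, ← sub_smul]
    rw [show (((j : ℕ) : ℂ) * ħ + ħ) - (((j : ℕ) : ℂ) + 1) * ħ = 0 by ring, zero_smul]
  rcases le_or_gt b j with hb | hb
  · have := hterm b hb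
    rw [hQ0, smul_zero, ← two_mul] at this
    exact eq_zero_of_smul (mul_ne_zero two_ne_zero hx0) this
  · exact hterm' b hb

theorem RttCoeffs.isHighest (h : RttCoeffs ħ d f₀ τ) (hΩ : HighestCoeffs d τ Ω lam) (a : ℕ)
    (c : ℂ) : IsHighest (openD d τ a c) (⊤ : Submodule ℂ V) (invSet d τ) Ω where
  mem := trivial
  lower x hx i j hij := by
    -- The finitely many x at which a scalar to be cancelled vanishes; they are recovered by
    -- continuity.
    set F : Set ℂ := (⋃ j : Fin n, {x | polyLam d (lam j) (-x + (j : ℕ) * ħ) = 0}) ∪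
      ({0} ∪ ⋃ j : Fin n, {((j : ℕ) + 1) * ħ / 2}) with hF
    have hFfin : F.Finite := by
      refine (Set.finite_iUnion fun j => ?_).union
        ((Set.finite_singleton _).union (Set.finite_iUnion fun j => Set.finite_singleton _))
      exact (hΩ.finite_zeros h j).preimage (f := fun x : ℂ => -x + (j : ℕ) * ħ)
        (fun x _ y _ hxy => by simpa using hxy)
    refine WeakContOn.eqOn_of_finite ((h.reflData a c).cont i j Ω trivial) (weakContOn_const 0)
      h.finite_compl hFfin (fun x hx hxF => ?_) x hx
    simp only [hF, Set.mem_union, Set.mem_iUnion, Set.mem_ofPred_eq, Set.mem_singleton_iff,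
      not_or, not_exists] at hxF
    have key := polyT_invT_smul_eq_zero h hΩ hx hxF.1 hxF.2.1 (fun j h0 => hxF.2.2 j (by
      linear_combination (1 / 2) * h0)) hij
    rw [openD, Matrix.mul_apply, Finset.sum_smul]
    refine Finset.sum_eq_zero fun b _ => ?_
    rw [mul_smul, kMinus, Matrix.diagonal_map (map_zero _), Matrix.mul_diagonal, mul_smul,
      Algebra.algebraMap_eq_smul_one, smul_assoc, one_smul, smul_smul_comm_of_tower, key,
      smul_zero]

end OpenMonodromy


/-! ### Representations of the Yangian -/

noncomputable section YangianRepresentations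

open Finset.HasAntidiagonal in
/-- The coefficients of the product of the series `f` and `g`. -/
def conv {E : Type*} [AddCommGroup E] [Module ℂ E] (f : ℕ → ℂ) (g : ℕ → E) (m : ℕ) : E :=
  ∑ x ∈ antidiagonal m, f x.1 • g x.2

section Convolution

variable {E : Type*} [Ring E] [Algebra ℂ E]

theorem conv_zero (f : ℕ → ℂ) (g : ℕ → E) : conv f g 0 = f 0 • g 0 := by
  simp [conv]

theorem conv_succ (f : ℕ → ℂ) (g : ℕ → E) (m : ℕ) :
    conv f g (m + 1) = conv f (fun p => g (p + 1)) m + f (m + 1) • g 0 := by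
  rw [conv, Finset.Nat.sum_antidiagonal_succ', add_comm, conv]

theorem conv_mul_conv_sub (f : ℕ → ℂ) (g h g' h' : ℕ → E) (r s : ℕ) :
    conv f g r * conv f h s - conv f g' s * conv f h' r =
      conv f (fun p => conv f (fun q => g p * h q - g' q * h' p) s) r := by
  simp only [conv, Finset.sum_mul_sum, smul_mul_smul_comm]
  rw [Finset.sum_comm (s := Finset.HasAntidiagonal.antidiagonal s), ← Finset.sum_sub_distrib]
  refine Finset.sum_congr rfl fun x _ => ?_
  rw [← Finset.sum_sub_distrib, Finset.smul_sum]
  refine Finset.sum_congr rfl fun y _ => ?_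
  rw [mul_comm (f y.1), ← smul_sub, smul_smul]

theorem conv_sub (f : ℕ → ℂ) (g h : ℕ → E) (m : ℕ) :
    conv f g m - conv f h m = conv f (fun p => g p - h p) m := by
  simp only [conv, smul_sub, Finset.sum_sub_distrib]

theorem smul_conv (c : ℂ) (f : ℕ → ℂ) (g : ℕ → E) (m : ℕ) :
    c • conv f g m = conv f (fun p => c • g p) m := by
  simp only [conv, Finset.smul_sum]
  exact Finset.sum_congr rfl fun _ _ => smul_comm _ _ _

end Convolution

variable {ħ : ℂ} {n : ℕ}

theorem Yangian.t_zero (i j : Fin n) : Yangian.t ħ n 0 i j = if i = j then 1 else 0 := by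
  rw [Yangian.t, tFree, Matrix.one_apply]
  split_ifs <;> simp

theorem Yangian.comm (r s : ℕ) (i j k l : Fin n) :
    Yangian.t ħ n (r + 1) i j * Yangian.t ħ n s k l -
        Yangian.t ħ n s k l * Yangian.t ħ n (r + 1) i j -
      (Yangian.t ħ n r i j * Yangian.t ħ n (s + 1) k l -
        Yangian.t ħ n (s + 1) k l * Yangian.t ħ n r i j) =
      ħ • (Yangian.t ħ n r k j * Yangian.t ħ n s i l -
        Yangian.t ħ n s k j * Yangian.t ħ n r i l) := by
  have hL : ∀ p, tFree₁ n p = leg₁ (tFree n p) := fun _ => rfl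
  have hR : ∀ p, tFree₂ n p = leg₂ (tFree n p) := fun _ => rfl
  have h := RingQuot.mkAlgHom_rel ℂ (YangianRel.rtt (ħ := ħ) (n := n) r s (i, k) (j, l))
  rw [rttLeft, rttRight] at h
  simp only [hL, hR, Matrix.sub_apply, Matrix.smul_apply, mul_assoc (permP _ n), permP_mul_apply,
    mul_permP_apply, leg₁_mul_leg₂_apply, leg₂_mul_leg₁_apply, map_sub, map_mul, map_smul] at h
  change Yangian.t ħ n (r + 1) i j * Yangian.t ħ n s k l -
    Yangian.t ħ n r i j * Yangian.t ħ n (s + 1) k l -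
    ħ • (Yangian.t ħ n r k j * Yangian.t ħ n s i l) =
    Yangian.t ħ n s k l * Yangian.t ħ n (r + 1) i j -
    Yangian.t ħ n (s + 1) k l * Yangian.t ħ n r i j -
    ħ • (Yangian.t ħ n s k j * Yangian.t ħ n r i l) at h
  rw [smul_sub]
  rw [sub_eq_iff_eq_add] at h
  rw [sub_sub_sub_comm, h]
  abel

variable {V : Type*} [AddCommGroup V] [Module ℂ V]

/-- The coefficients of `f(u) ρ(T(u))`. -/
def rhoCoeff (ρ : Yangian ħ n →ₐ[ℂ] Module.End ℂ V) (f : ℕ → ℂ) (m : ℕ) :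
    Matrix (Fin n) (Fin n) (Module.End ℂ V) :=
  Matrix.of fun i j => conv f (fun p => ρ (Yangian.t ħ n p i j)) m

variable {ρ : Yangian ħ n →ₐ[ℂ] Module.End ℂ V} {f : ℕ → ℂ}

/-- Multiplying the RTT relation by the scalar series f(u) f(v) preserves it; on coefficients this
is convolution with f in both indices. -/
theorem rhoCoeff_comm (r s : ℕ) (i j k l : Fin n) :
    rhoCoeff ρ f (r + 1) i j * rhoCoeff ρ f s k l -
        rhoCoeff ρ f s k l * rhoCoeff ρ f (r + 1) i j -
      (rhoCoeff ρ f r i j * rhoCoeff ρ f (s + 1) k l -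
        rhoCoeff ρ f (s + 1) k l * rhoCoeff ρ f r i j) =
      ħ • (rhoCoeff ρ f r k j * rhoCoeff ρ f s i l -
        rhoCoeff ρ f s k j * rhoCoeff ρ f r i l) := by
  have hz : ∀ (i j : Fin n) (X : Module.End ℂ V), ρ (Yangian.t ħ n 0 i j) * X -
      X * ρ (Yangian.t ħ n 0 i j) = 0 := fun i j X => by
    rw [Yangian.t_zero]
    split_ifs <;> simp
  have hz' : ∀ (i j : Fin n) (X : Module.End ℂ V), X * ρ (Yangian.t ħ n 0 i j) -
      ρ (Yangian.t ħ n 0 i j) * X = 0 := fun i j X => by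
    rw [← neg_sub, hz, neg_zero]
  have h0 : ∀ s, conv f (fun _ : ℕ => (0 : Module.End ℂ V)) s = 0 := fun s => by simp [conv]
  simp only [rhoCoeff, Matrix.of_apply]
  simp only [conv_mul_conv_sub]
  -- The index shift leaves extra terms containing t^{(0)}; being scalar, it has zero commutators.
  simp only [conv_succ f _ r, conv_succ f _ s, hz, hz', h0, smul_zero, add_zero]
  rw [conv_sub, smul_conv]
  simp only [conv_sub, smul_conv, ← map_mul, ← map_sub, ← map_smul, Yangian.comm]

/-- The normalization data of a polynomial monodromy matrix. -/
structure Normalization (ρ : Yangian ħ n →ₐ[ℂ] Module.End ℂ V)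
    (T : Matrix (Fin n) (Fin n) (Polynomial (Module.End ℂ V))) (d : ℕ) (f : ℕ → ℂ) : Prop where
  ne_zero : f 0 ≠ 0
  natDegree_le : ∀ i j, (T i j).natDegree ≤ d
  coeff : ∀ i j m, rhoCoeff ρ f m i j = if m ≤ d then (T i j).coeff (d - m) else 0

variable {T : Matrix (Fin n) (Fin n) (Polynomial (Module.End ℂ V))} {d : ℕ}

theorem IsMonodromy.exists_normalization (h : IsMonodromy ρ T) :
    ∃ d f, Normalization ρ T d f := by
  obtain ⟨d, f, h0, hT⟩ := h
  exact ⟨d, f, h0, fun i j => (hT i j).1, fun i j => (hT i j).2⟩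

theorem Normalization.rttCoeffs (h : Normalization ρ T d f) :
    RttCoeffs ħ d (f 0) (rhoCoeff ρ f) where
  ne_zero := h.ne_zero
  zero := by
    ext1 i j
    rw [rhoCoeff, Matrix.of_apply, conv_zero, Yangian.t_zero, Matrix.smul_apply, Matrix.one_apply]
    split_ifs <;> simp
  vanish m hm := by
    ext1 i j
    rw [h.coeff, if_neg (not_le.2 hm), Matrix.zero_apply]
  comm := rhoCoeff_comm

theorem Normalization.evalT_eq (h : Normalization ρ T d f) (u : ℂ) :
    evalT T u = polyT d (rhoCoeff ρ f) u := by
  ext1 i j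
  rw [evalT, Matrix.map_apply, polyT_apply,
    Polynomial.eval_eq_sum_range' (Nat.lt_succ_of_le (h.natDegree_le i j)),
    ← Finset.sum_range_reflect]
  refine Finset.sum_congr rfl fun m hm => ?_
  have hm' := Nat.lt_succ_iff.1 (Finset.mem_range.1 hm)
  rw [h.coeff, if_pos hm', show d + 1 - 1 - m = d - m by omega, ← map_pow, Algebra.smul_def]
  exact (Algebra.commutes _ _).symm

theorem Normalization.openMonodromy_eq [FiniteDimensional ℂ V] (h : Normalization ρ T d f) (a : ℕ)
    (c : ℂ) : openMonodromy T a c = openD d (rhoCoeff ρ f) a c := by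
  funext u
  rw [openMonodromy, openD, invT, h.evalT_eq, h.evalT_eq]

theorem Normalization.mem_invSet (h : Normalization ρ T d f) {x : ℂ} :
    x ∈ invSet d (rhoCoeff ρ f) ↔ IsUnit (evalT T (-x)) := by
  rw [h.evalT_eq]; rfl

theorem IsHighestWeightVector.highestCoeffs [FiniteDimensional ℂ V] {Ω : V}
    (hΩ : IsHighestWeightVector ρ Ω) (d : ℕ) (f : ℕ → ℂ) : ∃ lam, HighestCoeffs d (rhoCoeff ρ f) Ω lam := by
  choose lam hlam using hΩ.diag
  refine ⟨fun i => conv f (lam i), hΩ.ne_zero, fun m i j hij => ?_, fun i m => ?_⟩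
  · rw [rhoCoeff, Matrix.of_apply, conv, Finset.sum_smul]
    refine Finset.sum_eq_zero fun x _ => ?_
    rw [smul_assoc, Module.End.smul_def, hΩ.lower _ i j hij, smul_zero]
  · rw [rhoCoeff, Matrix.of_apply, conv, conv, Finset.sum_smul, Finset.sum_smul]
    refine Finset.sum_congr rfl fun x _ => ?_
    rw [smul_assoc, Module.End.smul_def, hlam, smul_assoc]

end YangianRepresentations


/-! ### Continuity of the trace formula in the parameters -/

noncomputable section TraceContinuity

/-- The factors of the trace formula are defined at `u` for a generating matrix defined on `S`. -/
structure WeakRegPts (ħ : ℂ) (S : Set ℂ) {r : ℕ} (M : Fin r → ℕ)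
    (u : (k : Fin r) → Fin (M k) → ℂ) : Prop where
  mem : ∀ k j, u k j + ħ / 2 + (k : ℕ) * ħ / 2 ∈ S
  two_ne : ∀ (k : Fin r) (j : Fin (M k)), 0 < (k : ℕ) → 2 * u k j + ħ ≠ 0
  add_ne : ∀ (k b : Fin r) (j : Fin (M k)) (c : Fin (M b)), b < k →
    u k j + u b c + (((k : ℕ) : ℂ) - ((b : ℕ) : ℂ)) * ħ / 2 ≠ ħ
  sub_ne : ∀ (k b : Fin r) (j : Fin (M k)) (c : Fin (M b)), b < k →
    u k j - u b c + (((k : ℕ) : ℂ) - ((b : ℕ) : ℂ)) * ħ / 2 ≠ ħ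

variable {r : ℕ} {A : Type*} [Ring A] [Algebra ℂ A] [Module.Finite ℂ A] {ħ : ℂ} {S G : Set ℂ}
  {M : Fin r → ℕ}

theorem WeakRegPts.perm {u : (k : Fin r) → Fin (M k) → ℂ} (h : WeakRegPts ħ S M u)
    (π : (k : Fin r) → Equiv.Perm (Fin (M k))) : WeakRegPts ħ S M (fun k j => u k (π k j)) where
  mem k _ := h.mem k _
  two_ne k _ := h.two_ne k _
  add_ne k b _ _ := h.add_ne k b _ _
  sub_ne k b _ _ := h.sub_ne k b _ _

theorem WeakContOn.matrix_apply {E : Type*} [AddCommGroup E] [Module ℂ E] {ι κ : Type*}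
    {f : ℂ → Matrix ι κ E} (hf : WeakContOn f G) (i : ι) (j : κ) :
    WeakContOn (fun x => f x i j) G :=
  hf.map (Matrix.entryLinearMap ℂ E i j)

theorem weakContOn_onSite {Λ : Type*} [DecidableEq Λ] [Fintype Λ] {n : ℕ} (s : Λ)
    {X : ℂ → Matrix (Fin n) (Fin n) A} (hX : WeakContOn X G) :
    WeakContOn (fun z => onSite s (X z)) G :=
  WeakContOn.matrix fun p q => WeakContOn.ite (hX.matrix_apply (p s) (q s))

theorem weakContOn_onSites_normR {Λ : Type*} [DecidableEq Λ] [Fintype Λ] {n : ℕ} (s t : Λ)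
    (k p : ℕ) {x : ℂ → ℂ} (hx : ContinuousOn x G) (hne : ∀ z ∈ G, x z ≠ ħ) :
    WeakContOn (fun z => onSites A s t (normR ħ n k p (x z))) G := by
  refine WeakContOn.matrix fun p' q' => WeakContOn.ite ?_
  simp only [Algebra.algebraMap_eq_smul_one]
  refine WeakContOn.smul ?_ (weakContOn_const _)
  simp only [normR, Matrix.smul_apply]
  refine ContinuousOn.smul ((hx.sub continuousOn_const).inv₀ fun z hz => sub_ne_zero.2 (hne z hz)) ?_
  have h : Continuous fun y : ℂ =>
      (proj n k ⊗ₖ proj n p * rMatrix ħ n y * proj n k ⊗ₖ proj n p) (p' s, p' t) (q' s, q' t) := by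
    unfold rMatrix
    fun_prop
  exact h.comp_continuousOn hx

theorem weakContOn_hatD {n : ℕ} {D : ℂ → Matrix (Fin n) (Fin n) A} (hD : WeakContOn D S) (k : ℕ)
    {x : ℂ → ℂ} (hx : ContinuousOn x G) (hmem : ∀ z ∈ G, x z + k * ħ / 2 ∈ S)
    (hne : 0 < k → ∀ z ∈ G, 2 * x z ≠ 0) : WeakContOn (fun z => hatD ħ D k (x z)) G := by
  have hD' : WeakContOn (fun z => D (x z + k * ħ / 2)) G :=
    hD.comp (hx.add continuousOn_const) hmem
  refine WeakContOn.matrix fun i j => WeakContOn.ite (WeakContOn.add (hD'.matrix_apply i j)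
    (WeakContOn.ite (WeakContOn.sum _ fun a _ => ?_)))
  split_ifs with ha
  · exact WeakContOn.smul (continuousOn_const.div (continuousOn_const.mul hx)
      (hne (by omega))) (hD'.matrix_apply a a)
  · exact weakContOn_const 0

theorem weakContOn_betheTrace {D : ℂ → Matrix (Fin (r + 1)) (Fin (r + 1)) A}
    (hD : WeakContOn D S) {u : ℂ → (k : Fin r) → Fin (M k) → ℂ}
    (hu : ∀ k j, ContinuousOn (fun z => u z k j) G) (hreg : ∀ z ∈ G, WeakRegPts ħ S M (u z)) :
    WeakContOn (fun z => betheTrace ħ D M (fun _ => 1) (u z)) G := by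
  refine WeakContOn.map (f := fun z =>
    (List.ofFn fun k : Fin r => dressedD ħ D M (fun _ => 1) (u z) k).prod * lowering M A)
    (WeakContOn.mul ?_ (weakContOn_const _)) (Matrix.traceLinearMap _ ℂ A)
  simp only [List.ofFn_eq_map]
  refine WeakContOn.list_prod _ fun k _ => ?_
  simp only [dressedD, List.ofFn_eq_map]
  refine WeakContOn.list_prod _ fun j _ => WeakContOn.mul (WeakContOn.mul ?_ ?_) ?_
  · simp only [rBar, List.ofFn_eq_map]
    refine WeakContOn.list_prod _ fun b hb => WeakContOn.list_prod _ fun c _ => ?_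
    have hbk : b < k := by simpa using hb
    exact weakContOn_onSites_normR _ _ _ _ (((hu k j).add (hu b c)).add continuousOn_const)
      fun z hz => (hreg z hz).add_ne k b j c hbk
  · refine weakContOn_onSite _ (weakContOn_hatD hD _ ((hu k j).add continuousOn_const)
      (fun z hz => (hreg z hz).mem k j) fun hk z hz => ?_)
    have := (hreg z hz).two_ne k j hk
    rwa [mul_add, mul_div_cancel₀ _ two_ne_zero]
  · simp only [rProd, List.ofFn_eq_map, ← List.map_reverse]
    refine WeakContOn.list_prod _ fun b hb => WeakContOn.list_prod _ fun c _ => ?_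
    have hbk : b < k := by simpa using hb
    exact weakContOn_onSites_normR _ _ _ _ (((hu k j).sub (hu b c)).add continuousOn_const)
      fun z hz => (hreg z hz).sub_ne k b j c hbk

theorem finite_mul_add_eq {a b c : ℂ} (ha : a ≠ 0) : {z : ℂ | a * z + b = c}.Finite :=
  (Set.finite_singleton ((c - b) / a)).subset fun z hz => by
    rw [Set.mem_singleton_iff, eq_div_iff ha, mul_comm]
    exact eq_sub_of_add_eq hz

theorem finite_shift (hS : Sᶜ.Finite) (b : ℂ) : {z : ℂ | z + b ∉ S}.Finite :=
  hS.preimage (f := fun z : ℂ => z + b) (add_left_injective b).injOn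

/-- A common shift z adds 2z to sums and nothing to differences, so the conditions on sums exclude
finitely many z and those on differences exclude none. -/
theorem finite_shift_not_weakRegPts (hS : Sᶜ.Finite) {u : (k : Fin r) → Fin (M k) → ℂ}
    (hu : WeakRegPts ħ S M u) :
    {z | WeakRegPts ħ S M (fun k j => u k j + z)}ᶜ.Finite := by
  refine (((Set.finite_iUnion fun k : Fin r => Set.finite_iUnion fun j : Fin (M k) =>
    finite_shift hS (u k j + ħ / 2 + (k : ℕ) * ħ / 2)).union
    (Set.finite_iUnion fun k : Fin r => Set.finite_iUnion fun j : Fin (M k) =>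
      finite_mul_add_eq (b := 2 * u k j + ħ) (c := 0) two_ne_zero)).union
    (Set.finite_iUnion fun k : Fin r => Set.finite_iUnion fun b : Fin r =>
      Set.finite_iUnion fun j : Fin (M k) => Set.finite_iUnion fun c : Fin (M b) =>
      finite_mul_add_eq (b := u k j + u b c + (((k : ℕ) : ℂ) - ((b : ℕ) : ℂ)) * ħ / 2) (c := ħ)
        two_ne_zero)).subset fun z hz => ?_
  by_contra hcon
  simp only [Set.mem_union, Set.mem_iUnion, Set.mem_ofPred_eq, not_or, not_exists, not_not] at hcon
  obtain ⟨⟨h₁, h₂⟩, h₃⟩ := hcon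
  refine hz ⟨fun k j => ?_, fun k j _ => ?_, fun k b j c _ => ?_, fun k b j c hb => ?_⟩
  · convert h₁ k j using 1; ring
  · convert h₂ k j using 1; ring
  · convert h₃ k b j c using 1; ring
  · convert hu.sub_ne k b j c hb using 1; ring

theorem WeakRegPts.regPts {u : (k : Fin r) → Fin (M k) → ℂ} (hu : WeakRegPts ħ S M u)
    (h : ∀ (k : Fin r) (j : Fin (M k)) (l : ℕ), 1 ≤ l → l ≤ (k : ℕ) → 2 * u k j + l * ħ ≠ 0) :
    RegPts ħ S M u :=
  ⟨hu.mem, h, hu.add_ne, hu.sub_ne⟩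

theorem finite_shift_two_eq (u : (k : Fin r) → Fin (M k) → ℂ) :
    {z | ¬ ∀ (k : Fin r) (j : Fin (M k)) (l : ℕ), 1 ≤ l → l ≤ (k : ℕ) →
      2 * (u k j + z) + l * ħ ≠ 0}.Finite := by
  refine (Set.finite_iUnion fun k : Fin r => Set.finite_iUnion fun j : Fin (M k) =>
    Set.finite_iUnion fun l : Fin (r + 1) =>
      finite_mul_add_eq (b := 2 * u k j + (l : ℕ) * ħ) (c := 0) two_ne_zero).subset fun z hz => ?_
  by_contra hcon
  simp only [Set.mem_iUnion, Set.mem_ofPred_eq, not_exists] at hcon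
  refine hz fun k j l _ hl => ?_
  convert hcon k j ⟨l, by omega⟩ using 1
  ring

variable {V : Type*} [AddCommGroup V] [Module ℂ V] [Module A V] [IsScalarTower ℂ A V]

/-- For all but finitely many common shifts the shifted parameters satisfy 2u_{ij} + lħ ≠ 0, and the
symmetry is known there. Both sides are continuous in the shift, so it holds at shift 0. -/
theorem betheTrace_symm {D : ℂ → Matrix (Fin (r + 1)) (Fin (r + 1)) A} {W : Submodule ℂ V} {Ω : V}
    (hD : ReflData ħ D W S) (hcont : WeakContOn D S) (hΩ : IsHighest D W S Ω)
    {u : (k : Fin r) → Fin (M k) → ℂ} (hu : WeakRegPts ħ S M u)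
    (π : (k : Fin r) → Equiv.Perm (Fin (M k))) :
    betheTrace ħ D M (fun _ => 1) (fun k j => u k (π k j)) • Ω =
      betheTrace ħ D M (fun _ => 1) u • Ω := by
  have hc : ∀ v : (k : Fin r) → Fin (M k) → ℂ,
      ∀ k j, ContinuousOn (fun z : ℂ => v k j + z) {z | WeakRegPts ħ S M (fun k j => u k j + z)} :=
    fun v k j => by fun_prop
  have hmap : ∀ {f : ℂ → A} {G : Set ℂ}, WeakContOn f G → WeakContOn (fun z => f z • Ω) G :=
    fun hf => hf.map ((LinearMap.toSpanSingleton A V Ω).restrictScalars ℂ)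
  have := WeakContOn.eqOn_of_finite
    (hmap (weakContOn_betheTrace hcont (hc fun k j => u k (π k j))
      fun z (hz : WeakRegPts ħ S M _) => hz.perm π))
    (hmap (weakContOn_betheTrace hcont (hc u) fun z hz => hz))
    (finite_shift_not_weakRegPts hD.finite_compl hu) (finite_shift_two_eq (ħ := ħ) u)
    (fun z hz hz' => (betheTrace_eq_betheRec_and_symm r hD
      (WeakRegPts.regPts hz (not_not.1 hz')) hΩ).2 π) 0 (by simpa using hu)
  simpa using this

end TraceContinuity

end OpenChain

/-! ### The main theorem -/

namespace OpenChain

theorem Normalization.weakRegPts {ħ : ℂ} {r : ℕ} {V : Type*} [AddCommGroup V] [Module ℂ V]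
    {ρ : Yangian ħ (r + 1) →ₐ[ℂ] Module.End ℂ V}
    {T : Matrix (Fin (r + 1)) (Fin (r + 1)) (Polynomial (Module.End ℂ V))} {d : ℕ} {f : ℕ → ℂ}
    (h : Normalization ρ T d f) {M : Fin r → ℕ} {u : (k : Fin r) → Fin (M k) → ℂ}
    (hu : IsRegular ħ T M u) : WeakRegPts ħ (invSet d (rhoCoeff ρ f)) M u where
  mem k j := by
    rw [h.mem_invSet]
    convert hu.isUnit k j using 3
    ring
  two_ne := hu.hatD_ne
  add_ne := hu.add_ne
  sub_ne := hu.sub_ne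

end OpenChain

theorem mainTheorem3 (ħ : ℂ) (r : ℕ) {V : Type*} [AddCommGroup V] [Module ℂ V]
    [FiniteDimensional ℂ V]
    (ρ : OpenChain.Yangian ħ (r + 2) →ₐ[ℂ] Module.End ℂ V)
    (T : Matrix (Fin (r + 2)) (Fin (r + 2)) (Polynomial (Module.End ℂ V)))
    (hT : OpenChain.IsMonodromy ρ T)
    (Ω : V) (hΩ : OpenChain.IsHighestWeightVector ρ Ω)
    (a : ℕ) (c : ℂ)
    (M : Fin (r + 1) → ℕ) (u : (k : Fin (r + 1)) → Fin (M k) → ℂ)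
    (hu : OpenChain.IsRegular ħ T M u) :
    (∀ π : (k : Fin (r + 1)) → Equiv.Perm (Fin (M k)),
      OpenChain.betheTrace ħ (OpenChain.openMonodromy T a c) M π (fun k j => u k (π k j)) Ω =
          OpenChain.betheTrace ħ (OpenChain.openMonodromy T a c) M (fun _ => 1) u Ω ∧
        OpenChain.betheTrace ħ (OpenChain.openMonodromy T a c) M (fun _ => 1)
            (fun k j => u k (π k j)) Ω =
          OpenChain.betheTrace ħ (OpenChain.openMonodromy T a c) M (fun _ => 1) u Ω) ∧
    ((∀ (k : Fin (r + 1)) (j : Fin (M k)) (l : ℕ), 1 ≤ l → l ≤ (k : ℕ) → 2 * u k j + l * ħ ≠ 0) →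
      OpenChain.betheTrace ħ (OpenChain.openMonodromy T a c) M (fun _ => 1) u Ω =
          OpenChain.contractB ħ (OpenChain.openMonodromy T a c) (u 0)
            (OpenChain.betheTrace ħ
              (OpenChain.psiGen ħ (u 0) (OpenChain.openMonodromy T a c))
              (fun k => M k.succ) (fun _ => 1) (fun k => u k.succ)) Ω ∧
        OpenChain.betheTrace ħ (OpenChain.openMonodromy T a c) M (fun _ => 1) u Ω =
          OpenChain.betheRec ħ (r + 1) (OpenChain.openMonodromy T a c) M u Ω) := by
  open OpenChain in
  obtain ⟨d, f, hN⟩ := hT.exists_normalization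
  obtain ⟨lam, hlam⟩ := hΩ.highestCoeffs d f
  have hD := hN.rttCoeffs.reflData a c
  have hH := hN.rttCoeffs.isHighest hlam a c
  have hreg := hN.weakRegPts hu
  rw [hN.openMonodromy_eq a c]
  have hsymm := betheTrace_symm hD (weakContOn_openD a c) hH hreg
  refine ⟨fun π => ⟨?_, hsymm π⟩, fun h => ?_⟩
  -- Moving the spaces along with the parameters has no effect, so both forms of the invariance
  -- reduce to the symmetry in the parameters.
  · rw [betheTrace_relabel]
    exact hsymm π
  · exact ⟨betheTrace_smul hD (hreg.regPts h) hH,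
      (betheTrace_eq_betheRec_and_symm (r + 1) hD (hreg.regPts h) hH).1⟩
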